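/- **Model.** The model is a randomized real RAM with floor function. Memory consists of real variables, real arrays and arrays of *sketch cells*; arrays are indexed by arbitrary integers. An arithmetic operation ($+,-,\times,/,\sqrt{\cdot},\lfloor\cdot\rfloor$), a comparison, a memory access, or the choice of a uniformly random element of $\{0,\dots,m\}$ takes $O(1)$ time. Sketches are opaque: a program may only copy a sketch, join two sketches, or query the membership oracle on a sketch, and each of these takes time $\tau$, where $\tau\ge 1$ is an integer parameter ($\tau=O(1)$ for constant-size sketches). **Sketchable families.** Let $P$ be a finite set. A family $\mathcal F$ of subsets of $P$ is *upward closed* if $X\in\mathcal F$ and $X\subseteq Y\subseteq P$ imply $Y\in\mathcal F$. It is *sketchable* if moreover every $S\subseteq P$ has a sketch $\mathrm{sk}(S)$ such that, for disjoint $S,T\subseteq P$, the join operation computes $\mathrm{sk}(S\cup T)$ from $\mathrm{sk}(S)$ and $\mathrm{sk}(T)$, and the membership oracle decides from $\mathrm{sk}(S)$ whether $S\in\mathcal F$. **Theorem.** For every $d\ge 1$ there are a program and a constant $C>0$, depending only on $d$, such that the following holds for every set $P\subseteq\mathbb R^d$ of $n\ge 1$ distinct points, every nonempty sketchable family $(P,\mathcal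 F)$, and every $\varepsilon\in(0,1)$. Among the closed balls $b$ of $\mathbb R^d$ (of radius $\ge 0$) with $b\cap P\in\mathcal F$ there is one of smallest radius $\rho$. Given $n$, $\varepsilon$, the points of $P$ in any order, the sketches of the singletons $\{x\}$, $x\in P$, and the sketch of $\emptyset$, the program halts almost surely; whenever it halts, it outputs a number in $[\rho,(1+\varepsilon)\rho]$; and its expected running time is at most $C\,\tau\, n/\varepsilon^d$. In particular the expected running time is $O(n/\varepsilon^d)$ if the sketch operations take $O(1)$ time. In particular, the same program $(1+\varepsilon)$-approximates, in this sense, 1. the radius of the smallest ball containing at least $k$ points of $P$, for $0\le k\le n$, in expected time at most $C\,n/\varepsilon^d$ (the sketch of a set is its cardinality, $\tau=1$); 2. if the points of $P$ are coloured by $K$ colours, the radius of the smallest ball containing points of at least $t$ different colours, for every $t$ not exceeding the number of colours that appear in $P$, in expected time at most $C\,nK/\varepsilon^d$ (the sketch of a set is the $K$-dimensional bit vector of the colours that appear in it, $\tau=K$). -/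

import Mathlib

/-! ## Sketchable families -/

/-- A sketching scheme for a family `F` of subsets of a finite ground set `α`: every subset has a
sketch (an element of `S`), the sketch of a disjoint union is computed from the two sketches by
`join`, and membership in `F` is decided from the sketch by `oracle`.  What these operations cost
is a parameter of the machine model below. -/
structure Sketching {α : Type} [DecidableEq α] (F : Set (Finset α)) (S : Type) where
  sketch : Finset α → S
  join : S → S → S
  oracle : S → Bool
  join_sketch : ∀ A B : Finset α, Disjoint A B → join (sketch A) (sketch B) = sketch (A ∪ B)
  oracle_sketch : ∀ A : Finset α, oracle (sketch A) = true ↔ A ∈ F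

/-- The sets with at least `k` elements. -/
def countFamily (α : Type) (k : ℕ) : Set (Finset α) := {A | k ≤ A.card}

/-- The sketch of a set is its number of elements. -/
def countSketching (α : Type) [DecidableEq α] (k : ℕ) : Sketching (countFamily α k) ℕ where
  sketch A := A.card
  join a b := a + b
  oracle a := decide (k ≤ a)
  join_sketch A B h := (Finset.card_union_of_disjoint h).symm
  oracle_sketch A := by simp [countFamily]

/-- The sets in which at least `t` different colours appear. -/
def colourFamily {α : Type} {K : ℕ} (χ : α → Fin K) (t : ℕ) : Set (Finset α) :=
  {A | t ≤ (A.image χ).card}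

/-- The sketch of a set is the bit vector, of length `K`, of the colours that appear in it. -/
def colourSketching {α : Type} [DecidableEq α] {K : ℕ} (χ : α → Fin K) (t : ℕ) :
    Sketching (colourFamily χ t) (Fin K → Bool) where
  sketch A := fun c => decide (c ∈ A.image χ)
  join u v := fun c => u c || v c
  oracle u := decide (t ≤ (Finset.univ.filter fun c => u c = true).card)
  join_sketch A B _ := by
    funext c
    simp only [Finset.image_union, Finset.mem_union, Bool.decide_or]
  oracle_sketch A := by
    have h : (Finset.univ.filter fun c => decide (c ∈ A.image χ) = true) = A.image χ := by
      ext c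
      simp
    rw [h]
    simp [colourFamily]

/-! ## The problem -/

open Classical in
/-- The (indices of the) points of `P` in the closed ball with centre `c` and radius `r`. -/
noncomputable def pointsInBall {d n : ℕ} (P : Fin n → EuclideanSpace ℝ (Fin d))
    (c : EuclideanSpace ℝ (Fin d)) (r : ℝ) : Finset (Fin n) :=
  Finset.univ.filter fun i => P i ∈ Metric.closedBall c r

/-- The radii of the balls `b` with `b ∩ P ∈ F`. -/
def ballRadii {d n : ℕ} (P : Fin n → EuclideanSpace ℝ (Fin d)) (F : Set (Finset (Fin n))) :
    Set ℝ :=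
  {r | 0 ≤ r ∧ ∃ c : EuclideanSpace ℝ (Fin d), pointsInBall P c r ∈ F}

/-! ## The machine: a randomized real RAM with floor function and sketch cells -/

namespace RealRAM

/-- Arithmetic expressions over real variables and real arrays.  `read a e` is the cell of array
`a` whose integer address is the integer part of the value of `e`. -/
inductive Expr : Type
  | var (x : ℕ)
  | const (z : ℤ)
  | read (a : ℕ) (e : Expr)
  | add (e₁ e₂ : Expr)
  | sub (e₁ e₂ : Expr)
  | mul (e₁ e₂ : Expr)
  | div (e₁ e₂ : Expr)
  | floor (e : Expr)
  | sqrt (e : Expr)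

inductive Test : Type
  | lt (e₁ e₂ : Expr)
  | not (b : Test)
  | and (b₁ b₂ : Test)

/-- Programs.  They are finite and do not depend on the input. Sketches are opaque: a program can
only move them, join two of them, and ask the membership oracle about one of them. -/
inductive Prog : Type
  | skip
  /-- `x := e` -/
  | assign (x : ℕ) (e : Expr)
  /-- `a[i] := e` -/
  | write (a : ℕ) (i e : Expr)
  /-- `x :=` a uniformly random element of `{0, 1, …, ⌊e⌋}` -/
  | rand (x : ℕ) (e : Expr)
  /-- sketch cells: `a[i] := b[j]` -/
  | skCopy (a : ℕ) (i : Expr) (b : ℕ) (j : Expr)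
  /-- sketch cells: `a[i] := join (a[i]) (b[j])` -/
  | skJoin (a : ℕ) (i : Expr) (b : ℕ) (j : Expr)
  /-- `x := 1` if the oracle accepts the sketch in the sketch cell `a[i]`, and `x := 0` if not -/
  | skQuery (x : ℕ) (a : ℕ) (i : Expr)
  | seq (p q : Prog)
  | ite (b : Test) (p q : Prog)
  | while (b : Test) (p : Prog)

/-- Memory: real variables, real arrays, and arrays of sketches. -/
structure State (S : Type) where
  var : ℕ → ℝ
  arr : ℕ → ℤ → ℝ
  sk : ℕ → ℤ → S

noncomputable def Expr.eval {S : Type} (s : State S) : Expr → ℝ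
  | .var x => s.var x
  | .const z => z
  | .read a e => s.arr a ⌊e.eval s⌋
  | .add e₁ e₂ => e₁.eval s + e₂.eval s
  | .sub e₁ e₂ => e₁.eval s - e₂.eval s
  | .mul e₁ e₂ => e₁.eval s * e₂.eval s
  | .div e₁ e₂ => e₁.eval s / e₂.eval s
  | .floor e => (⌊e.eval s⌋ : ℝ)
  | .sqrt e => Real.sqrt (e.eval s)

def Test.holds {S : Type} (s : State S) : Test → Prop
  | .lt e₁ e₂ => e₁.eval s < e₂.eval s
  | .not b => ¬ b.holds s
  | .and b₁ b₂ => b₁.holds s ∧ b₂.holds s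

def State.setVar {S : Type} (s : State S) (x : ℕ) (v : ℝ) : State S :=
  { s with var := Function.update s.var x v }

def State.setArr {S : Type} (s : State S) (a : ℕ) (i : ℤ) (v : ℝ) : State S :=
  { s with arr := Function.update s.arr a (Function.update (s.arr a) i v) }

def State.setSk {S : Type} (s : State S) (a : ℕ) (i : ℤ) (v : S) : State S :=
  { s with sk := Function.update s.sk a (Function.update (s.sk a) i v) }

/-- A configuration: the programs still to be executed, in this order, and the memory.
The machine has halted when nothing is left to be executed. -/
abbrev Conf (S : Type) := List Prog × State S

open Classical in
/-- The distribution of the next configuration. -/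
noncomputable def step {S : Type} (join : S → S → S) (oracle : S → Bool) :
    Conf S → PMF (Conf S)
  | ([], s) => PMF.pure ([], s)
  | (.skip :: k, s) => PMF.pure (k, s)
  | (.assign x e :: k, s) => PMF.pure (k, s.setVar x (e.eval s))
  | (.write a i e :: k, s) => PMF.pure (k, s.setArr a ⌊i.eval s⌋ (e.eval s))
  | (.rand x e :: k, s) =>
      PMF.map (fun j : Fin (⌊e.eval s⌋₊ + 1) => (k, s.setVar x (j.val : ℝ)))
        (PMF.uniformOfFintype (Fin (⌊e.eval s⌋₊ + 1)))
  | (.skCopy a i b j :: k, s) => PMF.pure (k, s.setSk a ⌊i.eval s⌋ (s.sk b ⌊j.eval s⌋))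
  | (.skJoin a i b j :: k, s) =>
      PMF.pure (k, s.setSk a ⌊i.eval s⌋ (join (s.sk a ⌊i.eval s⌋) (s.sk b ⌊j.eval s⌋)))
  | (.skQuery x a i :: k, s) =>
      PMF.pure (k, s.setVar x (if oracle (s.sk a ⌊i.eval s⌋) = true then 1 else 0))
  | (.seq p q :: k, s) => PMF.pure (p :: q :: k, s)
  | (.ite b p q :: k, s) => PMF.pure (if b.holds s then p :: k else q :: k, s)
  | (.while b p :: k, s) => PMF.pure (if b.holds s then p :: .while b p :: k else k, s)

/-- The time of the next step: an instruction on sketches takes time `τ`, any other one (a fixed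
number of arithmetic operations, comparisons and memory accesses) takes time `1`. -/
def stepCost {S : Type} (τ : ℕ) : Conf S → ℕ
  | ([], _) => 0
  | (.skCopy _ _ _ _ :: _, _) => τ
  | (.skJoin _ _ _ _ :: _, _) => τ
  | (.skQuery _ _ _ :: _, _) => τ
  | (_ :: _, _) => 1

/-- The expected time of the first `m` steps from a configuration. -/
noncomputable def expectedTimeOfSteps {S : Type} (join : S → S → S) (oracle : S → Bool) (τ : ℕ) :
    ℕ → Conf S → ENNReal
  | 0, _ => 0
  | m + 1, c =>
      (stepCost τ c : ENNReal)
        + ∑' c', step join oracle c c' * expectedTimeOfSteps join oracle τ m c'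

/-- The expected running time from a configuration (infinite unless the machine halts
almost surely, when `τ ≠ 0`). -/
noncomputable def expectedTime {S : Type} (join : S → S → S) (oracle : S → Bool) (τ : ℕ)
    (c : Conf S) : ENNReal :=
  ⨆ m : ℕ, expectedTimeOfSteps join oracle τ m c

/-- `c'` occurs with positive probability in a run from `c`. -/
def Reaches {S : Type} (join : S → S → S) (oracle : S → Bool) : Conf S → Conf S → Prop :=
  Relation.ReflTransGen fun c c' => c' ∈ (step join oracle c).support

open Classical in
/-- The input: variable `0` holds `n`, variable `1` holds `ε`, the cell `i` of array `j < d` holds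
the `j`-th coordinate of the point `i`, the cell `i` of sketch array `0` holds the sketch of `{i}`.
All other cells are zero, respectively hold the sketch of the empty set. -/
noncomputable def inputState {d n : ℕ} {S : Type} (P : Fin n → EuclideanSpace ℝ (Fin d)) (ε : ℝ)
    (sketch : Finset (Fin n) → S) : State S where
  var x := if x = 0 then n else if x = 1 then ε else 0
  arr j i := if h : j < d ∧ 0 ≤ i ∧ i.toNat < n then P ⟨i.toNat, h.2.2⟩ ⟨j, h.1⟩ else 0
  sk a i := if h : a = 0 ∧ 0 ≤ i ∧ i.toNat < n then sketch {⟨i.toNat, h.2.2⟩} else sketch ∅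

/-- On the points `P`, the family `F` (given through its sketches) and the accuracy `ε`, there is a
smallest ball `b` with `b ∩ P ∈ F`, every halting run of `p` leaves in variable `0` a number between
its radius and `1 + ε` times its radius, and the expected running time of `p` is at most `T`, if
an instruction on sketches takes time `τ`. -/
def ApproximatesSmallestBall {d n : ℕ} {S : Type} (p : Prog)
    (P : Fin n → EuclideanSpace ℝ (Fin d)) {F : Set (Finset (Fin n))} (σ : Sketching F S) (τ : ℕ)
    (ε T : ℝ) : Prop :=
  ∃ ρ : ℝ, IsLeast (ballRadii P F) ρ ∧
    (∀ s : State S, Reaches σ.join σ.oracle ([p], inputState P ε σ.sketch) ([], s) →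
      ρ ≤ s.var 0 ∧ s.var 0 ≤ (1 + ε) * ρ) ∧
    expectedTime σ.join σ.oracle τ ([p], inputState P ε σ.sketch) ≤ ENNReal.ofReal T

end RealRAM

/-! The program is a net-and-prune algorithm. It keeps a list of representatives, each standing for
a cluster of points within distance `E` of it, such that all points of some optimal ball are
represented and `3 * E ≤ ρ`. A round draws a random representative, computes the distance `ℓ` to its
nearest neighbour in the list, and compares `ρ` with multiples of `u = ℓ / 16`. To compare with `R`,
take a lattice so fine that every point is within `u` of the corner of its cell, join the sketch of
each cluster into all lattice points within `R` of its representative, and query. Acceptance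
somewhere gives `ρ ≤ R + E` (`Clustering.le_of_hitSet_mem`). Rejection everywhere gives `R < ρ + E +
u`, because an optimal centre can be rounded to the lattice (`Clustering.lt_of_hitSet_notMem`).

If `ρ` is small compared with `ℓ`, isolated representatives cannot belong to the optimal ball and
are dropped (`Clustering.prune`). If `ρ` is large, the list is thinned to a net at a scale
proportional to `ℓ` (`Clustering.net`). Otherwise `ρ` is known up to the factor 307. Pruning removes
everything whose nearest-neighbour distance is at least `ℓ`; a net removes at least half of what has
nearest-neighbour distance at most `ℓ` (`card_filter_close_le`). Since `ℓ` belongs to a random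
representative, a twelfth of the list is lost on average (`sq_le_twelve_mul_sum`), and the expected
cost of all rounds is linear (`mainLoop_bounded`).

From `lo ≤ ρ ≤ 307 * lo` a search shrinks the gap `h` between the two bounds by a factor 3/4 or
better in each step. A step works on all points with a lattice spacing proportional to `h` and costs
`O(n (lo / h) ^ d)`. These costs grow geometrically, so the last one, with `h` of order `ε * lo`,
dominates (`refine_spec`). The case `ρ = 0` is recognised beforehand by querying the empty set and
the singletons (`isLeast_eq_zero_iff`).

On the machine, a lattice point is encoded injectively as an integer (`gcode`) and used directly as
an address. Tables are never cleared: each pass works in a block of unused addresses, which costs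
nothing because arrays are indexed by all integers. Everything but one random draw per round is
deterministic and is verified with the triples `Tri`. -/

namespace RealRAM

/-! ### Big-step semantics of deterministic programs -/

section Semantics

variable {S : Type}

/-- `Run jn orc τ p s t s'`: the deterministic program `p` leads from `s` to `s'` in time `t`. -/
inductive Run (jn : S → S → S) (orc : S → Bool) (τ : ℕ) :
    Prog → State S → ℕ → State S → Prop
  | skip (s : State S) : Run jn orc τ .skip s 1 s
  | assign (x : ℕ) (e : Expr) (s : State S) :
      Run jn orc τ (.assign x e) s 1 (s.setVar x (e.eval s))
  | write (a : ℕ) (i e : Expr) (s : State S) :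
      Run jn orc τ (.write a i e) s 1 (s.setArr a ⌊i.eval s⌋ (e.eval s))
  | skCopy (a : ℕ) (i : Expr) (b : ℕ) (j : Expr) (s : State S) :
      Run jn orc τ (.skCopy a i b j) s τ (s.setSk a ⌊i.eval s⌋ (s.sk b ⌊j.eval s⌋))
  | skJoin (a : ℕ) (i : Expr) (b : ℕ) (j : Expr) (s : State S) :
      Run jn orc τ (.skJoin a i b j) s τ
        (s.setSk a ⌊i.eval s⌋ (jn (s.sk a ⌊i.eval s⌋) (s.sk b ⌊j.eval s⌋)))
  | skQuery (x a : ℕ) (i : Expr) (s : State S) :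
      Run jn orc τ (.skQuery x a i) s τ
        (s.setVar x (if orc (s.sk a ⌊i.eval s⌋) = true then 1 else 0))
  | seq {p q : Prog} {s s' s'' : State S} {t t' : ℕ} :
      Run jn orc τ p s t s' → Run jn orc τ q s' t' s'' →
      Run jn orc τ (.seq p q) s (1 + t + t') s''
  | ite_pos {b : Test} {p q : Prog} {s s' : State S} {t : ℕ} : b.holds s →
      Run jn orc τ p s t s' → Run jn orc τ (.ite b p q) s (1 + t) s'
  | ite_neg {b : Test} {p q : Prog} {s s' : State S} {t : ℕ} : ¬ b.holds s →
      Run jn orc τ q s t s' → Run jn orc τ (.ite b p q) s (1 + t) s'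
  | while_pos {b : Test} {p : Prog} {s s' s'' : State S} {t t' : ℕ} : b.holds s →
      Run jn orc τ p s t s' → Run jn orc τ (.while b p) s' t' s'' →
      Run jn orc τ (.while b p) s (1 + t + t') s''
  | while_neg {b : Test} {p : Prog} {s : State S} : ¬ b.holds s →
      Run jn orc τ (.while b p) s 1 s

/-- Every configuration that is halted and reached within `N` steps satisfies `Q`. -/
def Safe (jn : S → S → S) (orc : S → Bool) (Q : State S → Prop) : ℕ → Conf S → Prop
  | 0, c => c.1 = [] → Q c.2
  | N + 1, c => (c.1 = [] → Q c.2) ∧ ∀ c' ∈ (step jn orc c).support, Safe jn orc Q N c'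

variable {jn : S → S → S} {orc : S → Bool} {τ : ℕ} {Q : State S → Prop}

theorem Safe.of_succ : ∀ {N : ℕ} {c : Conf S}, Safe jn orc Q (N + 1) c → Safe jn orc Q N c
  | 0, _, h => h.1
  | _ + 1, _, h => ⟨h.1, fun c' hc' => (h.2 c' hc').of_succ⟩

/-- A halting run has finitely many steps, so safety for every step budget covers it. -/
theorem Safe.reaches {c : Conf S} {z : State S} (h : ∀ N, Safe jn orc Q N c)
    (hr : Reaches jn orc c ([], z)) : Q z := by
  unfold Reaches at hr
  induction hr using Relation.ReflTransGen.head_induction_on with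
  | refl => exact h 0 rfl
  | head hab _ ih => exact ih fun N => (h (N + 1)).2 _ hab

theorem expectedTimeOfSteps_le_succ (N : ℕ) (c : Conf S) :
    expectedTimeOfSteps jn orc τ N c ≤ expectedTimeOfSteps jn orc τ (N + 1) c := by
  induction N generalizing c with
  | zero => exact zero_le
  | succ N ih =>
    have h : ∀ N, expectedTimeOfSteps jn orc τ (N + 1) c = (stepCost τ c : ENNReal)
        + ∑' c', step jn orc c c' * expectedTimeOfSteps jn orc τ N c' := fun _ => rfl
    rw [h, h]
    gcongr
    exact ih _

/-- Within `N` steps from `c`, the expected time is at most `X` and the halted configurations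
satisfy `Q`. -/
def Bounded (jn : S → S → S) (orc : S → Bool) (τ : ℕ) (Q : State S → Prop) (N : ℕ) (c : Conf S)
    (X : ENNReal) : Prop :=
  expectedTimeOfSteps jn orc τ N c ≤ X ∧ Safe jn orc Q N c

theorem Bounded.of_succ {N : ℕ} {c : Conf S} {X : ENNReal}
    (h : Bounded jn orc τ Q (N + 1) c X) : Bounded jn orc τ Q N c X :=
  ⟨(expectedTimeOfSteps_le_succ N c).trans h.1, h.2.of_succ⟩

theorem Bounded.mono {N : ℕ} {c : Conf S} {X Y : ENNReal}
    (h : Bounded jn orc τ Q N c X) (hXY : X ≤ Y) : Bounded jn orc τ Q N c Y :=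
  ⟨h.1.trans hXY, h.2⟩

theorem bounded_zero (p : Prog) (k : List Prog) (s : State S) (X : ENNReal) :
    Bounded jn orc τ Q 0 (p :: k, s) X :=
  ⟨zero_le, fun h => by simp at h⟩

theorem tsum_pure_mul {α : Type} (a : α) (f : α → ENNReal) :
    ∑' b, (PMF.pure a) b * f b = f a := by
  rw [tsum_eq_single a]
  · simp
  · intro b hb
    simp [PMF.pure_apply, hb]

theorem bounded_step {N : ℕ} {p : Prog} {k : List Prog} {s : State S} {c' : Conf S}
    {X : ENNReal} (hs : step jn orc (p :: k, s) = PMF.pure c')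
    (h : Bounded jn orc τ Q N c' X) :
    Bounded jn orc τ Q (N + 1) (p :: k, s) (stepCost τ (p :: k, s) + X) := by
  refine ⟨?_, fun h => by simp at h, fun c hc => ?_⟩
  · rw [expectedTimeOfSteps, hs, tsum_pure_mul]
    gcongr
    exact h.1
  · rw [hs] at hc
    simp only [PMF.support_pure, Set.mem_singleton_iff] at hc
    exact hc ▸ h.2

/-- The budget `N` is the same before and after `p`, although `p` consumes part of it: `Bounded`
only gets weaker when the budget shrinks, so steps need not be counted. -/
theorem Run.bounded {p : Prog} {s s' : State S} {t : ℕ} (hr : Run jn orc τ p s t s') :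
    ∀ (N : ℕ) (k : List Prog) (X : ENNReal), Bounded jn orc τ Q N (k, s') X →
      Bounded jn orc τ Q N (p :: k, s) (t + X) := by
  have base : ∀ {p : Prog} {s s' : State S} {t : ℕ},
      (∀ k, step jn orc (p :: k, s) = PMF.pure (k, s')) →
      (∀ k, stepCost τ (p :: k, s) = t) →
      ∀ (N : ℕ) (k : List Prog) (X : ENNReal), Bounded jn orc τ Q N (k, s') X →
      Bounded jn orc τ Q N (p :: k, s) (t + X) := by
    intro p s s' t h1 h2 N k X hX
    cases N with
    | zero => exact bounded_zero _ _ _ _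
    | succ N => exact h2 k ▸ bounded_step (h1 k) hX.of_succ
  induction hr with
  | skip s => exact base (fun _ => rfl) (fun _ => rfl)
  | assign x e s => exact base (fun _ => rfl) (fun _ => rfl)
  | write a i e s => exact base (fun _ => rfl) (fun _ => rfl)
  | skCopy a i b j s => exact base (fun _ => rfl) (fun _ => rfl)
  | skJoin a i b j s => exact base (fun _ => rfl) (fun _ => rfl)
  | skQuery x a i s => exact base (fun _ => rfl) (fun _ => rfl)
  | seq _ _ ih1 ih2 =>
    intro N k X hX
    cases N with
    | zero => exact bounded_zero _ _ _ _
    | succ N =>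
      refine (bounded_step rfl (ih1 N _ _ (ih2 N _ _ hX.of_succ))).mono (le_of_eq ?_)
      simp [stepCost, add_assoc]
  | @ite_pos b p q s s' t hb _ ih =>
    intro N k X hX
    cases N with
    | zero => exact bounded_zero _ _ _ _
    | succ N =>
      refine (bounded_step (c' := (p :: k, s)) (by simp [step, hb])
        (ih N _ _ hX.of_succ)).mono (le_of_eq ?_)
      simp [stepCost, add_assoc]
  | @ite_neg b p q s s' t hb _ ih =>
    intro N k X hX
    cases N with
    | zero => exact bounded_zero _ _ _ _
    | succ N =>
      refine (bounded_step (c' := (q :: k, s)) (by simp [step, hb])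
        (ih N _ _ hX.of_succ)).mono (le_of_eq ?_)
      simp [stepCost, add_assoc]
  | @while_pos b p s s' s'' t t' hb _ _ ih1 ih2 =>
    intro N k X hX
    cases N with
    | zero => exact bounded_zero _ _ _ _
    | succ N =>
      refine (bounded_step (c' := (p :: .while b p :: k, s)) (by simp [step, hb])
        (ih1 N _ _ (ih2 N _ _ hX.of_succ))).mono (le_of_eq ?_)
      simp [stepCost, add_assoc]
  | @while_neg b p s hb =>
    intro N k X hX
    cases N with
    | zero => exact bounded_zero _ _ _ _
    | succ N =>
      refine (bounded_step (c' := (k, s)) (by simp [step, hb]) hX.of_succ).mono (le_of_eq ?_)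
      simp [stepCost]

theorem tsum_map_mul {α β : Type} (f : α → β) (p : PMF α) (g : β → ENNReal) :
    ∑' b, (PMF.map f p) b * g b = ∑' a, p a * g (f a) := by
  classical
  simp_rw [PMF.map_apply, ← ENNReal.tsum_mul_right]
  rw [ENNReal.tsum_comm]
  refine tsum_congr fun a => ?_
  rw [tsum_eq_single (f a)]
  · simp
  · intro b hb
    simp [hb]

/-- The bounds `Y` may depend on the outcome and enter only through their sum. This is what the
amortised analysis of the random round needs. -/
theorem bounded_rand {N : ℕ} {x : ℕ} {e : Expr} {k : List Prog} {s : State S} {m : ℕ}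
    {X : ENNReal} {Y : Fin (m + 1) → ENNReal} (he : ⌊e.eval s⌋₊ = m)
    (h : ∀ j : Fin (m + 1), Bounded jn orc τ Q N (k, s.setVar x (j.val : ℝ)) (Y j))
    (hX : ∑ j, Y j ≤ (m + 1 : ℕ) * X) :
    Bounded jn orc τ Q (N + 1) (.rand x e :: k, s) (1 + X) := by
  subst he
  refine ⟨?_, fun h => by simp at h, fun c hc => ?_⟩
  · rw [expectedTimeOfSteps]
    simp only [stepCost, step, tsum_map_mul]
    rw [tsum_fintype]
    gcongr
    · simp
    · calc ∑ a : Fin (⌊e.eval s⌋₊ + 1), PMF.uniformOfFintype (Fin (⌊e.eval s⌋₊ + 1)) a *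
              expectedTimeOfSteps jn orc τ N (k, s.setVar x (a.val : ℝ))
          = ∑ a : Fin (⌊e.eval s⌋₊ + 1), (⌊e.eval s⌋₊ + 1 : ENNReal)⁻¹ *
              expectedTimeOfSteps jn orc τ N (k, s.setVar x (a.val : ℝ)) := by simp
        _ ≤ (⌊e.eval s⌋₊ + 1 : ENNReal)⁻¹ * ∑ a, Y a := by
            rw [Finset.mul_sum]
            gcongr with a
            exact (h a).1
        _ ≤ (⌊e.eval s⌋₊ + 1 : ENNReal)⁻¹ * ((⌊e.eval s⌋₊ + 1 : ℕ) * X) := by gcongr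
        _ = X := by
            rw [← mul_assoc]
            push_cast
            rw [ENNReal.inv_mul_cancel (by simp) (by finiteness), one_mul]
  · simp only [step, PMF.support_map, Set.mem_image] at hc
    obtain ⟨j, _, rfl⟩ := hc
    exact (h j).2

/-! ### What a program may change -/

/-- `p` may change the variable `x`. -/
def Prog.wv : Prog → ℕ → Prop
  | .skip, _ => False
  | .assign y _, x => x = y
  | .write _ _ _, _ => False
  | .rand y _, x => x = y
  | .skCopy _ _ _ _, _ => False
  | .skJoin _ _ _ _, _ => False
  | .skQuery y _ _, x => x = y
  | .seq p q, x => p.wv x ∨ q.wv x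
  | .ite _ p q, x => p.wv x ∨ q.wv x
  | .while _ p, x => p.wv x

/-- `p` may change the array `a`. -/
def Prog.wa : Prog → ℕ → Prop
  | .skip, _ => False
  | .assign _ _, _ => False
  | .write b _ _, a => a = b
  | .rand _ _, _ => False
  | .skCopy _ _ _ _, _ => False
  | .skJoin _ _ _ _, _ => False
  | .skQuery _ _ _, _ => False
  | .seq p q, a => p.wa a ∨ q.wa a
  | .ite _ p q, a => p.wa a ∨ q.wa a
  | .while _ p, a => p.wa a

/-- `p` may change the sketch array `a`. -/
def Prog.wk : Prog → ℕ → Prop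
  | .skip, _ => False
  | .assign _ _, _ => False
  | .write _ _ _, _ => False
  | .rand _ _, _ => False
  | .skCopy b _ _ _, a => a = b
  | .skJoin b _ _ _, a => a = b
  | .skQuery _ _ _, _ => False
  | .seq p q, a => p.wk a ∨ q.wk a
  | .ite _ p q, a => p.wk a ∨ q.wk a
  | .while _ p, a => p.wk a

/-- `s'` differs from `s` only where `p` may write. -/
structure Frame (p : Prog) (s s' : State S) : Prop where
  var : ∀ x, ¬ p.wv x → s'.var x = s.var x
  arr : ∀ a, ¬ p.wa a → s'.arr a = s.arr a
  sk : ∀ a, ¬ p.wk a → s'.sk a = s.sk a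

@[simp] theorem setVar_var (s : State S) (x : ℕ) (v : ℝ) (y : ℕ) :
    (s.setVar x v).var y = if y = x then v else s.var y := by
  simp [State.setVar, Function.update_apply]
@[simp] theorem setVar_arr (s : State S) (x : ℕ) (v : ℝ) : (s.setVar x v).arr = s.arr := rfl
@[simp] theorem setVar_sk (s : State S) (x : ℕ) (v : ℝ) : (s.setVar x v).sk = s.sk := rfl
@[simp] theorem setArr_var (s : State S) (a : ℕ) (i : ℤ) (v : ℝ) :
    (s.setArr a i v).var = s.var := rfl
@[simp] theorem setArr_sk (s : State S) (a : ℕ) (i : ℤ) (v : ℝ) :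
    (s.setArr a i v).sk = s.sk := rfl
@[simp] theorem setArr_arr (s : State S) (a : ℕ) (i : ℤ) (v : ℝ) (b : ℕ) :
    (s.setArr a i v).arr b = if b = a then Function.update (s.arr a) i v else s.arr b := by
  by_cases h : b = a
  · subst h; simp [State.setArr]
  · simp [State.setArr, h]
@[simp] theorem setSk_var (s : State S) (a : ℕ) (i : ℤ) (v : S) :
    (s.setSk a i v).var = s.var := rfl
@[simp] theorem setSk_arr (s : State S) (a : ℕ) (i : ℤ) (v : S) :
    (s.setSk a i v).arr = s.arr := rfl
@[simp] theorem setSk_sk (s : State S) (a : ℕ) (i : ℤ) (v : S) (b : ℕ) :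
    (s.setSk a i v).sk b = if b = a then Function.update (s.sk a) i v else s.sk b := by
  by_cases h : b = a
  · subst h; simp [State.setSk]
  · simp [State.setSk, h]

theorem Frame.trans {p : Prog} {s s' s'' : State S} (h : Frame p s s') (h' : Frame p s' s'') :
    Frame p s s'' :=
  ⟨fun x hx => (h'.var x hx).trans (h.var x hx), fun x hx => (h'.arr x hx).trans (h.arr x hx),
    fun x hx => (h'.sk x hx).trans (h.sk x hx)⟩

theorem Frame.refl (p : Prog) (s : State S) : Frame p s s :=
  ⟨fun _ _ => rfl, fun _ _ => rfl, fun _ _ => rfl⟩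

theorem Frame.weaken {p q : Prog} {s s' : State S} (h : Frame p s s')
    (hv : ∀ x, p.wv x → q.wv x) (ha : ∀ x, p.wa x → q.wa x) (hk : ∀ x, p.wk x → q.wk x) :
    Frame q s s' :=
  ⟨fun x hx => h.var x fun h => hx (hv x h), fun x hx => h.arr x fun h => hx (ha x h),
    fun x hx => h.sk x fun h => hx (hk x h)⟩

theorem Run.frame {p : Prog} {s s' : State S} {t : ℕ} (hr : Run jn orc τ p s t s') :
    Frame p s s' := by
  induction hr with
  | skip s => exact Frame.refl _ _
  | assign x e s => constructor <;> intro y hy <;> simp_all [Prog.wv, Prog.wa, Prog.wk]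
  | write a i e s => constructor <;> intro y hy <;> simp_all [Prog.wv, Prog.wa, Prog.wk]
  | skCopy a i b j s => constructor <;> intro y hy <;> simp_all [Prog.wv, Prog.wa, Prog.wk]
  | skJoin a i b j s => constructor <;> intro y hy <;> simp_all [Prog.wv, Prog.wa, Prog.wk]
  | skQuery x a i s => constructor <;> intro y hy <;> simp_all [Prog.wv, Prog.wa, Prog.wk]
  | seq _ _ ih1 ih2 =>
    exact (ih1.weaken (fun _ => Or.inl) (fun _ => Or.inl) (fun _ => Or.inl)).trans
      (ih2.weaken (fun _ => Or.inr) (fun _ => Or.inr) (fun _ => Or.inr))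
  | ite_pos _ _ ih => exact ih.weaken (fun _ => Or.inl) (fun _ => Or.inl) (fun _ => Or.inl)
  | ite_neg _ _ ih => exact ih.weaken (fun _ => Or.inr) (fun _ => Or.inr) (fun _ => Or.inr)
  | while_pos _ _ _ ih1 ih2 =>
    exact Frame.trans (p := .while _ _)
      (ih1.weaken (fun _ => id) (fun _ => id) (fun _ => id)) ih2
  | while_neg _ => exact Frame.refl _ _

/-! ### Total correctness with a bound on the running time -/

/-- From `s`, the deterministic program `p` halts within time `T` in a state satisfying `Q`. -/
def Tri (jn : S → S → S) (orc : S → Bool) (τ : ℕ) (p : Prog) (s : State S) (T : ℝ)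
    (Q : State S → Prop) : Prop :=
  ∃ (t : ℕ) (s' : State S), (t : ℝ) ≤ T ∧ Run jn orc τ p s t s' ∧ Q s'

theorem Tri.mono {p : Prog} {s : State S} {T T' : ℝ} {Q Q' : State S → Prop}
    (h : Tri jn orc τ p s T Q) (hT : T ≤ T') (hQ : ∀ s', Q s' → Q' s') :
    Tri jn orc τ p s T' Q' := by
  obtain ⟨t, s', h1, h2, h3⟩ := h
  exact ⟨t, s', h1.trans hT, h2, hQ _ h3⟩

theorem Tri.frame {p : Prog} {s : State S} {T : ℝ} {Q : State S → Prop}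
    (h : Tri jn orc τ p s T Q) : Tri jn orc τ p s T fun s' => Frame p s s' ∧ Q s' := by
  obtain ⟨t, s', h1, h2, h3⟩ := h
  exact ⟨t, s', h1, h2, h2.frame, h3⟩

theorem Tri.skip {s : State S} (h : Q s) : Tri jn orc τ .skip s 1 Q :=
  ⟨1, s, by simp, .skip s, h⟩

theorem Tri.assign {s : State S} {x : ℕ} {e : Expr} (h : Q (s.setVar x (e.eval s))) :
    Tri jn orc τ (.assign x e) s 1 Q :=
  ⟨1, _, by simp, .assign x e s, h⟩

theorem Tri.write {s : State S} {a : ℕ} {i e : Expr}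
    (h : Q (s.setArr a ⌊i.eval s⌋ (e.eval s))) : Tri jn orc τ (.write a i e) s 1 Q :=
  ⟨1, _, by simp, .write a i e s, h⟩

theorem Tri.skCopy {s : State S} {a b : ℕ} {i j : Expr}
    (h : Q (s.setSk a ⌊i.eval s⌋ (s.sk b ⌊j.eval s⌋))) :
    Tri jn orc τ (.skCopy a i b j) s τ Q :=
  ⟨τ, _, by simp, .skCopy a i b j s, h⟩

theorem Tri.skJoin {s : State S} {a b : ℕ} {i j : Expr}
    (h : Q (s.setSk a ⌊i.eval s⌋ (jn (s.sk a ⌊i.eval s⌋) (s.sk b ⌊j.eval s⌋)))) :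
    Tri jn orc τ (.skJoin a i b j) s τ Q :=
  ⟨τ, _, by simp, .skJoin a i b j s, h⟩

theorem Tri.skQuery {s : State S} {x a : ℕ} {i : Expr}
    (h : Q (s.setVar x (if orc (s.sk a ⌊i.eval s⌋) = true then 1 else 0))) :
    Tri jn orc τ (.skQuery x a i) s τ Q :=
  ⟨τ, _, by simp, .skQuery x a i s, h⟩

theorem Tri.seq {p q : Prog} {s : State S} {T₁ T₂ : ℝ}
    (h : Tri jn orc τ p s T₁ fun s' => Tri jn orc τ q s' T₂ Q) :
    Tri jn orc τ (.seq p q) s (1 + T₁ + T₂) Q := by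
  obtain ⟨t, s', h1, h2, t', s'', h3, h4, h5⟩ := h
  exact ⟨_, s'', by push_cast; linarith, h2.seq h4, h5⟩

theorem Tri.ite {b : Test} {p q : Prog} {s : State S} {T₁ T₂ : ℝ}
    (hp : b.holds s → Tri jn orc τ p s T₁ Q) (hq : ¬ b.holds s → Tri jn orc τ q s T₂ Q) :
    Tri jn orc τ (.ite b p q) s (1 + max T₁ T₂) Q := by
  by_cases hb : b.holds s
  · obtain ⟨t, s', h1, h2, h3⟩ := hp hb
    exact ⟨_, s', by push_cast; linarith [le_max_left T₁ T₂], h2.ite_pos hb, h3⟩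
  · obtain ⟨t, s', h1, h2, h3⟩ := hq hb
    exact ⟨_, s', by push_cast; linarith [le_max_right T₁ T₂], h2.ite_neg hb, h3⟩

theorem Tri.while_pos {b : Test} {p : Prog} {s : State S} {T₁ T₂ : ℝ} (hb : b.holds s)
    (h : Tri jn orc τ p s T₁ fun s' => Tri jn orc τ (.while b p) s' T₂ Q) :
    Tri jn orc τ (.while b p) s (1 + T₁ + T₂) Q := by
  obtain ⟨t, s', h1, h2, t', s'', h3, h4, h5⟩ := h
  exact ⟨_, s'', by push_cast; linarith, h2.while_pos hb h4, h5⟩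

theorem Tri.while_neg {b : Test} {p : Prog} {s : State S} (hb : ¬ b.holds s) (h : Q s) :
    Tri jn orc τ (.while b p) s 1 Q :=
  ⟨1, s, by simp, .while_neg hb, h⟩

/-- `for i = 0, 1, …` as long as `i < e` do `p`. -/
def Prog.for (i : ℕ) (e : Expr) (p : Prog) : Prog :=
  .seq (.assign i (.const 0))
    (.while (.lt (.var i) e) (.seq p (.assign i (.add (.var i) (.const 1)))))

@[simp] theorem Prog.wv_for (i : ℕ) (e : Expr) (p : Prog) (x : ℕ) :
    (Prog.for i e p).wv x ↔ x = i ∨ p.wv x := by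
  simp only [Prog.for, Prog.wv]; tauto
@[simp] theorem Prog.wa_for (i : ℕ) (e : Expr) (p : Prog) (x : ℕ) :
    (Prog.for i e p).wa x ↔ p.wa x := by
  simp only [Prog.for, Prog.wa]; tauto
@[simp] theorem Prog.wk_for (i : ℕ) (e : Expr) (p : Prog) (x : ℕ) :
    (Prog.for i e p).wk x ↔ p.wk x := by
  simp only [Prog.for, Prog.wk]; tauto

/-- A round costs three units beyond the body: test, sequencing and increment. The final three pay
for the initial assignment, its sequencing and the last test. The condition `hI` lets the counter
change without disturbing the invariant. -/
theorem Tri.for {i : ℕ} {e : Expr} {p : Prog} {n : ℕ} {T : ℝ} {s₀ : State S}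
    {I : ℕ → State S → Prop} (hi : ¬ p.wv i)
    (hI : ∀ k s v, I k s → I k (s.setVar i v))
    (h0 : I 0 s₀)
    (he : ∀ (k : ℕ) s, Frame (Prog.for i e p) s₀ s → s.var i = k → I k s → e.eval s = n)
    (hp : ∀ k < n, ∀ s, Frame (Prog.for i e p) s₀ s → s.var i = k → I k s →
      Tri jn orc τ p s T (I (k + 1))) :
    Tri jn orc τ (Prog.for i e p) s₀ (n * (T + 3) + 3) (I n) := by
  -- Induction on the number `j` of rounds still to be made.
  have key : ∀ j ≤ n, ∀ s, Frame (Prog.for i e p) s₀ s → s.var i = (n - j : ℕ) → I (n - j) s →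
      Tri jn orc τ (.while (.lt (.var i) e) (.seq p (.assign i (.add (.var i) (.const 1))))) s
        (j * (T + 3) + 1) (I n) := by
    intro j
    induction j with
    | zero =>
      intro _ s hf hs hIs
      refine (Tri.while_neg ?_ hIs).mono (by simp) fun _ h => h
      simp [Test.holds, he _ s hf hs hIs, Expr.eval, hs]
    | succ j ih =>
      intro hj s hf hs hIs
      have h1 : n - (j + 1) + 1 = n - j := by omega
      have hrun := (hp (n - (j + 1)) (by omega) s hf hs hIs).frame
      rw [h1] at hrun
      refine (Tri.while_pos (T₁ := 1 + T + 1) ?_ (Tri.seq (hrun.mono le_rfl ?_))).mono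
        (T := 1 + (1 + T + 1) + (j * (T + 3) + 1)) (by push_cast; linarith) fun _ h => h
      · simp only [Test.holds, he _ s hf hs hIs, Expr.eval, hs]
        exact_mod_cast (by omega : n - (j + 1) < n)
      · rintro s' ⟨hf', hI'⟩
        refine Tri.assign (ih (by omega) _ ?_ ?_ ?_)
        · refine hf.trans ⟨fun x hx => ?_, fun x hx => ?_, fun x hx => ?_⟩
          · simp only [Prog.wv_for, not_or] at hx
            simp [hx.1, hf'.var x hx.2]
          · simp only [Prog.wa_for] at hx
            simp [hf'.arr x hx]
          · simp only [Prog.wk_for] at hx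
            simp [hf'.sk x hx]
        · simp only [Expr.eval, setVar_var, hf'.var i hi, hs, if_true]
          exact_mod_cast h1
        · exact hI _ _ _ hI'
  refine (Tri.seq (Tri.assign (key n le_rfl _ ?_ ?_ ?_))).mono (by linarith) fun _ h => h
  · refine ⟨fun x hx => ?_, fun x hx => rfl, fun x hx => rfl⟩
    simp only [Prog.wv_for, not_or] at hx
    simp [hx.1]
  · simp [Expr.eval]
  · rw [Nat.sub_self]
    exact hI _ _ _ h0

/-! ### Expressions -/

instance : Add Expr := ⟨Expr.add⟩
instance : Sub Expr := ⟨Expr.sub⟩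
instance : Mul Expr := ⟨Expr.mul⟩
instance : Div Expr := ⟨Expr.div⟩
instance (n : ℕ) : OfNat Expr n := ⟨Expr.const n⟩

/-- `e ^ k` -/
def Expr.power (e : Expr) : ℕ → Expr
  | 0 => 1
  | k + 1 => e.power k * e

/-- `f 0 + ⋯ + f (d - 1)` -/
def Expr.sum (f : ℕ → Expr) : ℕ → Expr
  | 0 => 0
  | k + 1 => Expr.sum f k + f k

variable (s : State S)

@[simp] theorem Expr.eval_var (x : ℕ) : (Expr.var x).eval s = s.var x := rfl
@[simp] theorem Expr.eval_const (z : ℤ) : (Expr.const z).eval s = z := rfl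
@[simp] theorem Expr.eval_read (a : ℕ) (e : Expr) :
    (Expr.read a e).eval s = s.arr a ⌊e.eval s⌋ := rfl
@[simp] theorem Expr.eval_floor (e : Expr) : (Expr.floor e).eval s = ⌊e.eval s⌋ := rfl
@[simp] theorem Expr.eval_sqrt (e : Expr) : (Expr.sqrt e).eval s = Real.sqrt (e.eval s) := rfl
@[simp] theorem Expr.eval_hadd (a b : Expr) : (a + b).eval s = a.eval s + b.eval s := rfl
@[simp] theorem Expr.eval_hsub (a b : Expr) : (a - b).eval s = a.eval s - b.eval s := rfl
@[simp] theorem Expr.eval_hmul (a b : Expr) : (a * b).eval s = a.eval s * b.eval s := rfl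
@[simp] theorem Expr.eval_hdiv (a b : Expr) : (a / b).eval s = a.eval s / b.eval s := rfl
@[simp] theorem Expr.eval_zero : (0 : Expr).eval s = 0 := by
  change ((0 : ℤ) : ℝ) = 0; simp
@[simp] theorem Expr.eval_one : (1 : Expr).eval s = 1 := by
  change ((1 : ℤ) : ℝ) = 1; simp
@[simp] theorem Expr.eval_ofNat (n : ℕ) [n.AtLeastTwo] :
    (ofNat(n) : Expr).eval s = (OfNat.ofNat n : ℝ) := by
  change (((OfNat.ofNat n : ℕ) : ℤ) : ℝ) = _; simp
@[simp] theorem Expr.eval_power (e : Expr) (k : ℕ) : (e.power k).eval s = e.eval s ^ k := by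
  induction k with
  | zero => simp [Expr.power]
  | succ k ih => simp [Expr.power, ih, pow_succ]
@[simp] theorem Expr.eval_sum (f : ℕ → Expr) (d : ℕ) :
    (Expr.sum f d).eval s = ∑ k : Fin d, (f k).eval s := by
  induction d with
  | zero => simp [Expr.sum]
  | succ k ih => simp [Expr.sum, ih, Fin.sum_univ_castSucc]

end Semantics

attribute [simp] Test.holds

end RealRAM

/-! ## Smallest balls -/

section Geometry

open Filter Topology

variable {d n : ℕ} (P : Fin n → EuclideanSpace ℝ (Fin d)) {F : Set (Finset (Fin n))} {ρ : ℝ}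

@[simp] theorem mem_pointsInBall {c : EuclideanSpace ℝ (Fin d)} {r : ℝ} {i : Fin n} :
    i ∈ pointsInBall P c r ↔ dist (P i) c ≤ r := by
  simp [pointsInBall]

/-- The largest distance from `c` to a point of `A` is continuous in `c` and tends to infinity, so
it attains its minimum. -/
theorem exists_isLeast_enclosing_radius [NeZero d] (A : Finset (Fin n)) :
    ∃ r : ℝ, IsLeast {r | 0 ≤ r ∧ ∃ c, A ⊆ pointsInBall P c r} r := by
  rcases A.eq_empty_or_nonempty with rfl | hA
  · exact ⟨0, ⟨le_rfl, 0, by simp⟩, fun r hr => hr.1⟩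
  · let f : EuclideanSpace ℝ (Fin d) → ℝ := fun c => A.sup' hA fun i => dist (P i) c
    have hf : Continuous f :=
      Continuous.finset_sup'_apply hA fun i _ => continuous_const.dist continuous_id
    obtain ⟨i, hi⟩ := hA
    have hlim : Tendsto f (cocompact _) atTop := by
      refine tendsto_atTop_mono (fun c => ?_) (tendsto_dist_left_cocompact_atTop (P i))
      exact Finset.le_sup' (fun i => dist (P i) c) hi
    obtain ⟨c, hc⟩ := hf.exists_forall_le hlim
    refine ⟨f c, ⟨dist_nonneg.trans (Finset.le_sup' (fun i => dist (P i) c) hi), c,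
      fun j hj => ?_⟩, ?_⟩
    · rw [mem_pointsInBall]
      exact Finset.le_sup' (fun i => dist (P i) c) hj
    · rintro r ⟨_, c', hc'⟩
      refine (hc c').trans (Finset.sup'_le _ _ fun j hj => ?_)
      exact (mem_pointsInBall P).1 (hc' hj)

/-- `F` is finite, so the enclosing radius can be minimised over its members; a larger set of points
inside the ball does no harm by upward closure. -/
theorem exists_isLeast_ballRadii [NeZero d] (hF : IsUpperSet F) (hne : F.Nonempty) :
    ∃ r : ℝ, IsLeast (ballRadii P F) r := by
  choose r hr using exists_isLeast_enclosing_radius P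
  have hfin : F.Finite := Set.toFinite F
  obtain ⟨A, hA, hmin⟩ := Set.exists_min_image F r hfin hne
  refine ⟨r A, ⟨(hr A).1.1, ?_⟩, ?_⟩
  · obtain ⟨c, hc⟩ := (hr A).1.2
    exact ⟨c, hF hc hA⟩
  · rintro s ⟨hs, c, hc⟩
    exact (hmin _ hc).trans ((hr _).2 ⟨hs, c, le_rfl⟩)

theorem le_of_subset_pointsInBall (hF : IsUpperSet F) (hρ : IsLeast (ballRadii P F) ρ)
    {A : Finset (Fin n)} (hA : A ∈ F) {c : EuclideanSpace ℝ (Fin d)} {r : ℝ} (hr : 0 ≤ r)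
    (h : ∀ i ∈ A, dist (P i) c ≤ r) : ρ ≤ r :=
  hρ.2 ⟨hr, c, hF (fun i hi => (mem_pointsInBall P).2 (h i hi)) hA⟩

/-- A ball of radius zero contains at most one of the distinct points, so `n + 1` oracle calls
settle the degenerate case. -/
theorem isLeast_eq_zero_iff (hP : Function.Injective P) (hF : IsUpperSet F)
    (hρ : IsLeast (ballRadii P F) ρ) : ρ = 0 ↔ ∅ ∈ F ∨ ∃ i, {i} ∈ F := by
  constructor
  · rintro rfl
    obtain ⟨-, c, hc⟩ := hρ.1
    rcases (pointsInBall P c 0).eq_empty_or_nonempty with h | ⟨i, hi⟩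
    · exact Or.inl (h ▸ hc)
    · refine Or.inr ⟨i, ?_⟩
      convert hc using 1
      refine (Finset.eq_singleton_iff_unique_mem.2 ⟨hi, fun j hj => hP ?_⟩).symm
      rw [mem_pointsInBall] at hi hj
      rw [dist_le_zero.1 hi, dist_le_zero.1 hj]
  · rintro (h | ⟨i, h⟩)
    · exact le_antisymm (le_of_subset_pointsInBall P hF hρ h (c := 0) le_rfl (by simp)) hρ.1.1
    · exact le_antisymm (le_of_subset_pointsInBall P hF hρ h (c := P i) le_rfl (by simp)) hρ.1.1

/-! ### Lattice points -/

/-- The lattice point with integer coordinates `g` in the lattice with spacing `u`. -/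
noncomputable def latt (u : ℝ) (g : Fin d → ℤ) : EuclideanSpace ℝ (Fin d) :=
  WithLp.toLp 2 fun k => u * g k

/-- The lower corner of the lattice cell containing `x`. -/
noncomputable def cell (u : ℝ) (x : EuclideanSpace ℝ (Fin d)) : Fin d → ℤ := fun k => ⌊x k / u⌋

theorem dist_latt_le_iff {u R : ℝ} (hR : 0 ≤ R) (x : EuclideanSpace ℝ (Fin d)) (g : Fin d → ℤ) :
    dist x (latt u g) ≤ R ↔ ∑ k, (x k - u * g k) * (x k - u * g k) ≤ R * R := by
  rw [EuclideanSpace.dist_eq, Real.sqrt_le_left hR, sq R]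
  simp [latt, Real.dist_eq, sq]

theorem abs_sub_le_dist (x y : EuclideanSpace ℝ (Fin d)) (k : Fin d) : |x k - y k| ≤ dist x y := by
  rw [dist_eq_norm]
  simpa using PiLp.norm_apply_le (x - y) k

/-- Each coordinate is off by at most `u`, which would give `u * √d`; the weaker `u * d` keeps roots
out of the constants of the program. -/
theorem dist_latt_cell {u : ℝ} (hu : 0 < u) (x : EuclideanSpace ℝ (Fin d)) :
    dist x (latt u (cell u x)) ≤ u * d := by
  rw [dist_latt_le_iff (by positivity)]
  have h : ∀ k, (x k - u * cell u x k) * (x k - u * cell u x k) ≤ u * u := by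
    intro k
    have h1 := Int.floor_le (x k / u)
    have h2 := Int.lt_floor_add_one (x k / u)
    rw [le_div_iff₀ hu] at h1
    rw [div_lt_iff₀ hu] at h2
    simp only [cell]
    have h3 : 0 ≤ x k - u * ⌊x k / u⌋ := by linarith
    have h4 : x k - u * ⌊x k / u⌋ ≤ u := by linarith
    exact mul_self_le_mul_self h3 h4
  calc _ ≤ ∑ _k : Fin d, u * u := Finset.sum_le_sum fun k _ => h k
    _ = d * (u * u) := by simp
    _ ≤ d * d * (u * u) := by
      gcongr
      have : d ≤ d * d := Nat.le_mul_self d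
      exact_mod_cast this
    _ = _ := by ring

theorem abs_cell_le {u b : ℝ} {H : ℕ} (hu : 0 < u) {x : EuclideanSpace ℝ (Fin d)}
    (hb : ∀ k, |x k| ≤ b) (hH : b / u + 1 ≤ H) (k : Fin d) : |cell u x k| ≤ H := by
  have h1 := abs_le.1 (hb k)
  have h2 : |x k / u| ≤ b / u := by
    rw [abs_div, abs_of_pos hu]; gcongr; exact hb k
  rw [abs_le] at h2 ⊢
  simp only [cell]
  constructor
  · rw [Int.le_floor]; push_cast; linarith
  · have := Int.floor_le (x k / u)
    have h3 : (⌊x k / u⌋ : ℝ) ≤ (H : ℤ) := by push_cast; linarith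
    exact_mod_cast h3

theorem abs_le_of_dist_latt_le {u b R : ℝ} {H : ℕ} (hu : 0 < u) {x : EuclideanSpace ℝ (Fin d)}
    (hb : ∀ k, |x k| ≤ b) {g : Fin d → ℤ} (hg : dist x (latt u g) ≤ R)
    (hH : b / u + R / u ≤ H) (k : Fin d) : |g k| ≤ H := by
  have h1 := (abs_sub_le_dist x (latt u g) k).trans hg
  simp only [latt] at h1
  have h2 : |u * (g k : ℝ)| ≤ b + R := by
    calc |u * (g k : ℝ)| = |x k - (x k - u * g k)| := by ring_nf
      _ ≤ |x k| + |x k - u * g k| := abs_sub _ _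
      _ ≤ b + R := add_le_add (hb k) h1
  rw [abs_mul, abs_of_pos hu] at h2
  have h3 : |(g k : ℝ)| ≤ H := by
    rw [← add_div, div_le_iff₀ hu] at hH
    exact le_of_mul_le_mul_left (by linarith) hu
  exact_mod_cast h3

/-- Justifies searching only a cube of offsets around the cell of `x`: rounding down costs one, the
distance costs `R / u`. -/
theorem abs_sub_cell_le {u R : ℝ} {L : ℕ} (hu : 0 < u) {x : EuclideanSpace ℝ (Fin d)}
    {g : Fin d → ℤ} (hg : dist x (latt u g) ≤ R) (hL : R / u + 1 ≤ L) (k : Fin d) :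
    |g k - cell u x k| ≤ L := by
  have h1 := (abs_sub_le_dist x (latt u g) k).trans hg
  simp only [latt] at h1
  have h2 : |x k / u - g k| ≤ R / u := by
    rw [show x k / u - g k = (x k - u * g k) / u by field_simp, abs_div, abs_of_pos hu]
    gcongr
  have h3 := Int.floor_le (x k / u)
  have h4 := Int.lt_floor_add_one (x k / u)
  have h5 : |((g k - cell u x k : ℤ) : ℝ)| ≤ L := by
    simp only [cell]
    push_cast
    rw [abs_le] at h2 ⊢
    constructor <;> linarith
  exact_mod_cast h5

/-- The integer with the digits `g k + H` to the base `2 * H + 1`. -/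
def gcode (H : ℕ) (g : Fin d → ℤ) : ℤ := ∑ k, (g k + H) * (2 * H + 1) ^ (k : ℕ)

/-- The bijection between digit sequences and numbers yields both the range and the injectivity of
the addresses. -/
theorem gcode_eq {H : ℕ} {g : Fin d → ℤ} (hg : ∀ k, |g k| ≤ H) :
    ∃ f : Fin d → Fin (2 * H + 1), (∀ k, (f k : ℤ) = g k + H) ∧
      gcode H g = (finFunctionFinEquiv f : ℕ) := by
  refine ⟨fun k => ⟨(g k + H).toNat, ?_⟩, fun k => ?_, ?_⟩
  · have := abs_le.1 (hg k); omega
  · have := abs_le.1 (hg k); simp; omega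
  · rw [finFunctionFinEquiv_apply]
    push_cast
    refine Finset.sum_congr rfl fun k _ => ?_
    have := abs_le.1 (hg k)
    rw [Int.toNat_of_nonneg (by omega)]

theorem gcode_nonneg {H : ℕ} {g : Fin d → ℤ} (hg : ∀ k, |g k| ≤ H) : 0 ≤ gcode H g := by
  obtain ⟨f, _, h⟩ := gcode_eq hg
  omega

theorem gcode_lt {H : ℕ} {g : Fin d → ℤ} (hg : ∀ k, |g k| ≤ H) :
    gcode H g < (2 * H + 1) ^ d := by
  obtain ⟨f, _, h⟩ := gcode_eq hg
  rw [h]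
  exact_mod_cast (finFunctionFinEquiv f).2

theorem gcode_inj {H : ℕ} {g g' : Fin d → ℤ} (hg : ∀ k, |g k| ≤ H) (hg' : ∀ k, |g' k| ≤ H)
    (h : gcode H g = gcode H g') : g = g' := by
  obtain ⟨f, h1, h2⟩ := gcode_eq hg
  obtain ⟨f', h1', h2'⟩ := gcode_eq hg'
  rw [h2, h2'] at h
  have : f = f' := finFunctionFinEquiv.injective (Fin.ext (by exact_mod_cast h))
  subst this
  funext k
  linarith [h1 k, h1' k]

/-- The `k`-th digit of `t` to the base `2 * L + 1`, shifted to the range `-L, …, L`. -/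
def offset (L t k : ℕ) : ℤ := (t / (2 * L + 1) ^ k % (2 * L + 1) : ℕ) - L

theorem exists_offset_eq {L : ℕ} {o : Fin d → ℤ} (ho : ∀ k, |o k| ≤ L) :
    ∃ t < (2 * L + 1) ^ d, ∀ k : Fin d, offset L t k = o k := by
  obtain ⟨f, h1, h2⟩ := gcode_eq ho
  refine ⟨finFunctionFinEquiv f, (finFunctionFinEquiv f).2, fun k => ?_⟩
  have := finFunctionFinEquiv_symm_apply_val (finFunctionFinEquiv f) k
  rw [Equiv.symm_apply_apply] at this
  rw [offset, ← this, h1]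
  ring

/-- Distinctness matters: a lattice point met twice would have the same cluster joined to it twice,
and `join` is specified for disjoint sets only. -/
theorem offset_inj {L t t' : ℕ} (ht : t < (2 * L + 1) ^ d) (ht' : t' < (2 * L + 1) ^ d)
    (h : ∀ k : Fin d, offset L t k = offset L t' k) : t = t' := by
  have : finFunctionFinEquiv.symm (⟨t, ht⟩ : Fin ((2 * L + 1) ^ d)) =
      finFunctionFinEquiv.symm ⟨t', ht'⟩ := by
    funext k
    refine Fin.ext ?_
    rw [finFunctionFinEquiv_symm_apply_val, finFunctionFinEquiv_symm_apply_val]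
    have := h k
    simp only [offset] at this
    exact_mod_cast sub_left_inj.1 this
  simpa using finFunctionFinEquiv.symm.injective this

/-- The machine has no remainder operation; a digit is obtained from the floors of two successive
quotients. -/
theorem floor_sub_floor_eq_offset (L t k : ℕ) :
    (⌊(t : ℝ) / (2 * L + 1 : ℝ) ^ k⌋ : ℝ) -
      (2 * L + 1) * (⌊(t : ℝ) / (2 * L + 1 : ℝ) ^ (k + 1)⌋ : ℝ) - L = offset L t k := by
  have h : ∀ j : ℕ, ⌊(t : ℝ) / (2 * L + 1 : ℝ) ^ j⌋ = ((t / (2 * L + 1) ^ j : ℕ) : ℤ) := by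
    intro j
    rw [← Nat.floor_div_eq_div (K := ℝ), Int.natCast_floor_eq_floor (by positivity)]
    push_cast
    rfl
  rw [h, h, offset, pow_succ, ← Nat.div_div_eq_div_mul]
  have := Nat.div_add_mod (t / (2 * L + 1) ^ k) (2 * L + 1)
  have h2 : (((t / (2 * L + 1) ^ k : ℕ) : ℤ) : ℝ) =
      (2 * L + 1) * ((t / (2 * L + 1) ^ k / (2 * L + 1) : ℕ) : ℤ) +
        ((t / (2 * L + 1) ^ k % (2 * L + 1) : ℕ) : ℤ) := by exact_mod_cast this.symm
  rw [h2]
  push_cast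
  ring

/-! ### Clusterings -/

/-- The points whose representative is in `l` and at distance at most `R` from the lattice
point `g`. -/
noncomputable def hitSet (own : Fin n → Fin n) (l : List (Fin n)) (u R : ℝ) (g : Fin d → ℤ) :
    Finset (Fin n) := by
  classical
  exact Finset.univ.filter fun p => own p ∈ l ∧ dist (P (own p)) (latt u g) ≤ R

theorem mem_hitSet {own : Fin n → Fin n} {l : List (Fin n)} {u R : ℝ} {g : Fin d → ℤ}
    {p : Fin n} : p ∈ hitSet P own l u R g ↔ own p ∈ l ∧ dist (P (own p)) (latt u g) ≤ R := by
  simp [hitSet]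

/-- The points of some optimal ball are represented by points of `l`, each at distance at most
`E` from its representative. -/
structure Clustering (F : Set (Finset (Fin n))) (ρ : ℝ) (l : List (Fin n)) (own : Fin n → Fin n)
    (E : ℝ) : Prop where
  nodup : l.Nodup
  nonneg : 0 ≤ E
  le : 3 * E ≤ ρ
  close : ∀ p, own p ∈ l → dist (P p) (P (own p)) ≤ E
  sep : ∀ w ∈ l, ∀ w' ∈ l, w ≠ w' → 8 / 17 * E ≤ dist (P w) (P w')
  cover : ∃ c, pointsInBall P c ρ ∈ F ∧ ∀ p ∈ pointsInBall P c ρ, own p ∈ l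

variable {P} {l : List (Fin n)} {own : Fin n → Fin n} {E u R : ℝ}

/-- Points of the hit set are within `E` of representatives that are within `R` of `g`, so a ball of
radius `R + E` around the lattice point contains them. -/
theorem Clustering.le_of_hitSet_mem (hC : Clustering P F ρ l own E) (hF : IsUpperSet F)
    (hρ : IsLeast (ballRadii P F) ρ) (hR : 0 ≤ R) {g : Fin d → ℤ}
    (h : hitSet P own l u R g ∈ F) : ρ ≤ R + E := by
  refine le_of_subset_pointsInBall P hF hρ h (c := latt u g) (add_nonneg hR hC.nonneg) ?_
  intro p hp
  rw [mem_hitSet] at hp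
  linarith [dist_triangle (P p) (P (own p)) (latt u g), hC.close p hp.1]

/-- Moving an optimal centre to the corner of its cell costs `u * d`, and passing from points to
representatives costs `E`. For any larger `R` the hit set of that corner would contain the whole
optimal ball. -/
theorem Clustering.lt_of_hitSet_notMem (hC : Clustering P F ρ l own E) (hF : IsUpperSet F)
    (hu : 0 < u) (h : ∀ g, hitSet P own l u R g ∉ F) : R < ρ + E + u * d := by
  obtain ⟨c, hc, hcov⟩ := hC.cover
  by_contra! hlt
  refine h (cell u c) (hF (fun p hp => ?_) hc)
  rw [mem_hitSet]
  refine ⟨hcov p hp, ?_⟩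
  have h1 := hC.close p (hcov p hp)
  rw [mem_pointsInBall] at hp
  have h2 := dist_triangle4 (P (own p)) (P p) c (latt u (cell u c))
  rw [dist_comm (P (own p)) (P p)] at h2
  have h3 := dist_latt_cell hu c
  linarith

/-- If `w` represented the whole optimal ball, the ball of radius `E` around it would do, but `3 * E
≤ ρ` and `0 < ρ`. So an optimal ball always meets two clusters. Hence the list keeps at least two
elements, and isolated representatives may be discarded. -/
theorem Clustering.exists_ne (hC : Clustering P F ρ l own E) (hF : IsUpperSet F)
    (hρ : IsLeast (ballRadii P F) ρ) (h0 : 0 < ρ) {c : EuclideanSpace ℝ (Fin d)}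
    (hc : pointsInBall P c ρ ∈ F) (hcov : ∀ p ∈ pointsInBall P c ρ, own p ∈ l) (w : Fin n) :
    ∃ p ∈ pointsInBall P c ρ, own p ≠ w := by
  by_contra! h
  have : ρ ≤ E := by
    refine le_of_subset_pointsInBall P hF hρ hc (c := P w) hC.nonneg fun p hp => ?_
    rw [← h p hp]
    exact hC.close p (hcov p hp)
  linarith [hC.le]

theorem Clustering.two_le_length (hC : Clustering P F ρ l own E) (hF : IsUpperSet F)
    (hρ : IsLeast (ballRadii P F) ρ) (h0 : 0 < ρ) (hn : 1 ≤ n) : 2 ≤ l.length := by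
  obtain ⟨c, hc, hcov⟩ := hC.cover
  obtain ⟨p, hp, -⟩ := hC.exists_ne hF hρ h0 hc hcov ⟨0, hn⟩
  obtain ⟨q, hq, hne⟩ := hC.exists_ne hF hρ h0 hc hcov (own p)
  classical
  calc 2 = ({own q, own p} : Finset (Fin n)).card := (Finset.card_pair hne).symm
    _ ≤ l.toFinset.card := Finset.card_le_card fun x hx => by
        simp only [Finset.mem_insert, Finset.mem_singleton] at hx
        rcases hx with rfl | rfl
        · exact List.mem_toFinset.2 (hcov q hq)
        · exact List.mem_toFinset.2 (hcov p hp)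
    _ ≤ l.length := l.toFinset_card_le

/-- Two points of the optimal ball are at distance at most `2 * ρ`, their representatives at most `2
* E` more. By `Clustering.exists_ne`, each representative of the ball has a different one that
close, so it is kept. -/
theorem Clustering.prune (hC : Clustering P F ρ l own E) (hF : IsUpperSet F)
    (hρ : IsLeast (ballRadii P F) ρ) (h0 : 0 < ρ) {l' : List (Fin n)} (hl : l'.Sublist l)
    {D : ℝ} (hD : 2 * ρ + 2 * E ≤ D)
    (hkeep : ∀ w ∈ l, ∀ w' ∈ l, w ≠ w' → dist (P w) (P w') ≤ D → w ∈ l') :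
    Clustering P F ρ l' own E := by
  obtain ⟨c, hc, hcov⟩ := hC.cover
  refine ⟨hl.nodup hC.nodup, hC.nonneg, hC.le, fun p hp => hC.close p (hl.subset hp),
    fun w hw w' hw' => hC.sep w (hl.subset hw) w' (hl.subset hw'), c, hc, fun p hp => ?_⟩
  obtain ⟨q, hq, hne⟩ := hC.exists_ne hF hρ h0 hc hcov (own p)
  refine hkeep _ (hcov p hp) _ (hcov q hq) hne.symm ?_
  have h1 := hC.close p (hcov p hp)
  have h2 := hC.close q (hcov q hq)
  rw [mem_pointsInBall] at hp hq
  have h3 := dist_triangle_right (P p) (P q) c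
  have h4 := dist_triangle4 (P (own p)) (P p) (P q) (P (own q))
  rw [dist_comm (P (own p)) (P p)] at h4
  linarith

/-- The errors of successive nets add up; `hE` expresses that a net is taken only when `ρ` is large
enough to tolerate the new total. -/
theorem Clustering.net (hC : Clustering P F ρ l own E) {l' : List (Fin n)} (hl : l'.Sublist l)
    {own' : Fin n → Fin n} (hown : ∀ p, own' p ∈ l' ↔ own p ∈ l) {D : ℝ}
    (hD : ∀ p, own p ∈ l → dist (P (own p)) (P (own' p)) ≤ D) (hD0 : 0 ≤ D)
    (hE : 3 * (E + D) ≤ ρ)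
    (hsep : ∀ w ∈ l', ∀ w' ∈ l', w ≠ w' → 8 / 17 * (E + D) ≤ dist (P w) (P w')) :
    Clustering P F ρ l' own' (E + D) := by
  obtain ⟨c, hc, hcov⟩ := hC.cover
  refine ⟨hl.nodup hC.nodup, add_nonneg hC.nonneg hD0, hE, fun p hp => ?_, hsep,
    c, hc, fun p hp => (hown p).2 (hcov p hp)⟩
  have h1 := (hown p).1 hp
  linarith [dist_triangle (P p) (P (own p)) (P (own' p)), hC.close p h1, hD p h1]

end Geometry

/-! ## Counting -/

section Counting

open Finset

variable {α : Type} (W : Finset α)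

/-- The product counts pairs with one element on each side of `x`. In every triple some element lies
between the other two in value, so at least one of its six orderings is counted. -/
theorem pow_three_le_six_mul (v : α → ℝ) :
    W.card ^ 3 ≤ 6 * ∑ x ∈ W, (W.filter fun y => v y ≤ v x).card *
      (W.filter fun y => v x ≤ v y).card := by
  let I (x y z : α) : ℕ := if v y ≤ v x ∧ v x ≤ v z then 1 else 0
  have h1 : ∑ x ∈ W, (W.filter fun y => v y ≤ v x).card * (W.filter fun y => v x ≤ v y).card
      = ∑ x ∈ W, ∑ y ∈ W, ∑ z ∈ W, I x y z := by
    refine sum_congr rfl fun x _ => ?_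
    rw [card_filter, card_filter, sum_mul_sum]
    refine sum_congr rfl fun y _ => sum_congr rfl fun z _ => ?_
    simp only [I]
    split_ifs <;> simp_all
  have h2 : ∀ x y z, 1 ≤ I x y z + I x z y + I y x z + I y z x + I z x y + I z y x := by
    intro x y z
    have key : I x y z = 1 ∨ I x z y = 1 ∨ I y x z = 1 ∨ I y z x = 1 ∨ I z x y = 1 ∨
        I z y x = 1 := by
      have hI : ∀ x y z, I x y z = 1 ↔ v y ≤ v x ∧ v x ≤ v z := fun x y z => by simp [I]
      simp only [hI]
      rcases le_total (v x) (v y) with h | h <;> rcases le_total (v y) (v z) with h' | h' <;>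
        rcases le_total (v x) (v z) with h'' | h'' <;> simp [*]
    omega
  have h3 : W.card ^ 3 = ∑ _x ∈ W, ∑ _y ∈ W, ∑ _z ∈ W, 1 := by simp; ring
  have h4 : ∑ x ∈ W, ∑ y ∈ W, ∑ z ∈ W, (I x y z + I x z y + I y x z + I y z x + I z x y + I z y x)
      = 6 * ∑ x ∈ W, ∑ y ∈ W, ∑ z ∈ W, I x y z := by
    simp only [sum_add_distrib]
    have e1 : ∑ x ∈ W, ∑ y ∈ W, ∑ z ∈ W, I x z y = ∑ x ∈ W, ∑ y ∈ W, ∑ z ∈ W, I x y z :=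
      sum_congr rfl fun x _ => sum_comm
    have e2 : ∑ x ∈ W, ∑ y ∈ W, ∑ z ∈ W, I y x z = ∑ x ∈ W, ∑ y ∈ W, ∑ z ∈ W, I x y z :=
      sum_comm
    have e3 : ∑ x ∈ W, ∑ y ∈ W, ∑ z ∈ W, I y z x = ∑ x ∈ W, ∑ y ∈ W, ∑ z ∈ W, I x y z := by
      rw [sum_comm]; exact sum_congr rfl fun x _ => sum_comm
    have e4 : ∑ x ∈ W, ∑ y ∈ W, ∑ z ∈ W, I z x y = ∑ x ∈ W, ∑ y ∈ W, ∑ z ∈ W, I x y z := by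
      rw [← e2]; exact sum_congr rfl fun x _ => sum_comm
    have e5 : ∑ x ∈ W, ∑ y ∈ W, ∑ z ∈ W, I z y x = ∑ x ∈ W, ∑ y ∈ W, ∑ z ∈ W, I x y z := by
      rw [← e3]; exact sum_congr rfl fun x _ => sum_comm
    rw [e1, e2, e3, e4, e5]; ring
  rw [h1, ← h4, h3]
  exact sum_le_sum fun x _ => sum_le_sum fun y _ => sum_le_sum fun z _ => h2 x y z

/-- If removing `r x` elements pays for half of one of the two sides of `x`, then on average a
constant fraction of `W` is removed. -/
theorem sq_le_twelve_mul_sum (v : α → ℝ) (r : α → ℕ)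
    (hr : ∀ x ∈ W, (W.filter fun y => v y ≤ v x).card ≤ 2 * r x ∨
      (W.filter fun y => v x ≤ v y).card ≤ 2 * r x) :
    W.card ^ 2 ≤ 12 * ∑ x ∈ W, r x := by
  -- One factor is at most `2 * r x`, the other at most `W.card`. Inserted in the cubic bound, this
  -- leaves a quadratic one after cancelling `W.card`.
  have h1 : ∀ x ∈ W, (W.filter fun y => v y ≤ v x).card * (W.filter fun y => v x ≤ v y).card ≤
      W.card * (2 * r x) := by
    intro x hx
    rcases hr x hx with h | h
    · rw [mul_comm]; exact Nat.mul_le_mul (card_filter_le _ _) h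
    · exact Nat.mul_le_mul (card_filter_le _ _) h
  have h2 := (pow_three_le_six_mul W v).trans (Nat.mul_le_mul_left 6 (sum_le_sum h1))
  rw [← mul_sum, ← mul_sum] at h2
  rcases Nat.eq_zero_or_pos W.card with h | h
  · simp [h]
  · refine Nat.le_of_mul_le_mul_left ?_ h
    calc W.card * W.card ^ 2 = W.card ^ 3 := by ring
      _ ≤ _ := h2
      _ = _ := by ring

/-- A surviving element of `C` has a neighbour within `r`, which cannot survive too, since survivors
are more than `2 * r` apart. For the same reason two survivors cannot share a neighbour. So the
survivors in `C` inject into the removed elements, and the other elements of `C` are removed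
themselves. -/
theorem card_filter_close_le [DecidableEq α] {X : Type} [PseudoMetricSpace X] (f : α → X)
    {W' : Finset α}
    (hW : W' ⊆ W) {r : ℝ} (hr : 0 ≤ r)
    (hsep : ∀ w ∈ W', ∀ w' ∈ W', w ≠ w' → 2 * r < dist (f w) (f w'))
    (C : Finset α) (hCW : C ⊆ W) (hC : ∀ y ∈ C, ∃ z ∈ W, z ≠ y ∧ dist (f y) (f z) ≤ r) :
    C.card ≤ 2 * (W.card - W'.card) := by
  choose! nb h1 h2 h3 using hC
  have hA : (C ∩ W').card ≤ (W \ W').card := by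
    refine card_le_card_of_injOn nb (fun y hy => ?_) fun y hy y' hy' h => ?_
    · simp only [coe_inter, Set.mem_inter_iff, mem_coe] at hy
      simp only [coe_sdiff, Set.mem_sdiff, mem_coe]
      refine ⟨h1 y hy.1, fun hn => ?_⟩
      linarith [hsep y hy.2 _ hn (h2 y hy.1).symm, h3 y hy.1]
    · simp only [coe_inter, Set.mem_inter_iff, mem_coe] at hy hy'
      by_contra hne
      have := hsep y hy.2 y' hy'.2 hne
      have h4 := h3 y hy.1
      have h5 := h3 y' hy'.1
      rw [← h] at h5
      linarith [dist_triangle_right (f y) (f y') (f (nb y))]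
  have hB : (C \ W').card ≤ (W \ W').card := card_le_card (sdiff_subset_sdiff hCW le_rfl)
  rw [card_sdiff_of_subset hW] at hA hB
  have := card_inter_add_card_sdiff C W'
  omega

end Counting

namespace RealRAM

/-! ## The program

Variables: `0` number of points and output, `1` accuracy, `2` bound on the coordinates, `3` whether
the radius is zero, `4` length of the current list of points, `5` first unused address, `6` and `7`
lower and upper bound, `8` whether the main loop is done, `9` spacing `u` of the lattice, `10` radius
`R`, `11` to `15` parameters of the lattice, `16` index into the list, `17` point, `18` whether a
query succeeded, `19` index of an offset, `20` temporary, `21` length of the new list, `22` address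
of a lattice point, `23` to `25` random point and distance to its neighbour.

Arrays: `0` to `d - 1` coordinates, `d` the current list of points, `d + 1` numbers attached to
lattice points. Sketch arrays: `0` singletons, `1` clusters, `2` attached to lattice points,
`3` empty set. -/

section Program

variable (d : ℕ)

/-- The `k`-th coordinate of the lattice cell of the point in variable `17`. -/
def cellCoord (k : ℕ) : Expr := .floor (.read k (.var 17) / .var 9)

/-- The `k`-th coordinate of the lattice point with offset number `19`. -/
def lattCoord (k : ℕ) : Expr :=
  cellCoord k + (.floor (.var 19 / (Expr.var 12).power k) -
    Expr.var 12 * .floor (.var 19 / (Expr.var 12).power (k + 1)) - .var 11)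

def nearTest : Test :=
  .not (.lt (Expr.var 10 * .var 10) (.sum (fun k =>
    (.read k (.var 17) - Expr.var 9 * lattCoord k) *
      (.read k (.var 17) - Expr.var 9 * lattCoord k)) d))

def lattAddr : Expr :=
  Expr.var 5 + .sum (fun k => (lattCoord k + .var 13) * (Expr.var 14).power k) d

def cellAddr : Expr :=
  Expr.var 5 + .sum (fun k => (cellCoord k + .var 13) * (Expr.var 14).power k) d

/-- Execute `body` for all lattice points at distance at most `R` from the point in
variable `17`. -/
def sweep (body : Prog) : Prog :=
  .for 19 (.var 15) (.ite (nearTest d) (.seq (.assign 22 (lattAddr d)) body) .skip)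

/-- Variables `11` to `15` receive the range `L` of offsets, its base `2 * L + 1`, the bound `H` on
lattice coordinates, its base `2 * H + 1`, and the number of offsets. The summands 2 and 1 absorb
the rounding of the floors. -/
def gridSetup : Prog :=
  .seq (.assign 11 (.floor (.var 10 / .var 9) + 2))
  (.seq (.assign 12 (2 * .var 11 + 1))
  (.seq (.assign 13 (.floor (.var 2 / .var 9) + .var 11 + 1))
  (.seq (.assign 14 (2 * .var 13 + 1))
  (.assign 15 ((Expr.var 12).power d)))))

/-- Querying after every join avoids a separate list of the lattice points touched, and keeps the
number of queries equal to the number of joins. -/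
def passBody : Prog :=
  .seq (.skJoin 2 (.var 22) 1 (.var 17))
  (.seq (.skQuery 20 2 (.var 22))
  (.seq (.ite (.lt 0 (.var 20)) (.assign 18 1) .skip)
  (.write (d + 1) (.var 22) (.read (d + 1) (.var 22) + 1))))

def passLoop : Prog :=
  .for 16 (.var 4) (.seq (.assign 17 (.read d (.var 16))) (sweep d (passBody d)))

/-- Count the points near each lattice point, join their sketches, and query the results. -/
def pass : Prog := .seq (gridSetup d) (.seq (.assign 18 0) (passLoop d))

/-- Move on to unused addresses. -/
def bump : Prog := .assign 5 (Expr.var 5 + (Expr.var 14).power d)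

def pruneLoop : Prog :=
  .for 16 (.var 4) (.seq (.assign 17 (.read d (.var 16)))
    (.ite (.lt 1 (.read (d + 1) (cellAddr d)))
      (.seq (.write d (.var 21) (.var 17)) (.assign 21 (.var 21 + 1))) .skip))

/-- Keep the points in whose cell's neighbourhood at least two points were counted. -/
def prune : Prog := .seq (.assign 21 0) (.seq (pruneLoop d) (.assign 4 (.var 21)))

/-- The mark left by a point is its index plus one, because zero is the content of an unused cell
and means unmarked. -/
def netLoop : Prog :=
  .for 16 (.var 4) (.seq (.assign 17 (.read d (.var 16)))
    (.ite (.lt 0 (.read (d + 1) (cellAddr d)))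
      (.skJoin 1 (.read (d + 1) (cellAddr d) - 1) 1 (.var 17))
      (.seq (.write d (.var 21) (.var 17)) (.seq (.assign 21 (.var 21 + 1))
        (sweep d (.write (d + 1) (.var 22) (.var 17 + 1)))))))

/-- Merge each point into an earlier one that is near, if there is any. -/
def net : Prog :=
  .seq (gridSetup d) (.seq (.assign 21 0) (.seq (netLoop d) (.assign 4 (.var 21))))

def sqDist (i j : Expr) : Expr :=
  .sum (fun k => (.read k i - .read k j) * (.read k i - .read k j)) d

/-- Variable `25` receives the squared distance of the point in variable `23` to its nearest
neighbour. -/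
def nearest : Prog :=
  .seq (.assign 25 0)
  (.for 16 (.var 4) (.seq (.assign 20 (sqDist d (.var 23) (.read d (.var 16))))
    (.ite (.and (.lt 0 (.var 20)) (.not (.and (.lt 0 (.var 25)) (.not (.lt (.var 20) (.var 25))))))
      (.assign 25 (.var 20)) .skip)))

/-- The deterministic part of an iteration of the main loop. -/
def mainStep : Prog :=
  .seq (.assign 23 (.read d (.var 24)))
  (.seq (nearest d)
  (.seq (.assign 6 (.sqrt (.var 25) / 16))
  (.seq (.assign 9 (.var 6 / .const d))
  (.seq (.assign 10 (3 * .var 6))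
  (.seq (pass d) (.seq (bump d)
  (.ite (.lt 0 (.var 18))
    (.seq (.assign 10 (14 * .var 6)) (.seq (pass d) (.seq (prune d) (bump d))))
    (.seq (.assign 10 (273 * .var 6)) (.seq (pass d) (.seq (bump d)
    (.ite (.lt 0 (.var 18))
      (.seq (.assign 7 (307 * .var 6)) (.assign 8 1))
      (.seq (.assign 10 (33 * .var 6)) (.seq (net d) (bump d))))))))))))))

/-- `rand` draws from `{0, …, ⌊e⌋}`, so the last index of the list is `var 4 - 1`. -/
def mainLoop : Prog :=
  .while (.lt (.var 8) 1) (.seq (.rand 24 (.var 4 - 1)) (mainStep d))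

/-- The sum of the absolute values of all coordinates serves as a common bound for them; `√(x * x)`
is the absolute value. -/
def initLoop : Prog :=
  .for 16 (.var 0)
    (.seq (.write d (.var 16) (.var 16))
    (.seq (.skCopy 1 (.var 16) 0 (.var 16))
    (.seq (.skQuery 20 0 (.var 16))
    (.seq (.ite (.lt 0 (.var 20)) (.assign 3 1) .skip)
    (.assign 2 (.var 2 + .sum (fun k => .sqrt (.read k (.var 16) * .read k (.var 16))) d))))))

def init : Prog :=
  .seq (.assign 2 0) (.seq (.skQuery 3 3 0) (.seq (initLoop d) (.assign 4 (.var 0))))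

/-- With gap `h = var 7 - var 6`, rounding to the lattice costs at most `h / 4`. Acceptance at the
midpoint leaves the gap `h / 2`, rejection leaves `3 * h / 4`. -/
def refineStep : Prog :=
  .seq (.assign 9 ((.var 7 - .var 6) / (4 * .const d)))
  (.seq (.assign 10 ((.var 6 + .var 7) / 2))
  (.seq (pass d) (.seq (bump d)
  (.ite (.lt 0 (.var 18)) (.assign 7 (.var 10))
    (.assign 6 (.var 10 - (.var 7 - .var 6) / 4))))))

def refine : Prog :=
  .while (.lt ((1 + .var 1) * .var 6) (.var 7)) (refineStep d)

/-- The main loop destroys the list and the cluster sketches. The second `init` restores the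
singletons, since the refinement must not suffer any clustering error. -/
def smallestBall : Prog :=
  .seq (init d) (.ite (.lt 0 (.var 3)) (.assign 0 0)
    (.seq (mainLoop d) (.seq (init d) (.seq (refine d) (.assign 0 (.var 7))))))

end Program

end RealRAM

namespace RealRAM

/-! ### Visiting the lattice points near a given point. -/

section Sweep

variable {S : Type} {jn : S → S → S} {orc : S → Bool} {τ : ℕ} {d n : ℕ}
  (P : Fin n → EuclideanSpace ℝ (Fin d))

/-- The input arrays hold the coordinates of the points. -/
def Coords (s : State S) : Prop := ∀ (i : Fin n) (k : Fin d), s.arr k (i : ℤ) = P i k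

/-- The state describes a lattice with spacing `u`. -/
structure Grid (s : State S) (β : ℤ) (u R : ℝ) (L H : ℕ) : Prop where
  v5 : s.var 5 = β
  v9 : s.var 9 = u
  v10 : s.var 10 = R
  v11 : s.var 11 = L
  v12 : s.var 12 = 2 * L + 1
  v13 : s.var 13 = H
  v14 : s.var 14 = 2 * H + 1
  v15 : s.var 15 = ((2 * L + 1) ^ d : ℕ)
  coords : Coords P s

/-- The parameters `L` and `H` are large enough. -/
structure GridOK (u R : ℝ) (L H : ℕ) : Prop where
  pos : 0 < u
  nonneg : 0 ≤ R
  hL : R / u + 1 ≤ L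
  hH : ∃ b : ℝ, (∀ i k, |P i k| ≤ b) ∧ b / u + R / u ≤ H ∧ b / u + 1 ≤ H

variable {P} {s s' : State S} {β : ℤ} {u R : ℝ} {L H : ℕ}

theorem GridOK.abs_le (h : GridOK P u R L H) {w : Fin n} {g : Fin d → ℤ}
    (hg : dist (P w) (latt u g) ≤ R) (k : Fin d) : |g k| ≤ H := by
  obtain ⟨b, h1, h2, -⟩ := h.hH
  exact abs_le_of_dist_latt_le h.pos (h1 w) hg h2 k

theorem GridOK.abs_cell_le (h : GridOK P u R L H) (w : Fin n) (k : Fin d) :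
    |cell u (P w) k| ≤ H := by
  obtain ⟨b, h1, -, h2⟩ := h.hH
  exact _root_.abs_cell_le h.pos (h1 w) h2 k

theorem Coords.congr (h : Coords P s) (ha : ∀ a < d, s'.arr a = s.arr a) : Coords P s' :=
  fun i k => by rw [ha k k.2]; exact h i k

theorem Grid.congr (h : Grid P s β u R L H)
    (hv : ∀ x, x = 5 ∨ (9 ≤ x ∧ x ≤ 15) → s'.var x = s.var x)
    (ha : ∀ a < d, s'.arr a = s.arr a) : Grid P s' β u R L H :=
  ⟨hv 5 (by simp) ▸ h.v5, hv 9 (by simp) ▸ h.v9, hv 10 (by simp) ▸ h.v10, hv 11 (by simp) ▸ h.v11,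
    hv 12 (by simp) ▸ h.v12, hv 13 (by simp) ▸ h.v13, hv 14 (by simp) ▸ h.v14,
    hv 15 (by simp) ▸ h.v15, h.coords.congr ha⟩

theorem Grid.eval_cellCoord (h : Grid P s β u R L H) {w : Fin n} (hw : s.var 17 = (w : ℕ))
    (k : Fin d) : (cellCoord k).eval s = cell u (P w) k := by
  have := h.coords w k
  simp only [cellCoord, Expr.eval, Expr.eval_hdiv, hw, h.v9, cell, Int.floor_natCast, this]

theorem Grid.eval_lattCoord (h : Grid P s β u R L H) {w : Fin n} (hw : s.var 17 = (w : ℕ)) {t : ℕ}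
    (ht : s.var 19 = t) (k : Fin d) :
    (lattCoord k).eval s = (cell u (P w) k + offset L t k : ℤ) := by
  simp only [lattCoord, Expr.eval_hadd, h.eval_cellCoord hw, Expr.eval_hsub,
    Expr.eval, Expr.eval_hdiv, Expr.eval_power, h.v12, h.v11, ht, floor_sub_floor_eq_offset]
  push_cast
  rfl

theorem Grid.nearTest_iff (h : Grid P s β u R L H) (hR : 0 ≤ R) {w : Fin n}
    (hw : s.var 17 = (w : ℕ)) {t : ℕ} (ht : s.var 19 = t) :
    (nearTest d).holds s ↔
      dist (P w) (latt u fun k => cell u (P w) k + offset L t k) ≤ R := by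
  rw [dist_latt_le_iff hR]
  have := fun k => h.coords w k
  simp only [nearTest, Test.holds, Expr.eval_sum, Expr.eval_hsub, Expr.eval,
    h.eval_lattCoord hw ht, h.v10, h.v9, hw, Int.floor_natCast, this, not_lt]

theorem Grid.eval_lattAddr (h : Grid P s β u R L H) {w : Fin n}
    (hw : s.var 17 = (w : ℕ)) {t : ℕ} (ht : s.var 19 = t) :
    (lattAddr d).eval s = (β + gcode H fun k => cell u (P w) k + offset L t k : ℤ) := by
  simp only [lattAddr, Expr.eval_sum, Expr.eval_hadd, Expr.eval,
    h.eval_lattCoord hw ht, h.v5, h.v13, h.v14, Expr.eval_power, gcode]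
  push_cast
  rfl

theorem Grid.eval_cellAddr (h : Grid P s β u R L H) {w : Fin n} (hw : s.var 17 = (w : ℕ)) :
    (cellAddr d).eval s = (β + gcode H (cell u (P w)) : ℤ) := by
  simp only [cellAddr, Expr.eval_sum, Expr.eval_hadd, Expr.eval,
    h.eval_cellCoord hw, h.v5, h.v13, h.v14, Expr.eval_power, gcode]
  push_cast
  rfl

/-- The invariant is indexed by the set of lattice points treated so far, so that loop bodies need
not know the order of enumeration. The body may rely on `g ∉ V`: no lattice point is treated twice.
-/
theorem sweep_spec {body : Prog} {w : Fin n} {I : Set (Fin d → ℤ) → State S → Prop} {T : ℝ}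
    {s₀ : State S} (hT : 0 ≤ T) (hok : GridOK P u R L H) (hG : Grid P s₀ β u R L H)
    (hw : s₀.var 17 = (w : ℕ)) (hv : ∀ x, body.wv x → x = 18 ∨ x = 20)
    (ha : ∀ a, body.wa a → d ≤ a)
    (hI : ∀ V s x v, x = 19 ∨ x = 22 → I V s → I V (s.setVar x v))
    (h0 : I ∅ s₀)
    (hbody : ∀ V g s, dist (P w) (latt u g) ≤ R → g ∉ V →
      (∀ g' ∈ V, dist (P w) (latt u g') ≤ R) → Frame (sweep d body) s₀ s →
      s.var 22 = (β + gcode H g : ℤ) → I V s → Tri jn orc τ body s T (I (insert g V))) :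
    Tri jn orc τ (sweep d body) s₀ (((2 * L + 1) ^ d : ℕ) * (T + 6) + 3)
      (I {g | dist (P w) (latt u g) ≤ R}) := by
  set G : ℕ → Fin d → ℤ := fun t k => cell u (P w) k + offset L t k with hGdef
  -- The near lattice points among those with offset numbers below `t`; for the full range of
  -- offsets these are all near ones.
  set V : ℕ → Set (Fin d → ℤ) := fun t => {g | ∃ t' < t, g = G t' ∧ dist (P w) (latt u g) ≤ R}
    with hV
  have hgrid : ∀ s, Frame (sweep d body) s₀ s → Grid P s β u R L H := by
    intro s hf
    refine hG.congr (fun x hx => hf.var x ?_) (fun a hx => hf.arr a ?_)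
    · simp only [sweep, Prog.wv_for, Prog.wv, or_false, not_or]
      exact ⟨by omega, by omega, fun h => by have := hv x h; omega⟩
    · simp only [sweep, Prog.wa_for, Prog.wa, or_false, false_or]
      exact fun h => by have := ha a h; omega
  have hw' : ∀ s, Frame (sweep d body) s₀ s → s.var 17 = (w : ℕ) := by
    intro s hf
    rw [hf.var 17, hw]
    simp only [sweep, Prog.wv_for, Prog.wv, or_false, not_or]
    exact ⟨by omega, by omega, fun h => by have := hv 17 h; omega⟩
  have hend : V ((2 * L + 1) ^ d) = {g | dist (P w) (latt u g) ≤ R} := by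
    ext g
    refine ⟨fun ⟨t, _, _, h⟩ => h, fun h => ?_⟩
    obtain ⟨t, ht, hto⟩ := exists_offset_eq (L := L) (o := fun k => g k - cell u (P w) k)
      (fun k => abs_sub_cell_le hok.pos h hok.hL k)
    refine ⟨t, ht, ?_, h⟩
    funext k
    simp only [hGdef, hto]
    ring
  have hGinj : ∀ t < (2 * L + 1) ^ d, ∀ t' < (2 * L + 1) ^ d, G t = G t' → t = t' := by
    intro t ht t' ht' h
    refine offset_inj ht ht' fun k => ?_
    have := congrFun h k
    simpa [hGdef] using this
  rw [← hend]
  refine (Tri.for (I := fun t => I (V t)) (T := T + 3) ?_ ?_ ?_ ?_ ?_).mono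
    (by linarith) fun _ h => h
  · simp only [Prog.wv, or_false, not_or]
    exact ⟨by omega, fun h => by have := hv 19 h; omega⟩
  · exact fun k s v h => hI _ _ _ _ (Or.inl rfl) h
  · have : V 0 = ∅ := by ext g; simp [hV]
    rw [this]
    exact h0
  · intro t s hf hs hIs
    exact (hgrid s hf).v15
  · intro t ht s hf hs hIs
    have hgr := hgrid s hf
    refine (Tri.ite (T₁ := 1 + 1 + T) (T₂ := 1) ?_ ?_).mono
      (by rw [max_eq_left (by linarith)]; linarith) fun _ h => h
    · intro hb
      rw [hgr.nearTest_iff hok.nonneg (hw' s hf) hs] at hb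
      have hVt : V (t + 1) = insert (G t) (V t) := by
        ext g
        simp only [hV, Set.mem_ofPred_eq, Set.mem_insert_iff, Nat.lt_succ_iff_lt_or_eq]
        constructor
        · rintro ⟨t', h | rfl, h2, h3⟩
          · exact Or.inr ⟨t', h, h2, h3⟩
          · exact Or.inl h2
        · rintro (rfl | ⟨t', h, h2, h3⟩)
          · exact ⟨t, Or.inr rfl, rfl, hb⟩
          · exact ⟨t', Or.inl h, h2, h3⟩
      rw [hVt]
      refine Tri.seq (Tri.assign ?_)
      refine hbody _ _ _ hb ?_ (fun g' hg' => hg'.choose_spec.2.2) ?_ ?_ (hI _ _ _ _ (Or.inr rfl) hIs)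
      · rintro ⟨t', ht', h, -⟩
        have := hGinj _ ht _ (ht'.trans ht) h
        omega
      · refine Frame.trans hf ⟨fun x hx => ?_, fun a ha => rfl, fun a ha => rfl⟩
        simp only [sweep, Prog.wv_for, Prog.wv, or_false, not_or] at hx
        simp [hx.2.1]
      · simp only [setVar_var, if_true]
        exact hgr.eval_lattAddr (hw' s hf) hs
    · intro hb
      rw [hgr.nearTest_iff hok.nonneg (hw' s hf) hs] at hb
      refine Tri.skip ?_
      have hVt : V (t + 1) = V t := by
        ext g
        simp only [hV, Set.mem_ofPred_eq, Nat.lt_succ_iff_lt_or_eq]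
        constructor
        · rintro ⟨t', h | rfl, h2, h3⟩
          · exact ⟨t', h, h2, h3⟩
          · rw [h2] at h3
            exact absurd h3 hb
        · rintro ⟨t', h, h2, h3⟩
          exact ⟨t', Or.inl h, h2, h3⟩
      rw [hVt]
      exact hIs

theorem gridSetup_spec {b : ℝ} (hu : 0 < u) (hR : 0 ≤ R) (hb : ∀ i k, |P i k| ≤ b) (hb0 : 0 ≤ b)
    (h5 : s.var 5 = β) (h9 : s.var 9 = u) (h10 : s.var 10 = R) (h2 : s.var 2 = b)
    (hc : Coords P s) {Q : State S → Prop}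
    (hQ : ∀ s' H, Frame (gridSetup d) s s' → GridOK P u R (⌊R / u⌋₊ + 2) H →
      Grid P s' β u R (⌊R / u⌋₊ + 2) H → Q s') :
    Tri jn orc τ (gridSetup d) s 9 Q := by
  have hL : ((⌊R / u⌋ : ℤ) : ℝ) = (⌊R / u⌋₊ : ℝ) := (natCast_floor_eq_intCast_floor (by positivity)).symm
  have hH : ((⌊b / u⌋ : ℤ) : ℝ) = (⌊b / u⌋₊ : ℝ) := (natCast_floor_eq_intCast_floor (by positivity)).symm
  refine Tri.mono (Tri.frame (T := 1 + 1 + (1 + 1 + (1 + 1 + (1 + 1 + 1)))) (Q := fun s' =>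
      Grid P s' β u R (⌊R / u⌋₊ + 2) (⌊b / u⌋₊ + (⌊R / u⌋₊ + 2) + 1)) ?_) (by norm_num) ?_
  · refine Tri.seq (Tri.assign (Tri.seq (Tri.assign (Tri.seq (Tri.assign (Tri.seq (Tri.assign
      (Tri.assign ?_))))))))
    constructor <;> try simp [h5, h9, h10, h2, hL, hH]
    exact hc
  · rintro s' ⟨hf, hg⟩
    refine hQ s' _ hf ⟨hu, hR, ?_, b, hb, ?_, ?_⟩ hg
    · push_cast
      linarith [Nat.lt_floor_add_one (R / u)]
    · push_cast
      linarith [Nat.lt_floor_add_one (R / u), Nat.lt_floor_add_one (b / u)]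
    · push_cast
      linarith [Nat.lt_floor_add_one (b / u), Nat.cast_nonneg (α := ℝ) ⌊R / u⌋₊]

end Sweep

end RealRAM

namespace RealRAM

/-! ### One pass: joining, counting and querying at the lattice points. -/

section Pass

open Classical in
/-- The lattice points in `V` have been treated for the point `w`. -/
def Swept {S : Type} (jn : S → S → S) (orc : S → Bool) (d : ℕ) (β : ℤ) (H : ℕ) (w : ℕ)
    (s₀ : State S) (V : Set (Fin d → ℤ)) (s : State S) : Prop :=
  (∀ g : Fin d → ℤ, (∀ k, |g k| ≤ H) →
    s.sk 2 (β + gcode H g) = (if g ∈ V then jn (s₀.sk 2 (β + gcode H g)) (s₀.sk 1 w)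
      else s₀.sk 2 (β + gcode H g)) ∧
    s.arr (d + 1) (β + gcode H g) = s₀.arr (d + 1) (β + gcode H g) + if g ∈ V then 1 else 0) ∧
  (∀ x : ℤ, β + (2 * H + 1) ^ d ≤ x →
    s.sk 2 x = s₀.sk 2 x ∧ s.arr (d + 1) x = s₀.arr (d + 1) x) ∧
  (0 < s.var 18 ↔ 0 < s₀.var 18 ∨
    ∃ g ∈ V, orc (jn (s₀.sk 2 (β + gcode H g)) (s₀.sk 1 w)) = true)

variable {S : Type} {jn : S → S → S} {orc : S → Bool} {τ : ℕ} {d n : ℕ}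
  {P : Fin n → EuclideanSpace ℝ (Fin d)} {s₀ : State S} {β : ℤ} {u R : ℝ} {L H : ℕ}

theorem sweep_passBody_spec (hok : GridOK P u R L H) (hG : Grid P s₀ β u R L H) {w : Fin n}
    (hw : s₀.var 17 = (w : ℕ)) :
    Tri jn orc τ (sweep d (passBody d)) s₀ (((2 * L + 1) ^ d : ℕ) * (2 * τ + 12) + 3)
      (Swept jn orc d β H w s₀ {g | dist (P w) (latt u g) ≤ R}) := by
  refine (sweep_spec (T := 2 * τ + 6) (I := Swept jn orc d β H w s₀) (by positivity) hok hG hw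
    ?_ ?_ ?_ ?_ ?_).mono (le_of_eq (by ring)) fun _ h => h
  · intro x hx
    simp only [passBody, Prog.wv, or_false, false_or] at hx
    omega
  · intro a ha
    simp only [passBody, Prog.wa, or_false, false_or] at ha
    omega
  · rintro V s x v hx ⟨h1, h2, h3⟩
    refine ⟨h1, h2, ?_⟩
    rw [setVar_var, if_neg (by omega)]
    exact h3
  · exact ⟨fun g _ => by simp, fun x _ => ⟨rfl, rfl⟩, by simp⟩
  · intro V g s hg hgV hV hf h22 ⟨h1, h2, h3⟩
    have h17 : s.var 17 = (w : ℕ) := by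
      rw [hf.var 17, hw]
      simp [sweep, passBody, Prog.wv]
    have hs1 : s.sk 1 = s₀.sk 1 := hf.sk 1 (by simp [sweep, passBody, Prog.wk])
    have hgH := fun k => hok.abs_le hg k
    have h1g := h1 g hgH
    simp only [hgV, if_false, add_zero] at h1g
    refine Tri.mono (T := 1 + τ + (1 + τ + (1 + (1 + max 1 1) + 1))) ?_
      (le_of_eq (by rw [max_self]; ring)) fun _ h => h
    refine Tri.seq (Tri.skJoin (Tri.seq (Tri.skQuery (Tri.seq ?_))))
    simp only [Expr.eval_var, h22, Int.floor_intCast, h17, Int.floor_natCast, hs1,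
      setSk_var, setSk_sk, if_true, Function.update_self, h1g.1]
    have hfin : ∀ s₂ : State S, s₂.sk 2 = Function.update (s.sk 2) (β + gcode H g)
        (jn (s₀.sk 2 (β + gcode H g)) (s₀.sk 1 w)) → s₂.arr = s.arr → s₂.var 22 = s.var 22 →
        (0 < s₂.var 18 ↔ 0 < s.var 18 ∨
          orc (jn (s₀.sk 2 (β + gcode H g)) (s₀.sk 1 w)) = true) →
        Tri jn orc τ (.write (d + 1) (.var 22) (.read (d + 1) (.var 22) + 1)) s₂ 1
          (Swept jn orc d β H w s₀ (insert g V)) := by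
      intro s₂ e1 e2 e3 e4
      refine Tri.write ?_
      simp only [Expr.eval_var, Expr.eval_read, Expr.eval_hadd, Expr.eval_one, e3, h22, Int.floor_intCast, e2, h1g.2]
      refine ⟨fun g' hg' => ?_, fun x hx => ?_, ?_⟩
      · simp only [setArr_sk, setArr_arr, if_true, e1, e2]
        by_cases hgg : g' = g
        · subst hgg
          simp
        · have : β + gcode H g' ≠ β + gcode H g :=
            fun h => hgg (gcode_inj hg' hgH (by linarith))
          have hm : g' ∈ insert g V ↔ g' ∈ V := by simp [hgg]
          rw [Function.update_of_ne this, Function.update_of_ne this]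
          have h1' := h1 g' hg'
          by_cases hgV' : g' ∈ V
          · rw [if_pos hgV', if_pos hgV'] at h1'
            rwa [if_pos (hm.2 hgV'), if_pos (hm.2 hgV')]
          · rw [if_neg hgV', if_neg hgV'] at h1'
            rwa [if_neg (hm.not.2 hgV'), if_neg (hm.not.2 hgV')]
      · have : x ≠ β + gcode H g := by linarith [gcode_lt hgH]
        simp only [setArr_sk, setArr_arr, if_true, e1, e2, Function.update_of_ne this]
        exact h2 x hx
      · rw [setArr_var, e4, h3, Set.exists_mem_insert, or_assoc,
          or_comm (a := ∃ g ∈ V, _)]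
    refine Tri.ite (fun hb => Tri.assign (hfin _ (by simp) (by simp) (by simp) ?_))
      (fun hb => Tri.skip (hfin _ (by simp) (by simp) (by simp) ?_))
    all_goals simp only [Test.holds, Expr.eval_zero, Expr.eval_var, setVar_var, if_true] at hb
    · have hq : orc (jn (s₀.sk 2 (β + gcode H g)) (s₀.sk 1 w)) = true := by
        by_contra hq
        simp [hq] at hb
      simp [hq]
    · have hq : ¬ orc (jn (s₀.sk 2 (β + gcode H g)) (s₀.sk 1 w)) = true := by
        intro hq
        simp [hq] at hb
      simp [hq]

/-- The points represented by `w`. -/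
def cluster (own : Fin n → Fin n) (w : Fin n) : Finset (Fin n) := Finset.univ.filter (own · = w)

/-- The number of points of `l` near the lattice point `g`. -/
noncomputable def nearCount (P : Fin n → EuclideanSpace ℝ (Fin d)) (l : List (Fin n)) (u R : ℝ)
    (g : Fin d → ℤ) : ℕ := by
  classical
  exact (Finset.univ.filter fun w => w ∈ l ∧ dist (P w) (latt u g) ≤ R).card

/-- The array `f` starts with the list `l`. -/
def Holds (f : ℤ → ℝ) (l : List (Fin n)) : Prop :=
  ∀ (j : ℕ) (h : j < l.length), f j = (l[j] : ℕ)

variable {F : Set (Finset (Fin n))} (σ : Sketching F S)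

/-- The cells with address at least `β` are unused. -/
def Fresh (d : ℕ) (s : State S) (β : ℤ) : Prop :=
  ∀ x ≥ β, s.arr (d + 1) x = 0 ∧ s.sk 2 x = σ.sketch ∅

/-- The state holds the list `l` of representatives, and the sketches of their clusters. -/
structure Clustered (d : ℕ) (s : State S) (l : List (Fin n)) (own : Fin n → Fin n) : Prop where
  v4 : s.var 4 = l.length
  holds : Holds (s.arr d) l
  sketch : ∀ w ∈ l, s.sk 1 (w : ℕ) = σ.sketch (cluster own w)

variable {σ} {l : List (Fin n)} {own : Fin n → Fin n}

theorem mem_take_succ {j : ℕ} (h : j < l.length) {w : Fin n} :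
    w ∈ l.take (j + 1) ↔ w ∈ l.take j ∨ w = l[j] := by
  rw [List.take_succ_eq_append_getElem h, List.mem_append, List.mem_singleton]

theorem getElem_notMem_take (hl : l.Nodup) {j : ℕ} (h : j < l.length) : l[j] ∉ l.take j := by
  intro hm
  have := (List.take_sublist (j + 1) l).nodup hl
  rw [List.take_succ_eq_append_getElem h, List.nodup_append] at this
  exact this.2.2 _ hm _ (by simp) rfl

/-- The first `j` points of `l` have been treated. -/
structure Passed (σ : Sketching F S) (P : Fin n → EuclideanSpace ℝ (Fin d)) (own : Fin n → Fin n)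
    (β : ℤ) (u R : ℝ) (H : ℕ) (l : List (Fin n)) (s : State S) : Prop where
  sk : ∀ g : Fin d → ℤ, (∀ k, |g k| ≤ H) →
    s.sk 2 (β + gcode H g) = σ.sketch (hitSet P own l u R g)
  cnt : ∀ g : Fin d → ℤ, (∀ k, |g k| ≤ H) →
    s.arr (d + 1) (β + gcode H g) = nearCount P l u R g
  fresh : Fresh σ d s (β + (2 * H + 1) ^ d)
  flag : 0 < s.var 18 ↔ ∃ g : Fin d → ℤ, hitSet P own l u R g ∈ F

/-- Clusters of different representatives are disjoint, so each join is legitimate and every lattice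
point ends up with the sketch of its hit set. The flag records whether some intermediate hit set was
accepted. Hit sets only grow and `F` is upward closed, so this is the same as acceptance at the end.
-/
theorem passLoop_spec (hemp : ∅ ∉ F) (hF : IsUpperSet F) (hτ : 1 ≤ τ) (hl : l.Nodup)
    (hok : GridOK P u R L H) (hG : Grid P s₀ β u R L H) (hs : Clustered σ d s₀ l own)
    (hfr : Fresh σ d s₀ β) (h18 : s₀.var 18 = 0) :
    Tri σ.join σ.oracle τ (passLoop d) s₀ (22 * τ * ((2 * L + 1) ^ d : ℕ) * l.length + 3)
      (Passed σ P own β u R H l) := by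
  have hwv : ∀ x, (passLoop d).wv x ↔ 16 ≤ x ∧ x ≤ 20 ∨ x = 22 := by
    intro x
    simp only [passLoop, sweep, passBody, Prog.wv_for, Prog.wv, or_false, false_or]
    omega
  have hwa : ∀ x, (passLoop d).wa x ↔ x = d + 1 := by
    intro x
    simp [passLoop, sweep, passBody, Prog.wa]
  have hwk : ∀ x, (passLoop d).wk x ↔ x = 2 := by
    intro x
    simp [passLoop, sweep, passBody, Prog.wk]
  have hK : (1 : ℝ) ≤ ((2 * L + 1) ^ d : ℕ) := by exact_mod_cast Nat.one_le_pow _ _ (by omega)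
  have hτ' : (1 : ℝ) ≤ τ := by exact_mod_cast hτ
  have hhit0 : ∀ g : Fin d → ℤ, hitSet P own (l.take 0) u R g = ∅ := by
    intro g; ext p; simp [mem_hitSet]
  have key : Tri σ.join σ.oracle τ (passLoop d) s₀
      (l.length * ((1 + 1 + (((2 * L + 1) ^ d : ℕ) * (2 * τ + 12) + 3)) + 3) + 3)
      (Passed σ P own β u R H (l.take l.length)) := by
    refine Tri.for (I := fun j => Passed σ P own β u R H (l.take j)) ?_ ?_ ?_ ?_ ?_
    · simp [sweep, passBody, Prog.wv]
    · rintro j s v ⟨h1, h2, h3, h4⟩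
      exact ⟨h1, h2, h3, by simpa using h4⟩
    · refine ⟨fun g hg => ?_, fun g hg => ?_, fun x hx => hfr x ?_, ?_⟩
      · rw [hhit0]
        exact (hfr _ (by linarith [gcode_nonneg hg])).2
      · rw [(hfr _ (by linarith [gcode_nonneg hg])).1]
        simp [nearCount]
      · have : (0 : ℤ) ≤ (2 * H + 1) ^ d := by positivity
        linarith
      -- Before any point is treated all hit sets are empty, and `∅ ∉ F` agrees with the flag being
      -- zero.
      · simp only [hhit0, hemp, h18]
        simp
    · intro j s hf hj hI
      simp only [Expr.eval_var]
      rw [hf.var 4 ((hwv 4).not.2 (by omega)), hs.v4]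
    · intro j hj s hf hjs hI
      have harr : ∀ a ≤ d, s.arr a = s₀.arr a := fun a ha => hf.arr a ((hwa a).not.2 (by omega))
      have hid : s.arr d (j : ℤ) = (l[j] : ℕ) := by rw [harr d le_rfl]; exact hs.holds j hj
      refine Tri.seq (Tri.assign ((sweep_passBody_spec (β := β) (w := l[j]) hok ?_ ?_).mono le_rfl ?_))
      · refine hG.congr (fun x hx => ?_) (fun a ha => ?_)
        · rw [setVar_var, if_neg (by omega)]
          exact hf.var x ((hwv x).not.2 (by omega))
        · exact harr a ha.le
      · simp [hjs, hid]
      · rintro s' ⟨h1, h2, h3⟩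
        have hdis : ∀ g, Disjoint (hitSet P own (l.take j) u R g) (cluster own l[j]) := by
          intro g
          rw [Finset.disjoint_left]
          intro p hp hp'
          rw [mem_hitSet] at hp
          simp only [cluster, Finset.mem_filter, Finset.mem_univ, true_and] at hp'
          exact getElem_notMem_take hl hj (hp' ▸ hp.1)
        have hsucc : ∀ g, hitSet P own (l.take (j + 1)) u R g =
            if dist (P l[j]) (latt u g) ≤ R then hitSet P own (l.take j) u R g ∪ cluster own l[j]
            else hitSet P own (l.take j) u R g := by
          intro g
          ext p
          split_ifs with h
          · simp only [mem_hitSet, mem_take_succ hj, Finset.mem_union, cluster, Finset.mem_filter,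
              Finset.mem_univ, true_and]
            constructor
            · rintro ⟨h | h, h'⟩ <;> tauto
            · rintro (h' | h')
              · tauto
              · exact ⟨Or.inr h', h' ▸ h⟩
          · simp only [mem_hitSet, mem_take_succ hj]
            constructor
            · rintro ⟨h' | h', h''⟩
              · exact ⟨h', h''⟩
              · exact absurd (h' ▸ h'') h
            · rintro ⟨h', h''⟩
              exact ⟨Or.inl h', h''⟩
        have hsk1 : s.sk 1 (l[j] : ℕ) = σ.sketch (cluster own l[j]) := by
          rw [hf.sk 1 ((hwk 1).not.2 (by omega))]
          exact hs.sketch _ (List.getElem_mem hj)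
        have hjoin : ∀ g : Fin d → ℤ, (∀ k, |g k| ≤ H) →
            σ.join (s.sk 2 (β + gcode H g)) (s.sk 1 (l[j] : ℕ)) =
              σ.sketch (hitSet P own (l.take j) u R g ∪ cluster own l[j]) := by
          intro g hg
          rw [hI.sk g hg, hsk1, σ.join_sketch _ _ (hdis g)]
        refine ⟨fun g hg => ?_, fun g hg => ?_, fun x hx => ?_, ?_⟩
        · rw [(h1 g hg).1, hsucc]
          simp only [Set.mem_ofPred_eq, setVar_sk]
          split_ifs
          · exact hjoin g hg
          · exact hI.sk g hg
        · rw [(h1 g hg).2]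
          simp only [Set.mem_ofPred_eq, setVar_arr, hI.cnt g hg, nearCount]
          split_ifs with h
          · have hins : (Finset.univ.filter fun w => w ∈ l.take (j + 1) ∧ dist (P w) (latt u g) ≤ R)
                = insert l[j] (Finset.univ.filter fun w => w ∈ l.take j ∧
                  dist (P w) (latt u g) ≤ R) := by
              ext w
              simp only [mem_take_succ hj, Finset.mem_filter, Finset.mem_univ, true_and,
                Finset.mem_insert]
              constructor
              · rintro ⟨h' | h', h''⟩ <;> tauto
              · rintro (h' | h')
                · exact ⟨Or.inr h', h' ▸ h⟩
                · tauto
            rw [hins, Finset.card_insert_of_notMem]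
            · push_cast
              rfl
            · simp [getElem_notMem_take hl hj]
          · have hins : (Finset.univ.filter fun w => w ∈ l.take (j + 1) ∧ dist (P w) (latt u g) ≤ R)
                = Finset.univ.filter fun w => w ∈ l.take j ∧ dist (P w) (latt u g) ≤ R := by
              ext w
              simp only [mem_take_succ hj, Finset.mem_filter, Finset.mem_univ, true_and]
              constructor
              · rintro ⟨h' | h', h''⟩
                · exact ⟨h', h''⟩
                · exact absurd (h' ▸ h'') h
              · tauto
            rw [hins, add_zero]
        · have := h2 x hx
          rw [this.1, this.2]
          exact hI.fresh x hx
        · rw [h3]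
          simp only [setVar_var, setVar_sk]
          rw [if_neg (by omega), hI.flag]
          constructor
          · rintro (⟨g, hg⟩ | ⟨g, hg : dist (P l[j]) (latt u g) ≤ R, hq⟩)
            · refine ⟨g, hF ?_ hg⟩
              rw [hsucc]
              split_ifs
              · exact Finset.subset_union_left
              · exact le_rfl
            · rw [hjoin g (hok.abs_le hg), σ.oracle_sketch] at hq
              refine ⟨g, ?_⟩
              rw [hsucc, if_pos hg]
              exact hq
          · rintro ⟨g, hg⟩
            rw [hsucc] at hg
            split_ifs at hg with h
            · refine Or.inr ⟨g, h, ?_⟩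
              rw [hjoin g (hok.abs_le h), σ.oracle_sketch]
              exact hg
            · exact Or.inl ⟨g, hg⟩
  rw [List.take_length] at key
  refine key.mono ?_ fun _ h => h
  have h1 : ((2 * L + 1) ^ d : ℕ) * (2 * (τ : ℝ) + 12) + 8 ≤ 22 * τ * ((2 * L + 1) ^ d : ℕ) := by
    nlinarith
  nlinarith [Nat.cast_nonneg (α := ℝ) l.length]

theorem Clustered.congr {s s' : State S} (h : Clustered σ d s l own) (h4 : s'.var 4 = s.var 4)
    (ha : s'.arr d = s.arr d) (hk : s'.sk 1 = s.sk 1) : Clustered σ d s' l own :=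
  ⟨h4 ▸ h.v4, ha ▸ h.holds, hk ▸ h.sketch⟩

theorem Fresh.congr {s s' : State S} (h : Fresh σ d s β) (ha : s'.arr (d + 1) = s.arr (d + 1))
    (hk : s'.sk 2 = s.sk 2) : Fresh σ d s' β := by
  intro x hx
  rw [ha, hk]
  exact h x hx

theorem wv_gridSetup (x : ℕ) : (gridSetup d).wv x ↔ 11 ≤ x ∧ x ≤ 15 := by
  simp only [gridSetup, Prog.wv]; omega

theorem wv_pass (x : ℕ) : (pass d).wv x ↔ 11 ≤ x ∧ x ≤ 20 ∨ x = 22 := by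
  simp only [pass, passLoop, sweep, passBody, Prog.wv_for, Prog.wv, wv_gridSetup, or_false, false_or]; omega

theorem wa_pass (x : ℕ) : (pass d).wa x ↔ x = d + 1 := by
  simp [pass, gridSetup, passLoop, sweep, passBody, Prog.wa]

theorem wk_pass (x : ℕ) : (pass d).wk x ↔ x = 2 := by
  simp [pass, gridSetup, passLoop, sweep, passBody, Prog.wk]

theorem pass_spec (hemp : ∅ ∉ F) (hF : IsUpperSet F) (hτ : 1 ≤ τ) (hl : l.Nodup)
    {b : ℝ} (hu : 0 < u) (hR : 0 ≤ R) (hb : ∀ i k, |P i k| ≤ b) (hb0 : 0 ≤ b)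
    (h5 : s₀.var 5 = β) (h9 : s₀.var 9 = u) (h10 : s₀.var 10 = R) (h2 : s₀.var 2 = b)
    (hc : Coords P s₀) (hs : Clustered σ d s₀ l own) (hfr : Fresh σ d s₀ β)
    {Q : State S → Prop}
    (hQ : ∀ s' H, Frame (pass d) s₀ s' → GridOK P u R (⌊R / u⌋₊ + 2) H →
      Grid P s' β u R (⌊R / u⌋₊ + 2) H → Passed σ P own β u R H l s' → Q s') :
    Tri σ.join σ.oracle τ (pass d) s₀
      (22 * τ * ((2 * (⌊R / u⌋₊ + 2) + 1) ^ d : ℕ) * l.length + 15) Q := by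
  refine Tri.mono (Tri.frame (T := 1 + 9 + (1 + 1 +
    (22 * τ * ((2 * (⌊R / u⌋₊ + 2) + 1) ^ d : ℕ) * l.length + 3)))
    (Q := fun s' => ∃ H, GridOK P u R (⌊R / u⌋₊ + 2) H ∧
      Grid P s' β u R (⌊R / u⌋₊ + 2) H ∧ Passed σ P own β u R H l s') ?_) (le_of_eq (by ring))
      fun s' ⟨hf, H, h1, h2, h3⟩ => hQ s' H hf h1 h2 h3
  refine Tri.seq (gridSetup_spec hu hR hb hb0 h5 h9 h10 h2 hc fun s' H hf hok hG => ?_)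
  refine Tri.seq (Tri.assign ?_)
  have hG' : Grid P (s'.setVar 18 ((0 : Expr).eval s')) β u R (⌊R / u⌋₊ + 2) H :=
    hG.congr (fun x hx => by rw [setVar_var, if_neg (by omega)]) fun _ _ => rfl
  refine Tri.mono (Tri.frame (passLoop_spec (own := own) hemp hF hτ hl hok hG' ?_ ?_ ?_)) le_rfl ?_
  · exact hs.congr (by simp [hf.var 4 ((wv_gridSetup 4).not.2 (by omega))])
      (hf.arr d (by simp [gridSetup, Prog.wa])) (hf.sk 1 (by simp [gridSetup, Prog.wk]))
  · exact hfr.congr (hf.arr _ (by simp [gridSetup, Prog.wa]))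
      (hf.sk 2 (by simp [gridSetup, Prog.wk]))
  · simp
  · rintro s'' ⟨hf', h⟩
    refine ⟨H, hok, hG'.congr (fun x hx => hf'.var x ?_) (fun a ha => hf'.arr a ?_), h⟩
    · simp only [passLoop, sweep, passBody, Prog.wv_for, Prog.wv, or_false, false_or]; omega
    · simp only [passLoop, sweep, passBody, Prog.wa_for, Prog.wa, or_false, false_or]; omega

end Pass

end RealRAM

namespace RealRAM

/-! ### Shortening the list of representatives. -/

section Routines

variable {S : Type} {τ : ℕ} {d n : ℕ} {P : Fin n → EuclideanSpace ℝ (Fin d)} {s₀ : State S}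
  {β : ℤ} {u R : ℝ} {L H : ℕ} {F : Set (Finset (Fin n))} {σ : Sketching F S} {l : List (Fin n)}
  {own : Fin n → Fin n} {jn : S → S → S} {orc : S → Bool}

theorem Holds.append {f : ℤ → ℝ} {l : List (Fin n)} (h : Holds f l) (w : Fin n) :
    Holds (Function.update f (l.length : ℤ) ((w : ℕ) : ℝ)) (l ++ [w]) := by
  intro j hj
  rw [List.length_append, List.length_singleton] at hj
  by_cases hjl : j = l.length
  · subst hjl
    simp
  · rw [Function.update_of_ne (by exact_mod_cast hjl), List.getElem_append_left (by omega)]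
    exact h j (by omega)

/-! ### Pruning -/

theorem wv_prune (x : ℕ) : (prune d).wv x ↔ x = 4 ∨ x = 16 ∨ x = 17 ∨ x = 21 := by
  simp only [prune, pruneLoop, Prog.wv_for, Prog.wv, or_false, false_or]; omega

theorem wa_prune (x : ℕ) : (prune d).wa x ↔ x = d := by
  simp [prune, pruneLoop, Prog.wa]

theorem wk_prune (x : ℕ) : ¬ (prune d).wk x := by
  simp [prune, pruneLoop, Prog.wk]

/-- The points that are kept when pruning. -/
noncomputable def pruned (P : Fin n → EuclideanSpace ℝ (Fin d)) (l : List (Fin n)) (u R : ℝ) :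
    List (Fin n) :=
  l.filter fun w => decide (1 < nearCount P l u R (cell u (P w)))

theorem prune_spec (hok : GridOK P u R L H) (hG : Grid P s₀ β u R L H)
    (hs : Clustered σ d s₀ l own) (hcnt : ∀ g : Fin d → ℤ, (∀ k, |g k| ≤ H) →
      s₀.arr (d + 1) (β + gcode H g) = nearCount P l u R g) :
    Tri jn orc τ (prune d) s₀ (9 * l.length + 8) fun s =>
      Frame (prune d) s₀ s ∧ Clustered σ d s (pruned P l u R) own := by
  let keep : Fin n → Bool := fun w => decide (1 < nearCount P l u R (cell u (P w)))
  have key : ∀ s₁ : State S, Frame (prune d) s₀ s₁ → s₁.var 21 = 0 → s₁.arr d = s₀.arr d →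
      s₁.var 4 = s₀.var 4 →
      Tri jn orc τ (pruneLoop d) s₁ (l.length * ((1 + 1 + (1 + max (1 + 1 + 1) 1)) + 3) + 3)
        fun s => s.var 21 = ((l.take l.length).filter keep).length ∧
          Holds (s.arr d) ((l.take l.length).filter keep) ∧
          ∀ (i : ℕ) (h : i < l.length), l.length ≤ i → s.arr d i = (l[i] : ℕ) := by
    intro s₁ hf₁ h21 had h4
    refine Tri.for (I := fun j s => s.var 21 = ((l.take j).filter keep).length ∧
      Holds (s.arr d) ((l.take j).filter keep) ∧
      ∀ (i : ℕ) (h : i < l.length), j ≤ i → s.arr d i = (l[i] : ℕ)) ?_ ?_ ?_ ?_ ?_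
    · simp [Prog.wv]
    · rintro j s v ⟨h1, h2, h3⟩
      exact ⟨by simpa using h1, h2, h3⟩
    · refine ⟨by simpa using h21, fun j hj => by simp at hj, fun i hi _ => ?_⟩
      rw [had]
      exact hs.holds i hi
    · intro j s hf hj hI
      rw [Expr.eval_var, hf.var 4 (by simp [Prog.wv]), h4, hs.v4]
    · rintro j hj s hf hjs ⟨h1, h2, h3⟩
      have hf₂ : Frame (prune d) s₀ s := hf₁.trans (hf.weaken
        (fun x hx => (wv_prune x).2 (by
          simp only [Prog.wv_for, Prog.wv, or_false, false_or] at hx; omega))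
        (fun x hx => (wa_prune x).2 (by simpa [Prog.wa] using hx))
        (fun x hx => by simp [Prog.wk] at hx))
      -- The list is compacted in place: the write position never passes the read position, so
      -- unread entries stay intact.
      have hlen : ((l.take j).filter keep).length ≤ j :=
        (List.length_filter_le _ _).trans (by simp)
      have hid : (Expr.read d (.var 16)).eval s = (l[j] : ℕ) := by
        rw [Expr.eval_read, Expr.eval_var, hjs, Int.floor_natCast]
        exact h3 j hj le_rfl
      obtain ⟨s₂, hs₂⟩ : ∃ s₂, s₂ = s.setVar 17 ((Expr.read d (.var 16)).eval s) := ⟨_, rfl⟩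
      have h17 : s₂.var 17 = (l[j] : ℕ) := by simp [hs₂, -Expr.eval_read, hid]
      have hv21 : s₂.var 21 = ((l.take j).filter keep).length := by simpa [hs₂] using h1
      have harr : s₂.arr = s.arr := by simp [hs₂]
      have hG' : Grid P s₂ β u R L H :=
        hG.congr (fun x hx => by
          rw [hs₂, setVar_var, if_neg (by omega)]
          exact hf₂.var x ((wv_prune x).not.2 (by omega)))
          fun a ha => by rw [harr]; exact hf₂.arr a ((wa_prune a).not.2 (by omega))
      have htest : (Test.lt 1 (.read (d + 1) (cellAddr d))).holds s₂ ↔ keep l[j] = true := by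
        rw [Test.holds, Expr.eval_read, hG'.eval_cellAddr h17,
          Int.floor_intCast, harr, hf₂.arr (d + 1) ((wa_prune _).not.2 (by omega)),
          hcnt _ (hok.abs_cell_le _), Expr.eval_one]
        simp only [keep, decide_eq_true_eq]
        norm_cast
      have htake : (l.take (j + 1)).filter keep =
          (l.take j).filter keep ++ (if keep l[j] then [l[j]] else []) := by
        rw [List.take_succ_eq_append_getElem hj, List.filter_append, List.filter_singleton]
        cases keep l[j] <;> rfl
      simp only [htake]
      refine Tri.seq (Tri.assign ?_)
      rw [← hs₂]
      refine Tri.ite (fun hb => ?_) fun hb => Tri.skip ?_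
      · rw [htest] at hb
        simp only [hb, if_true]
        refine Tri.seq (Tri.write (Tri.assign ?_))
        simp only [Expr.eval_var, Expr.eval_hadd, Expr.eval_one, setVar_var, setVar_arr,
          setArr_arr, setArr_var, if_true, h17, hv21, harr, Int.floor_natCast]
        refine ⟨by simp, h2.append l[j], fun i hi hji => ?_⟩
        rw [Function.update_of_ne (by omega)]
        exact h3 i hi (by omega)
      · rw [htest] at hb
        simp only [hb, Bool.false_eq_true, if_false, List.append_nil, harr]
        exact ⟨hv21, h2, fun i hi hji => h3 i hi (by omega)⟩
  refine Tri.mono (Tri.frame (T := 1 + 1 + (1 +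
    (l.length * ((1 + 1 + (1 + max (1 + 1 + 1) 1)) + 3) + 3) + 1))
    (Q := fun s => Clustered σ d s (pruned P l u R) own) ?_) ?_ fun _ h => h
  · refine Tri.seq (Tri.assign (Tri.seq ((key (s₀.setVar 21 ((0 : Expr).eval s₀)) ?_ ?_ rfl
      ?_).frame.mono le_rfl ?_)))
    · refine ⟨fun x hx => ?_, fun _ _ => rfl, fun _ _ => rfl⟩
      rw [wv_prune] at hx
      rw [setVar_var, if_neg (by omega)]
    · simp
    · simp
    · rintro s ⟨hf, h1, h2, -⟩
      rw [List.take_length] at h1 h2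
      refine Tri.assign ⟨by simpa [pruned, keep] using h1, h2, fun w hw => ?_⟩
      rw [setVar_sk, hf.sk 1 (by simp [pruneLoop, Prog.wk]), setVar_sk]
      exact hs.sketch w (List.mem_of_mem_filter hw)
  · norm_num
    linarith [Nat.cast_nonneg (α := ℝ) l.length]

/-! ### Nets -/

theorem wv_net (x : ℕ) : (net d).wv x ↔
    x = 4 ∨ 11 ≤ x ∧ x ≤ 17 ∨ x = 19 ∨ x = 21 ∨ x = 22 := by
  simp only [net, netLoop, sweep, Prog.wv_for, Prog.wv, or_false, false_or, wv_gridSetup]; omega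

theorem wk_net (x : ℕ) : (net d).wk x ↔ x = 1 := by
  simp [net, netLoop, sweep, gridSetup, Prog.wk]

open Classical in
/-- The lattice points in `V` have been marked for the point `w`. -/
def Marked (d : ℕ) (β : ℤ) (H : ℕ) (w : ℕ) (s₀ : State S) (V : Set (Fin d → ℤ))
    (s : State S) : Prop :=
  (∀ g : Fin d → ℤ, (∀ k, |g k| ≤ H) →
    s.arr (d + 1) (β + gcode H g) = if g ∈ V then (w : ℝ) + 1
      else s₀.arr (d + 1) (β + gcode H g)) ∧
  ∀ x : ℤ, β + (2 * H + 1) ^ d ≤ x → s.arr (d + 1) x = s₀.arr (d + 1) x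

theorem sweep_mark_spec (hok : GridOK P u R L H) (hG : Grid P s₀ β u R L H) {w : Fin n}
    (hw : s₀.var 17 = (w : ℕ)) :
    Tri jn orc τ (sweep d (.write (d + 1) (.var 22) (.var 17 + 1))) s₀
      (((2 * L + 1) ^ d : ℕ) * (1 + 6) + 3)
      (Marked d β H w s₀ {g | dist (P w) (latt u g) ≤ R}) := by
  refine sweep_spec (I := Marked d β H w s₀) (by positivity) hok hG hw ?_ ?_ ?_ ?_ ?_
  · simp [Prog.wv]
  · simp [Prog.wa]
  · rintro V s x v _ h
    exact h
  · exact ⟨fun g _ => by simp, fun x _ => rfl⟩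
  · intro V g s hg hgV hV hf h22 ⟨h1, h2⟩
    have h17 : s.var 17 = (w : ℕ) := by
      rw [hf.var 17, hw]
      simp [sweep, Prog.wv]
    have hgH := fun k => hok.abs_le hg k
    refine Tri.write ⟨fun g' hg' => ?_, fun x hx => ?_⟩
    · simp only [Expr.eval_var, Expr.eval_hadd, Expr.eval_one, h22, h17, Int.floor_intCast,
        setArr_arr, if_true]
      by_cases hgg : g' = g
      · subst hgg
        simp
      · have : β + gcode H g' ≠ β + gcode H g :=
          fun h => hgg (gcode_inj hg' hgH (by linarith))
        have hm : g' ∈ insert g V ↔ g' ∈ V := by simp [hgg]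
        rw [Function.update_of_ne this, h1 g' hg']
        by_cases hgV' : g' ∈ V
        · rw [if_pos hgV', if_pos (hm.2 hgV')]
        · rw [if_neg hgV', if_neg (hm.not.2 hgV')]
    · have : x ≠ β + gcode H g := by linarith [gcode_lt hgH]
      simp only [Expr.eval_var, h22, Int.floor_intCast, setArr_arr, if_true,
        Function.update_of_ne this]
      exact h2 x hx

/-- The points of `l₁` (with representatives given by `own`) have been replaced by their net
`l'`. -/
structure NetOf (P : Fin n → EuclideanSpace ℝ (Fin d)) (own : Fin n → Fin n) (u R : ℝ)
    (l₁ l' : List (Fin n)) (own' : Fin n → Fin n) : Prop where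
  sub : l'.Sublist l₁
  mem : ∀ p, own p ∈ l₁ → own' p ∈ l' ∧ dist (P (own p)) (P (own' p)) ≤ R + u * d
  eq : ∀ p, own p ∉ l₁ → own' p = own p
  sep : ∀ w ∈ l', ∀ w' ∈ l', w ≠ w' → R - u * d < dist (P w) (P w')

/-- The state in which the first `j` points of `l` have been treated. -/
structure Netted (σ : Sketching F S) (P : Fin n → EuclideanSpace ℝ (Fin d)) (own : Fin n → Fin n)
    (β : ℤ) (u R : ℝ) (H : ℕ) (l : List (Fin n)) (j : ℕ) (l' : List (Fin n))
    (own' : Fin n → Fin n) (s : State S) : Prop where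
  net : NetOf P own u R (l.take j) l' own'
  v21 : s.var 21 = l'.length
  holds : Holds (s.arr d) l'
  tail : ∀ (i : ℕ) (h : i < l.length), j ≤ i → s.arr d i = (l[i] : ℕ)
  sk : ∀ w ∈ l', s.sk 1 (w : ℕ) = σ.sketch (cluster own' w)
  sk_tail : ∀ w ∈ l, w ∉ l.take j → s.sk 1 (w : ℕ) = σ.sketch (cluster own w)
  mark : ∀ g : Fin d → ℤ, (∀ k, |g k| ≤ H) →
    (s.arr (d + 1) (β + gcode H g) = 0 ∧ ∀ w ∈ l', ¬ dist (P w) (latt u g) ≤ R) ∨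
    ∃ w ∈ l', s.arr (d + 1) (β + gcode H g) = (w : ℕ) + 1 ∧ dist (P w) (latt u g) ≤ R
  fresh : Fresh σ d s (β + (2 * H + 1) ^ d)

theorem NetOf.merge {j : ℕ} (hj : j < l.length) {l' : List (Fin n)}
    {own' : Fin n → Fin n} (h : NetOf P own u R (l.take j) l' own') {w : Fin n} (hw : w ∈ l')
    (hd : dist (P l[j]) (P w) ≤ R + u * d) :
    NetOf P own u R (l.take (j + 1)) l' (fun p => if own p = l[j] then w else own' p) := by
  refine ⟨h.sub.trans ?_, fun p hp => ?_, fun p hp => ?_, h.sep⟩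
  · rw [List.take_succ_eq_append_getElem hj]
    exact List.sublist_append_left _ _
  · rw [mem_take_succ hj] at hp
    split_ifs with hpv
    · exact ⟨hw, hpv ▸ hd⟩
    · exact h.mem p (hp.resolve_right hpv)
  · rw [mem_take_succ hj, not_or] at hp
    rw [if_neg hp.2]
    exact h.eq p hp.1

/-- Points whose old representative has not been treated yet still have it under `own'`. Thus the
cluster of `l[j]` is untouched and disjoint from the clusters of all net points. -/
theorem NetOf.cluster_merge (hl : l.Nodup) {j : ℕ} (hj : j < l.length) {l' : List (Fin n)}
    {own' : Fin n → Fin n} (h : NetOf P own u R (l.take j) l' own') {w : Fin n} (hw : w ∈ l') :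
    Disjoint (cluster own' w) (cluster own l[j]) ∧
    cluster (fun p => if own p = l[j] then w else own' p) w =
      cluster own' w ∪ cluster own l[j] ∧
    ∀ w' ∈ l', w' ≠ w → cluster (fun p => if own p = l[j] then w else own' p) w' =
      cluster own' w' := by
  have hv := getElem_notMem_take hl hj
  have hne : ∀ w ∈ l', w ≠ l[j] := fun w hw h' => hv (h' ▸ h.sub.subset hw)
  have hown : ∀ p, own p = l[j] → own' p = l[j] := fun p hp => by
    rw [h.eq p (by rw [hp]; exact hv), hp]
  refine ⟨?_, ?_, fun w' hw' hww => ?_⟩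
  · rw [Finset.disjoint_left]
    intro p hp hp'
    simp only [cluster, Finset.mem_filter, Finset.mem_univ, true_and] at hp hp'
    exact hne w hw (hp.symm.trans (hown p hp'))
  · ext p
    simp only [cluster, Finset.mem_filter, Finset.mem_univ, true_and, Finset.mem_union]
    split_ifs with hp <;> simp [hp]
  · ext p
    simp only [cluster, Finset.mem_filter, Finset.mem_univ, true_and]
    split_ifs with hp
    · rw [hown p hp]
      exact ⟨fun h => absurd h hww.symm, fun h => absurd h.symm (hne w' hw')⟩
    · rfl

/-- The corner of the cell of `l[j]` is farther than `R` from every net point and within `u * d` of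
`l[j]` itself; hence the separation `R - u * d`. -/
theorem NetOf.extend (hl : l.Nodup) {j : ℕ} (hj : j < l.length) {l' : List (Fin n)}
    {own' : Fin n → Fin n} (h : NetOf P own u R (l.take j) l' own') (hu : 0 < u) (hR : 0 ≤ R)
    (hd : ∀ w ∈ l', R < dist (P w) (latt u (cell u (P l[j])))) :
    NetOf P own u R (l.take (j + 1)) (l' ++ [l[j]]) own' ∧
      cluster own' l[j] = cluster own l[j] := by
  have hv := getElem_notMem_take hl hj
  have hfar : ∀ w ∈ l', R - u * d < dist (P w) (P l[j]) := by
    intro w hw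
    linarith [hd w hw, dist_triangle (P w) (P l[j]) (latt u (cell u (P l[j]))),
      dist_latt_cell hu (P l[j])]
  refine ⟨⟨?_, fun p hp => ?_, fun p hp => ?_, fun w hw w' hw' hne => ?_⟩, ?_⟩
  · rw [List.take_succ_eq_append_getElem hj]
    exact h.sub.append (List.Sublist.refl _)
  · rw [mem_take_succ hj] at hp
    rcases hp with hp | hp
    · exact ⟨List.mem_append_left _ (h.mem p hp).1, (h.mem p hp).2⟩
    · rw [h.eq p (by rw [hp]; exact hv), dist_self]
      exact ⟨by simp [hp], by positivity⟩
  · rw [mem_take_succ hj, not_or] at hp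
    exact h.eq p hp.1
  · rw [List.mem_append, List.mem_singleton] at hw hw'
    rcases hw with hw | rfl <;> rcases hw' with hw' | rfl
    · exact h.sep w hw w' hw' hne
    · exact hfar w hw
    · rw [dist_comm]
      exact hfar w' hw'
    · exact absurd rfl hne
  · ext p
    simp only [cluster, Finset.mem_filter, Finset.mem_univ, true_and]
    by_cases hp : own p ∈ l.take j
    · refine ⟨fun h' => absurd (h.sub.subset (h.mem p hp).1) (h' ▸ hv), fun h' => ?_⟩
      exact absurd (h' ▸ hp) hv
    · rw [h.eq p hp]

/-- A lattice point remembers only the last net point that marked it. One near net point suffices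
for merging, and an absent mark excludes all of them. -/
theorem netLoop_spec (hτ : 1 ≤ τ) (hl : l.Nodup) (hok : GridOK P u R L H)
    (hG : Grid P s₀ β u R L H) (hs : Clustered σ d s₀ l own) (hfr : Fresh σ d s₀ β)
    (h21 : s₀.var 21 = 0) :
    Tri σ.join σ.oracle τ (netLoop d) s₀ (22 * τ * ((2 * L + 1) ^ d : ℕ) * l.length + 3)
      fun s => ∃ l' own', Netted σ P own β u R H l l.length l' own' s := by
  have hwv : ∀ x, (netLoop d).wv x ↔ x = 16 ∨ x = 17 ∨ x = 19 ∨ x = 21 ∨ x = 22 := by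
    intro x
    simp only [netLoop, sweep, Prog.wv_for, Prog.wv, or_false, false_or]
    omega
  have hwa : ∀ x, (netLoop d).wa x ↔ x = d ∨ x = d + 1 := by
    intro x
    simp [netLoop, sweep, Prog.wa]
  have hwk : ∀ x, (netLoop d).wk x ↔ x = 1 := by
    intro x
    simp [netLoop, sweep, Prog.wk]
  have hK : (1 : ℝ) ≤ ((2 * L + 1) ^ d : ℕ) := by exact_mod_cast Nat.one_le_pow _ _ (by omega)
  have hτ' : (1 : ℝ) ≤ τ := by exact_mod_cast hτ
  have key : Tri σ.join σ.oracle τ (netLoop d) s₀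
      (l.length * ((1 + 1 + (1 + max (τ : ℝ)
        (1 + 1 + (1 + 1 + (((2 * L + 1) ^ d : ℕ) * (1 + 6) + 3))))) + 3) + 3)
      fun s => ∃ l' own', Netted σ P own β u R H l l.length l' own' s := by
    refine Tri.for (I := fun j s => ∃ l' own', Netted σ P own β u R H l j l' own' s) ?_ ?_ ?_ ?_ ?_
    · simp [sweep, Prog.wv]
    · rintro j s v ⟨l', own', h⟩
      exact ⟨l', own', h.net, by simpa using h.v21, h.holds, h.tail, h.sk, h.sk_tail, h.mark,
        h.fresh⟩
    · refine ⟨[], own, ⟨⟨by simp, by simp, by simp, by simp⟩, by simpa using h21,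
        fun j hj => by simp at hj, fun i hi _ => hs.holds i hi, by simp,
        fun w hw _ => hs.sketch w hw, fun g hg => Or.inl ⟨?_, by simp⟩, fun x hx => hfr x ?_⟩⟩
      · exact (hfr _ (by linarith [gcode_nonneg hg])).1
      · have : (0 : ℤ) ≤ (2 * H + 1) ^ d := by positivity
        linarith
    · intro j s hf hj hI
      rw [Expr.eval_var, hf.var 4 ((hwv 4).not.2 (by omega)), hs.v4]
    · rintro j hj s hf hjs ⟨l', own', hN⟩
      have hid : (Expr.read d (.var 16)).eval s = (l[j] : ℕ) := by
        rw [Expr.eval_read, Expr.eval_var, hjs, Int.floor_natCast]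
        exact hN.tail j hj le_rfl
      obtain ⟨s₁, hs₁⟩ : ∃ s₁, s₁ = s.setVar 17 ((Expr.read d (.var 16)).eval s) := ⟨_, rfl⟩
      have h17 : s₁.var 17 = (l[j] : ℕ) := by simp [hs₁, -Expr.eval_read, hid]
      have harr : s₁.arr = s.arr := by simp [hs₁]
      have hsk : s₁.sk = s.sk := by simp [hs₁]
      have hG' : Grid P s₁ β u R L H :=
        hG.congr (fun x hx => by
          rw [hs₁, setVar_var, if_neg (by omega)]
          exact hf.var x ((hwv x).not.2 (by omega)))
          fun a ha => by rw [harr]; exact hf.arr a ((hwa a).not.2 (by omega))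
      have hlen : l'.length ≤ j := hN.net.sub.length_le.trans (by simp)
      have hcell := hok.abs_cell_le (w := l[j])
      have hread : (Expr.read (d + 1) (cellAddr d)).eval s₁ =
          s.arr (d + 1) (β + gcode H (cell u (P l[j]))) := by
        rw [Expr.eval_read, hG'.eval_cellAddr h17, Int.floor_intCast, harr]
      refine Tri.seq (Tri.assign ?_)
      rw [← hs₁]
      refine Tri.ite (fun hb => ?_) fun hb => ?_
      · rw [Test.holds, hread, Expr.eval_zero] at hb
        rcases hN.mark _ hcell with ⟨h0, -⟩ | ⟨w, hw, hmw, hnear⟩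
        · rw [h0] at hb
          exact absurd hb (lt_irrefl 0)
        have hd : dist (P l[j]) (P w) ≤ R + u * d := by
          linarith [dist_triangle_right (P l[j]) (P w) (latt u (cell u (P l[j]))),
            dist_latt_cell hok.pos (P l[j])]
        obtain ⟨hdis, hcl, hcl'⟩ := hN.net.cluster_merge hl hj hw
        have hwv' : w ≠ l[j] := fun h' => getElem_notMem_take hl hj (h' ▸ hN.net.sub.subset hw)
        refine Tri.skJoin ⟨l', _, hN.net.merge hj hw hd, ?_, ?_, ?_, ?_, ?_, ?_, ?_⟩
        · simpa [hs₁] using hN.v21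
        · exact harr ▸ hN.holds
        · rw [setSk_arr, harr]
          exact fun i hi hji => hN.tail i hi (by omega)
        all_goals simp only [Expr.eval_hsub, hread, hmw, Expr.eval_one, add_sub_cancel_right,
          Int.floor_natCast, Expr.eval_var, h17, setSk_sk, setSk_arr, if_true, hsk, harr]
        · intro w' hw'
          by_cases hww : w' = w
          · subst hww
            rw [Function.update_self, hcl, ← σ.join_sketch _ _ hdis, ← hN.sk _ hw,
              ← hN.sk_tail _ (List.getElem_mem hj) (getElem_notMem_take hl hj)]
          · rw [Function.update_of_ne (by simpa [Fin.ext_iff] using hww), hcl' w' hw' hww]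
            exact hN.sk w' hw'
        · intro w' hw' hnot
          rw [mem_take_succ hj, not_or] at hnot
          have hww : w' ≠ w := fun h' => hnot.1 (h' ▸ hN.net.sub.subset hw)
          rw [Function.update_of_ne (by simpa [Fin.ext_iff] using hww)]
          exact hN.sk_tail w' hw' hnot.1
        · exact hN.mark
        · exact hN.fresh.congr (by simp [harr]) (by simp [hsk])
      · rw [Test.holds, hread, Expr.eval_zero] at hb
        have hfar : ∀ w ∈ l', ¬ dist (P w) (latt u (cell u (P l[j]))) ≤ R := by
          rcases hN.mark _ hcell with ⟨-, h⟩ | ⟨w, hw, hmw, hnear⟩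
          · exact h
          · rw [hmw] at hb
            exact absurd (by positivity) hb
        obtain ⟨hnet, hcl⟩ := hN.net.extend hl hj hok.pos hok.nonneg
          fun w hw => not_le.1 (hfar w hw)
        refine Tri.seq (Tri.write (Tri.seq (Tri.assign ?_)))
        have hv21 : s₁.var 21 = l'.length := by simpa [hs₁] using hN.v21
        simp only [Expr.eval_var, Expr.eval_hadd, Expr.eval_one, setArr_var, hv21, h17,
          Int.floor_natCast]
        set s₂ := (s₁.setArr d (l'.length : ℤ) ((l[j] : ℕ) : ℝ)).setVar 21 ((l'.length : ℝ) + 1)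
          with hs₂
        have hG₂ : Grid P s₂ β u R L H :=
          hG'.congr (fun x hx => by simp only [hs₂, setVar_var, setArr_var]; rw [if_neg (by omega)])
            fun a ha => by simp [hs₂, ha.ne]
        refine (sweep_mark_spec (β := β) (w := l[j]) hok hG₂ (by simp [hs₂, h17])).frame.mono
          le_rfl ?_
        rintro s₃ ⟨hf₃, hm1, hm2⟩
        have hd3 : s₃.arr d = Function.update (s.arr d) (l'.length : ℤ) ((l[j] : ℕ) : ℝ) := by
          rw [hf₃.arr d (by simp [sweep, Prog.wa])]
          simp [hs₂, hs₁]
        have hk3 : s₃.sk = s.sk := by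
          funext a
          rw [hf₃.sk a (by simp [sweep, Prog.wk])]
          simp [hs₂, hs₁]
        have hd1 : s₂.arr (d + 1) = s.arr (d + 1) := by simp [hs₂, hs₁]
        have hv := getElem_notMem_take hl hj
        refine ⟨l' ++ [l[j]], own', hnet, ?_, ?_, ?_, ?_, ?_, ?_, ?_⟩
        · rw [hf₃.var 21 (by simp [sweep, Prog.wv])]
          simp [hs₂]
        · rw [hd3]
          exact hN.holds.append _
        · intro i hi hji
          rw [hd3, Function.update_of_ne (by omega)]
          exact hN.tail i hi (by omega)
        · intro w hw
          rw [hk3]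
          rw [List.mem_append, List.mem_singleton] at hw
          rcases hw with hw | rfl
          · exact hN.sk w hw
          · rw [hcl]
            exact hN.sk_tail _ (List.getElem_mem hj) hv
        · intro w hw hnot
          rw [mem_take_succ hj, not_or] at hnot
          rw [hk3]
          exact hN.sk_tail w hw hnot.1
        · intro g hg
          rw [hm1 g hg, hd1]
          by_cases hgn : dist (P l[j]) (latt u g) ≤ R
          · exact Or.inr ⟨l[j], by simp, if_pos hgn, hgn⟩
          · rw [if_neg (by exact hgn)]
            rcases hN.mark g hg with ⟨h0, h⟩ | ⟨w, hw, hmw, hnear⟩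
            · refine Or.inl ⟨h0, fun w hw => ?_⟩
              rw [List.mem_append, List.mem_singleton] at hw
              rcases hw with hw | rfl
              · exact h w hw
              · exact hgn
            · exact Or.inr ⟨w, List.mem_append_left _ hw, hmw, hnear⟩
        · intro x hx
          rw [hm2 x hx, hk3, hd1]
          exact hN.fresh x hx
  refine key.mono ?_ fun _ h => h
  have h1 : max (τ : ℝ) (1 + 1 + (1 + 1 + (((2 * L + 1) ^ d : ℕ) * (1 + 6) + 3))) ≤
      15 * τ * ((2 * L + 1) ^ d : ℕ) := max_le (by nlinarith) (by nlinarith)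
  have h2 : 1 ≤ (τ : ℝ) * ((2 * L + 1) ^ d : ℕ) := by nlinarith
  nlinarith [Nat.cast_nonneg (α := ℝ) l.length]

theorem net_spec (hτ : 1 ≤ τ) (hl : l.Nodup)
    {b : ℝ} (hu : 0 < u) (hR : 0 ≤ R) (hb : ∀ i k, |P i k| ≤ b) (hb0 : 0 ≤ b)
    (h5 : s₀.var 5 = β) (h9 : s₀.var 9 = u) (h10 : s₀.var 10 = R) (h2 : s₀.var 2 = b)
    (hc : Coords P s₀) (hs : Clustered σ d s₀ l own) (hfr : Fresh σ d s₀ β) :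
    Tri σ.join σ.oracle τ (net d) s₀
      (22 * τ * ((2 * (⌊R / u⌋₊ + 2) + 1) ^ d : ℕ) * l.length + 17) fun s =>
      Frame (net d) s₀ s ∧ ∃ H l' own', Grid P s β u R (⌊R / u⌋₊ + 2) H ∧
        NetOf P own u R l l' own' ∧ Clustered σ d s l' own' ∧
        Fresh σ d s (β + (2 * H + 1) ^ d) := by
  refine Tri.mono (Tri.frame (T := 1 + 9 + (1 + 1 + (1 +
    (22 * τ * ((2 * (⌊R / u⌋₊ + 2) + 1) ^ d : ℕ) * l.length + 3) + 1)))
    (Q := fun s => ∃ H l' own', Grid P s β u R (⌊R / u⌋₊ + 2) H ∧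
        NetOf P own u R l l' own' ∧ Clustered σ d s l' own' ∧
        Fresh σ d s (β + (2 * H + 1) ^ d)) ?_) (le_of_eq (by ring)) fun _ h => h
  refine Tri.seq (gridSetup_spec hu hR hb hb0 h5 h9 h10 h2 hc fun s' H hf hok hG => ?_)
  refine Tri.seq (Tri.assign (Tri.seq ?_))
  have hG' : Grid P (s'.setVar 21 ((0 : Expr).eval s')) β u R (⌊R / u⌋₊ + 2) H :=
    hG.congr (fun x hx => by rw [setVar_var, if_neg (by omega)]) fun _ _ => rfl
  refine (netLoop_spec (own := own) (σ := σ) hτ hl hok hG' ?_ ?_ ?_).frame.mono le_rfl ?_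
  · exact hs.congr (by simp [hf.var 4 ((wv_gridSetup 4).not.2 (by omega))])
      (hf.arr d (by simp [gridSetup, Prog.wa])) (hf.sk 1 (by simp [gridSetup, Prog.wk]))
  · exact hfr.congr (hf.arr _ (by simp [gridSetup, Prog.wa]))
      (hf.sk 2 (by simp [gridSetup, Prog.wk]))
  · simp
  · rintro s'' ⟨hf', l', own', h⟩
    have hnet := h.net
    rw [List.take_length] at hnet
    refine Tri.assign ⟨H, l', own', hG'.congr (fun x hx => ?_) (fun a ha => hf'.arr a ?_), hnet,
      ⟨by simpa using h.v21, h.holds, h.sk⟩, h.fresh⟩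
    · rw [setVar_var, if_neg (by omega)]
      refine hf'.var x ?_
      simp only [netLoop, sweep, Prog.wv_for, Prog.wv, or_false, false_or]; omega
    · simp only [netLoop, sweep, Prog.wa_for, Prog.wa, or_false, false_or]; omega

end Routines

end RealRAM

namespace RealRAM

/-! ### The nearest neighbour in the list. -/

section Nearest

variable {S : Type} {τ : ℕ} {d n : ℕ} {P : Fin n → EuclideanSpace ℝ (Fin d)} {s₀ s : State S}
  {F : Set (Finset (Fin n))} {σ : Sketching F S} {l : List (Fin n)}
  {jn : S → S → S} {orc : S → Bool}

theorem Coords.eval_sqDist (hc : Coords P s) {i j : Expr} {v w : Fin n}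
    (hi : i.eval s = (v : ℕ)) (hj : j.eval s = (w : ℕ)) :
    (sqDist d i j).eval s = dist (P v) (P w) ^ 2 := by
  have h1 := hc v
  have h2 := hc w
  rw [EuclideanSpace.dist_eq, Real.sq_sqrt (Finset.sum_nonneg fun _ _ => sq_nonneg _)]
  simp only [sqDist, Expr.eval_sum, Expr.eval_hmul, Expr.eval_hsub, Expr.eval_read, hi, hj,
    Int.floor_natCast, h1, h2, Real.dist_eq, sq_abs]
  exact Finset.sum_congr rfl fun k _ => (sq _).symm

/-- `ℓ` is the distance of `x` to its nearest neighbour in `l`. -/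
structure NearestAt (P : Fin n → EuclideanSpace ℝ (Fin d)) (x : Fin n) (l : List (Fin n))
    (ℓ : ℝ) : Prop where
  pos : 0 < ℓ
  mem : ∃ y ∈ l, y ≠ x ∧ dist (P x) (P y) = ℓ
  le : ∀ y ∈ l, y ≠ x → ℓ ≤ dist (P x) (P y)

theorem wv_nearest (x : ℕ) : (nearest d).wv x ↔ x = 16 ∨ x = 20 ∨ x = 25 := by
  simp only [nearest, Prog.wv_for, Prog.wv, or_false]; omega

theorem wa_nearest (x : ℕ) : ¬ (nearest d).wa x := by
  simp [nearest, Prog.wa]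

theorem wk_nearest (x : ℕ) : ¬ (nearest d).wk x := by
  simp [nearest, Prog.wk]

/-- Zero in variable `25` means that no neighbour has been seen yet. It cannot be confused with a
squared distance, since `P` is injective; testing for a positive distance also skips the point
itself. -/
theorem nearest_spec (hP : Function.Injective P) (hc : Coords P s₀) (h4 : s₀.var 4 = l.length)
    (hl : Holds (s₀.arr d) l) {x : Fin n} (hx : s₀.var 23 = (x : ℕ)) (hne : ∃ y ∈ l, y ≠ x) :
    Tri jn orc τ (nearest d) s₀ (8 * l.length + 5) fun s =>
      Frame (nearest d) s₀ s ∧ ∃ ℓ, s.var 25 = ℓ ^ 2 ∧ NearestAt P x l ℓ := by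
  refine Tri.mono (Tri.frame (T := 1 + 1 + (l.length * (1 + 1 + (1 + max 1 1) + 3) + 3))
    (Q := fun s => (s.var 25 = 0 ∧ ∀ y ∈ l.take l.length, y = x) ∨
      ∃ ℓ, s.var 25 = ℓ ^ 2 ∧ NearestAt P x (l.take l.length) ℓ) ?_) ?_ ?_
  · refine Tri.seq (Tri.assign (Tri.for (I := fun j s =>
      (s.var 25 = 0 ∧ ∀ y ∈ l.take j, y = x) ∨
      ∃ ℓ, s.var 25 = ℓ ^ 2 ∧ NearestAt P x (l.take j) ℓ) ?_ ?_ ?_ ?_ ?_))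
    · simp [Prog.wv]
    · intro j s v h
      simpa using h
    · exact Or.inl (by simp)
    · intro j s hf hj hI
      rw [Expr.eval_var, hf.var 4 (by simp [Prog.wv])]
      simpa using h4
    · intro j hj s hf hjs hI
      have harr : s.arr = s₀.arr := by
        funext a
        rw [hf.arr a (by simp [Prog.wa])]
        rfl
      have h23 : s.var 23 = (x : ℕ) := by
        rw [hf.var 23 (by simp [Prog.wv])]
        simpa using hx
      have hd : (sqDist d (.var 23) (.read d (.var 16))).eval s = dist (P x) (P l[j]) ^ 2 := by
        refine Coords.eval_sqDist (hc.congr fun a _ => by rw [harr]) h23 ?_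
        rw [Expr.eval_read, Expr.eval_var, hjs, Int.floor_natCast, harr]
        exact hl j hj
      have hmono : ∀ ℓ, NearestAt P x (l.take j) ℓ → (l[j] ≠ x → ℓ ≤ dist (P x) (P l[j])) →
          NearestAt P x (l.take (j + 1)) ℓ := by
        rintro ℓ ⟨hp, ⟨y, hy, hyx⟩, hle⟩ h
        refine ⟨hp, ⟨y, (mem_take_succ hj).2 (Or.inl hy), hyx⟩, fun y hy hyx => ?_⟩
        rcases (mem_take_succ hj).1 hy with hy | rfl
        · exact hle y hy hyx
        · exact h hyx
      have hzero : 0 < dist (P x) (P l[j]) ^ 2 ↔ l[j] ≠ x := by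
        rw [sq_pos_iff, dist_ne_zero, hP.ne_iff, ne_comm]
      refine Tri.seq (Tri.assign (Tri.ite (fun hb => Tri.assign ?_) fun hb => Tri.skip ?_))
      all_goals
        simp only [Test.holds, Expr.eval_zero, Expr.eval_var, setVar_var, if_true, hd, hzero] at hb ⊢
      · norm_num at hb
        refine Or.inr ⟨_, rfl, ?_, ⟨l[j], (mem_take_succ hj).2 (Or.inr rfl), hb.1, rfl⟩,
          fun y hy hyx => ?_⟩
        · exact dist_pos.2 (hP.ne (Ne.symm hb.1))
        · rcases (mem_take_succ hj).1 hy with hy | rfl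
          · rcases hI with ⟨_, h⟩ | ⟨ℓ, h25, hn⟩
            · exact absurd (h y hy) hyx
            · have := hb.2 (by rw [h25]; exact pow_pos hn.pos 2)
              rw [h25] at this
              exact (lt_of_pow_lt_pow_left₀ 2 hn.pos.le this).le.trans (hn.le y hy hyx)
          · exact le_rfl
      · norm_num at hb
        rcases hI with ⟨h25, h⟩ | ⟨ℓ, h25, hn⟩
        · have hjx : l[j] = x := by
            by_contra hjx
            have := (hb hjx).1
            rw [h25] at this
            exact lt_irrefl _ this
          refine Or.inl ⟨by simpa using h25, fun y hy => ?_⟩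
          rcases (mem_take_succ hj).1 hy with hy | rfl
          · exact h y hy
          · exact hjx
        · refine Or.inr ⟨ℓ, by simpa using h25, hmono ℓ hn fun hjx => ?_⟩
          have := (hb hjx).2
          rw [h25] at this
          exact le_of_sq_le_sq this dist_nonneg
  · norm_num
    linarith [Nat.cast_nonneg (α := ℝ) l.length]
  · rintro s ⟨hf, h⟩
    rw [List.take_length] at h
    refine ⟨hf, h.resolve_left fun h' => ?_⟩
    obtain ⟨y, hy, hyx⟩ := hne
    exact hyx (h'.2 y hy)

end Nearest

/-! ### Initialisation. -/

section Init

variable {S : Type} {τ : ℕ} {d n : ℕ} {P : Fin n → EuclideanSpace ℝ (Fin d)} {s₀ s : State S}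
  {F : Set (Finset (Fin n))} {σ : Sketching F S}

theorem wv_init (x : ℕ) : (init d).wv x ↔ x = 2 ∨ x = 3 ∨ x = 4 ∨ x = 16 ∨ x = 20 := by
  simp only [init, initLoop, Prog.wv_for, Prog.wv, or_false, false_or]; omega

theorem wa_init (x : ℕ) : (init d).wa x ↔ x = d := by
  simp [init, initLoop, Prog.wa]

theorem wk_init (x : ℕ) : (init d).wk x ↔ x = 1 := by
  simp [init, initLoop, Prog.wk]

theorem cluster_id (i : Fin n) : cluster id i = {i} := by
  ext j
  simp [cluster]

theorem init_spec (hτ : 1 ≤ τ) (hn : 1 ≤ n) (h0 : s₀.var 0 = n) (hc : Coords P s₀)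
    (hsk : ∀ i : Fin n, s₀.sk 0 (i : ℕ) = σ.sketch {i}) (hsk3 : s₀.sk 3 0 = σ.sketch ∅) :
    Tri σ.join σ.oracle τ (init d) s₀ (30 * τ * n) fun s =>
      Frame (init d) s₀ s ∧ Clustered σ d s (List.finRange n) id ∧
      (0 ≤ s.var 2 ∧ ∀ i k, |P i k| ≤ s.var 2) ∧
      (0 < s.var 3 ↔ ∅ ∈ F ∨ ∃ i, {i} ∈ F) := by
  have hτ' : (1 : ℝ) ≤ τ := by exact_mod_cast hτ
  have hn' : (1 : ℝ) ≤ n := by exact_mod_cast hn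
  refine Tri.mono (Tri.frame (T := 1 + 1 + (1 + τ + (1 + (n * (1 + 1 + (1 + τ + (1 + τ +
    (1 + (1 + max 1 1) + 1))) + 3) + 3) + 1))) (Q := fun s =>
      Clustered σ d s (List.finRange n) id ∧ (0 ≤ s.var 2 ∧ ∀ i k, |P i k| ≤ s.var 2) ∧
      (0 < s.var 3 ↔ ∅ ∈ F ∨ ∃ i, {i} ∈ F)) ?_) ?_ fun _ h => h
  · refine Tri.seq (Tri.assign (Tri.seq (Tri.skQuery (Tri.seq ?_))))
    obtain ⟨s₁, hs₁⟩ : ∃ s₁, s₁ = (s₀.setVar 2 ((0 : Expr).eval s₀)).setVar 3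
      (if σ.oracle ((s₀.setVar 2 ((0 : Expr).eval s₀)).sk 3
        ⌊(0 : Expr).eval (s₀.setVar 2 ((0 : Expr).eval s₀))⌋) = true then 1 else 0) := ⟨_, rfl⟩
    rw [← hs₁]
    have hf₁ : ∀ x, x ≠ 2 → x ≠ 3 → s₁.var x = s₀.var x := fun x h2 h3 => by simp [hs₁, h2, h3]
    have ha₁ : s₁.arr = s₀.arr := by simp [hs₁]
    have hk₁ : s₁.sk = s₀.sk := by simp [hs₁]
    have h2₁ : s₁.var 2 = 0 := by simp [hs₁]
    have h3₁ : 0 < s₁.var 3 ↔ ∅ ∈ F := by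
      by_cases h : ∅ ∈ F
      · simp [hs₁, hsk3, (σ.oracle_sketch ∅).2 h, h]
      · simp [hs₁, hsk3, mt (σ.oracle_sketch ∅).1 h, h]
    refine Tri.mono (Tri.frame (Tri.for (T := 1 + 1 + (1 + τ + (1 + τ + (1 + (1 + max 1 1) + 1))))
      (n := n) (I := fun j s => (∀ i : Fin n, (i : ℕ) < j → s.arr d (i : ℕ) = (i : ℕ) ∧
        s.sk 1 (i : ℕ) = σ.sketch {i} ∧ ∀ k, |P i k| ≤ s.var 2) ∧ 0 ≤ s.var 2 ∧
        (0 < s.var 3 ↔ ∅ ∈ F ∨ ∃ i : Fin n, (i : ℕ) < j ∧ {i} ∈ F)) ?_ ?_ ?_ ?_ ?_)) le_rfl ?_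
    · simp [Prog.wv]
    · rintro j s v ⟨h1, h2, h3⟩
      exact ⟨by simpa using h1, by simpa using h2, by simpa using h3⟩
    · exact ⟨by simp, h2₁.ge, by simpa using h3₁⟩
    · intro j s hf hj hI
      rw [Expr.eval_var, hf.var 0 (by simp [Prog.wv]), hf₁ 0 (by simp) (by simp), h0]
    · rintro j hj s hf hjs ⟨h1, h2, h3⟩
      have hsk0 : s.sk 0 (j : ℤ) = σ.sketch {⟨j, hj⟩} := by
        rw [hf.sk 0 (by simp [Prog.wk]), hk₁]
        exact hsk ⟨j, hj⟩
      have hcj : ∀ k : Fin d, s.arr k (j : ℤ) = P ⟨j, hj⟩ k := by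
        intro k
        rw [hf.arr k (by simp [Prog.wa, k.2.ne]), ha₁]
        exact hc ⟨j, hj⟩ k
      have hsum : ∀ i : Fin n, ∀ s' : State S, s'.var 16 = j → (∀ k : Fin d, s'.arr k = s.arr k) →
          (Expr.sum (fun k => .sqrt (.read k (.var 16) * .read k (.var 16))) d).eval s' =
            ∑ k, |P ⟨j, hj⟩ k| := by
        intro i s' h16 ha
        simp only [Expr.eval_sum, Expr.eval_sqrt, Expr.eval_hmul, Expr.eval_read, Expr.eval_var,
          h16, ha, Int.floor_natCast, hcj, Real.sqrt_mul_self_eq_abs]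
      have hfin : ∀ s' : State S, s'.var 16 = j → s'.var 2 = s.var 2 →
          (∀ k : Fin d, s'.arr k = s.arr k) →
          s'.arr d = Function.update (s.arr d) (j : ℤ) (j : ℝ) →
          s'.sk 1 = Function.update (s.sk 1) (j : ℤ) (s.sk 0 (j : ℤ)) →
          (0 < s'.var 3 ↔ 0 < s.var 3 ∨ {⟨j, hj⟩} ∈ F) →
          Tri σ.join σ.oracle τ (.assign 2 (.var 2 + .sum (fun k => .sqrt (.read k (.var 16) *
            .read k (.var 16))) d)) s' 1 fun s =>
            (∀ i : Fin n, (i : ℕ) < j + 1 → s.arr d (i : ℕ) = (i : ℕ) ∧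
            s.sk 1 (i : ℕ) = σ.sketch {i} ∧ ∀ k, |P i k| ≤ s.var 2) ∧ 0 ≤ s.var 2 ∧
            (0 < s.var 3 ↔ ∅ ∈ F ∨ ∃ i : Fin n, (i : ℕ) < j + 1 ∧ {i} ∈ F) := by
        intro s' e16 e2 ek ed e1 e3
        refine Tri.assign ?_
        have hnn : 0 ≤ ∑ k, |P ⟨j, hj⟩ k| := Finset.sum_nonneg fun _ _ => abs_nonneg _
        simp only [Expr.eval_hadd, Expr.eval_var, hsum ⟨j, hj⟩ s' e16 ek, setVar_var, setVar_arr,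
          setVar_sk, if_true, e2, ed, e1]
        refine ⟨fun i hi => ?_, by positivity, ?_⟩
        · by_cases hij : (i : ℕ) = j
          · subst hij
            rw [Function.update_self, Function.update_self]
            refine ⟨rfl, hsk0, fun k => ?_⟩
            have := Finset.single_le_sum (f := fun k => |P i k|) (fun k _ => abs_nonneg _)
              (Finset.mem_univ k)
            dsimp only at this
            change |P i k| ≤ s.var 2 + ∑ k, |P i k|
            linarith
          · have hne : ((i : ℕ) : ℤ) ≠ j := by exact_mod_cast hij
            rw [Function.update_of_ne hne, Function.update_of_ne hne]
            obtain ⟨a, b, c⟩ := h1 i (by omega)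
            exact ⟨a, b, fun k => (c k).trans (by linarith)⟩
        · rw [if_neg (by omega), e3, h3]
          constructor
          · rintro ((h | ⟨i, hi, h⟩) | h)
            · exact Or.inl h
            · exact Or.inr ⟨i, by omega, h⟩
            · exact Or.inr ⟨_, Nat.lt_succ_self j, h⟩
          · rintro (h | ⟨i, hi, h⟩)
            · exact Or.inl (Or.inl h)
            · by_cases hij : (i : ℕ) = j
              · subst hij
                exact Or.inr h
              · exact Or.inl (Or.inr ⟨i, by omega, h⟩)
      refine Tri.seq (Tri.write (Tri.seq (Tri.skCopy (Tri.seq (Tri.skQuery (Tri.seq ?_))))))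
      obtain ⟨s₂, hs₂⟩ : ∃ s₂ : State S, s₂ = (s.setArr d (j : ℤ) (j : ℝ)).setSk 1 (j : ℤ)
        (s.sk 0 (j : ℤ)) := ⟨_, rfl⟩
      simp only [Expr.eval_var, hjs, Int.floor_natCast, setArr_var, setArr_sk, setSk_var]
      rw [← hs₂]
      have e0 : s₂.sk 0 (j : ℤ) = σ.sketch {⟨j, hj⟩} := by rw [hs₂, ← hsk0]; simp
      have ek : ∀ k : Fin d, s₂.arr k = s.arr k := fun k => by simp [hs₂, k.2.ne]
      have ed : s₂.arr d = Function.update (s.arr d) (j : ℤ) (j : ℝ) := by simp [hs₂]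
      have e1 : s₂.sk 1 = Function.update (s.sk 1) (j : ℤ) (s.sk 0 (j : ℤ)) := by simp [hs₂]
      have ev : s₂.var = s.var := by simp [hs₂]
      refine Tri.ite (fun hb => Tri.assign (hfin _ ?_ ?_ ek ed e1 ?_))
        fun hb => Tri.skip (hfin _ ?_ ?_ ek ed e1 ?_)
      all_goals simp only [Test.holds, Expr.eval_zero, Expr.eval_one, Expr.eval_var, setVar_var,
        if_true, e0, ev] at hb ⊢
      · simpa using hjs
      · simp
      · have : {⟨j, hj⟩} ∈ F := by
          rw [← σ.oracle_sketch]
          by_contra hq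
          simp [hq] at hb
        simp [this]
      · simpa using hjs
      · simp
      · have : {⟨j, hj⟩} ∉ F := by
          rw [← σ.oracle_sketch]
          intro hq
          simp [hq] at hb
        simp [this]
    · rintro s ⟨hf, h1, h2, h3⟩
      refine Tri.assign ⟨⟨?_, fun j hj => ?_, fun w _ => ?_⟩, ⟨?_, fun i k => ?_⟩, ?_⟩
      · rw [setVar_var, if_pos rfl, Expr.eval_var, hf.var 0 (by simp [initLoop, Prog.wv]),
          hf₁ 0 (by simp) (by simp), h0]
        simp
      · have := (h1 ⟨j, by simpa using hj⟩ (by simpa using hj)).1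
        simpa using this
      · rw [cluster_id]
        exact (h1 w w.2).2.1
      · simpa using h2
      · simpa using (h1 i i.2).2.2 k
      · simpa using h3
  · norm_num
    nlinarith

end Init

end RealRAM

namespace RealRAM

/-! ### One round of the main loop. -/

section MainStep

variable {S : Type} {τ : ℕ} {d n : ℕ} {P : Fin n → EuclideanSpace ℝ (Fin d)} {s s' : State S}
  {u R ρ E ε : ℝ} {F : Set (Finset (Fin n))} {σ : Sketching F S} {l : List (Fin n)}
  {own : Fin n → Fin n}

/-- What the routines need to know about the state. -/
structure Base (σ : Sketching F S) (P : Fin n → EuclideanSpace ℝ (Fin d)) (s : State S)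
    (l : List (Fin n)) (own : Fin n → Fin n) : Prop where
  clustered : Clustered σ d s l own
  coords : Coords P s
  fresh : ∃ β : ℤ, s.var 5 = β ∧ Fresh σ d s β
  nonneg : 0 ≤ s.var 2
  bound : ∀ i k, |P i k| ≤ s.var 2

/-- The routines have left the other variables unchanged. -/
structure Same (s s' : State S) : Prop where
  var : ∀ x, x ≠ 4 → x ≠ 5 → ¬ (11 ≤ x ∧ x ≤ 22) → x ≠ 25 → s'.var x = s.var x
  sk0 : s'.sk 0 = s.sk 0
  sk3 : s'.sk 3 = s.sk 3

theorem Base.setVar (h : Base σ P s l own) {x : ℕ} {v : ℝ} (h2 : x ≠ 2) (h4 : x ≠ 4)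
    (h5 : x ≠ 5) : Base σ P (s.setVar x v) l own := by
  obtain ⟨h1, hc, ⟨β, hβ, hf⟩, hn, hb⟩ := h
  refine ⟨h1.congr (by simp [h4.symm]) rfl rfl, hc, ⟨β, by simpa [h5.symm] using hβ, hf⟩, ?_, ?_⟩
  · simpa [h2.symm] using hn
  · simpa [h2.symm] using hb

theorem eval_bump {β : ℤ} {L H : ℕ} (hG : Grid P s β u R L H) :
    (Expr.var 5 + (Expr.var 14).power d).eval s = (β + (2 * H + 1) ^ d : ℤ) := by
  rw [Expr.eval_hadd, Expr.eval_power, Expr.eval_var, Expr.eval_var, hG.v5, hG.v14]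
  push_cast
  rfl

/-- The time for treating all points once, up to a constant factor. -/
def passTime (d τ m k : ℕ) : ℕ := τ * (2 * (k + 2) + 1) ^ d * m

theorem pass_bump_spec (hemp : ∅ ∉ F) (hF : IsUpperSet F) (hτ : 1 ≤ τ) (hl : l.Nodup)
    (hB : Base σ P s l own) (hu : 0 < u) (hR : 0 ≤ R) (h9 : s.var 9 = u) (h10 : s.var 10 = R)
    {q : Prog} {T : ℝ} {Q : State S → Prop}
    (hQ : ∀ s', Base σ P s' l own → Same s s' →
      (0 < s'.var 18 ↔ ∃ g : Fin d → ℤ, hitSet P own l u R g ∈ F) →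
      Tri σ.join σ.oracle τ q s' T Q) :
    Tri σ.join σ.oracle τ (.seq (pass d) (.seq (bump d) q)) s
      (22 * passTime d τ l.length ⌊R / u⌋₊ + 18 + T) Q := by
  obtain ⟨hcl, hc, ⟨β, hβ, hf⟩, hn, hb⟩ := hB
  refine Tri.mono (Tri.seq (pass_spec (σ := σ) (own := own) hemp hF hτ hl hu hR hb hn hβ h9 h10 rfl
    hc hcl hf fun s' H hfr hok hG hp => Tri.seq (T₁ := 1) (T₂ := T) (p := bump d)
      (Tri.assign (hQ _ ?_ ?_ ?_)))) ?_
    fun _ h => h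
  · have h2 := hfr.var 2 ((wv_pass 2).not.2 (by omega))
    refine ⟨hcl.congr ?_ (hfr.arr d ((wa_pass d).not.2 (by omega)))
      (hfr.sk 1 ((wk_pass 1).not.2 (by omega))), hG.coords,
      ⟨β + (2 * H + 1) ^ d, ?_, hp.fresh⟩, ?_, ?_⟩
    · rw [setVar_var, if_neg (by omega)]
      exact hfr.var 4 ((wv_pass 4).not.2 (by omega))
    · rw [setVar_var, if_pos rfl, eval_bump hG]
    · simpa [h2] using hn
    · simpa [h2] using hb
  · refine ⟨fun x h4 h5 hx _ => ?_, hfr.sk 0 ((wk_pass 0).not.2 (by omega)),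
      hfr.sk 3 ((wk_pass 3).not.2 (by omega))⟩
    rw [setVar_var, if_neg h5]
    exact hfr.var x ((wv_pass x).not.2 (by omega))
  · rw [setVar_var, if_neg (by omega)]
    exact hp.flag
  · simp only [passTime]
    push_cast
    linarith

theorem prune_bump_spec (hemp : ∅ ∉ F) (hF : IsUpperSet F) (hτ : 1 ≤ τ) (hl : l.Nodup)
    (hB : Base σ P s l own) (hu : 0 < u) (hR : 0 ≤ R) (h9 : s.var 9 = u) (h10 : s.var 10 = R)
    {Q : State S → Prop}
    (hQ : ∀ s', Base σ P s' (pruned P l u R) own → Same s s' → Q s') :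
    Tri σ.join σ.oracle τ (.seq (pass d) (.seq (prune d) (bump d))) s
      (22 * passTime d τ l.length ⌊R / u⌋₊ + 9 * l.length + 26) Q := by
  obtain ⟨hcl, hc, ⟨β, hβ, hf⟩, hn, hb⟩ := hB
  refine Tri.mono (Tri.seq (pass_spec (σ := σ) (own := own) hemp hF hτ hl hu hR hb hn hβ h9 h10 rfl
    hc hcl hf fun s' H hfr hok hG hp => Tri.seq ((prune_spec (own := own) (σ := σ) hok hG
      (hcl.congr (hfr.var 4 ((wv_pass 4).not.2 (by omega)))
        (hfr.arr d ((wa_pass d).not.2 (by omega))) (hfr.sk 1 ((wk_pass 1).not.2 (by omega))))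
      hp.cnt).mono le_rfl fun s'' hs'' => Tri.assign (hQ _ ?_ ?_)))) ?_ fun _ h => h
  · obtain ⟨hfr', hcl'⟩ := hs''
    have h2 : s''.var 2 = s.var 2 := (hfr'.var 2 ((wv_prune 2).not.2 (by omega))).trans
      (hfr.var 2 ((wv_pass 2).not.2 (by omega)))
    have hG' : Grid P s'' β u R (⌊R / u⌋₊ + 2) H :=
      hG.congr (fun x hx => hfr'.var x ((wv_prune x).not.2 (by omega)))
        fun a ha => hfr'.arr a ((wa_prune a).not.2 (by omega))
    refine ⟨hcl'.congr (by simp) rfl rfl, hG'.coords,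
      ⟨β + (2 * H + 1) ^ d, ?_, ?_⟩, ?_, ?_⟩
    · rw [setVar_var, if_pos rfl, eval_bump hG']
    · exact hp.fresh.congr (hfr'.arr _ ((wa_prune _).not.2 (by omega))) (hfr'.sk 2 (wk_prune 2))
    · simpa [h2] using hn
    · simpa [h2] using hb
  · obtain ⟨hfr', hcl'⟩ := hs''
    refine ⟨fun x h4 h5 hx _ => ?_,
      (hfr'.sk 0 (wk_prune 0)).trans (hfr.sk 0 ((wk_pass 0).not.2 (by omega))),
      (hfr'.sk 3 (wk_prune 3)).trans (hfr.sk 3 ((wk_pass 3).not.2 (by omega)))⟩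
    rw [setVar_var, if_neg h5, hfr'.var x ((wv_prune x).not.2 (by omega))]
    exact hfr.var x ((wv_pass x).not.2 (by omega))
  · simp only [passTime]
    push_cast
    linarith

theorem net_bump_spec (hτ : 1 ≤ τ) (hl : l.Nodup)
    (hB : Base σ P s l own) (hu : 0 < u) (hR : 0 ≤ R) (h9 : s.var 9 = u) (h10 : s.var 10 = R)
    {Q : State S → Prop}
    (hQ : ∀ s' l' own', Base σ P s' l' own' → Same s s' → NetOf P own u R l l' own' → Q s') :
    Tri σ.join σ.oracle τ (.seq (net d) (bump d)) s
      (22 * passTime d τ l.length ⌊R / u⌋₊ + 19) Q := by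
  obtain ⟨hcl, hc, ⟨β, hβ, hf⟩, hn, hb⟩ := hB
  refine Tri.mono (Tri.seq (T₂ := 1) ((net_spec (σ := σ) (own := own) hτ hl hu hR hb hn hβ h9 h10
    rfl hc hcl hf).mono le_rfl ?_)) ?_ fun _ h => h
  · rintro s' ⟨hfr, H, l', own', hG, hnet, hcl', hfresh⟩
    have h2 : s'.var 2 = s.var 2 := hfr.var 2 ((wv_net 2).not.2 (by omega))
    refine Tri.assign (hQ _ l' own' ⟨hcl'.congr (by simp) rfl rfl, hG.coords,
      ⟨β + (2 * H + 1) ^ d, ?_, hfresh⟩, ?_, ?_⟩ ⟨fun x h4 h5 hx _ => ?_,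
        hfr.sk 0 ((wk_net 0).not.2 (by omega)), hfr.sk 3 ((wk_net 3).not.2 (by omega))⟩ hnet)
    · rw [setVar_var, if_pos rfl, eval_bump hG]
    · simpa [h2] using hn
    · simpa [h2] using hb
    · rw [setVar_var, if_neg h5]
      exact hfr.var x ((wv_net x).not.2 (by omega))
  · simp only [passTime]
    push_cast
    linarith

/-- The input has not been changed. -/
structure Input (σ : Sketching F S) (P : Fin n → EuclideanSpace ℝ (Fin d)) (ε : ℝ)
    (s : State S) : Prop where
  v0 : s.var 0 = n
  v1 : s.var 1 = ε
  coords : Coords P s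
  sk0 : ∀ i : Fin n, s.sk 0 (i : ℕ) = σ.sketch {i}
  sk3 : s.sk 3 0 = σ.sketch ∅

theorem Input.congr (h : Input σ P ε s) (hs : Same s s') (hc : Coords P s') : Input σ P ε s' :=
  ⟨(hs.var 0 (by omega) (by omega) (by omega) (by omega)).trans h.v0,
    (hs.var 1 (by omega) (by omega) (by omega) (by omega)).trans h.v1, hc,
    fun i => hs.sk0 ▸ h.sk0 i, hs.sk3 ▸ h.sk3⟩

theorem Input.setVar (h : Input σ P ε s) {x : ℕ} {v : ℝ} (h0 : x ≠ 0) (h1 : x ≠ 1) :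
    Input σ P ε (s.setVar x v) :=
  ⟨by simpa [h0.symm] using h.v0, by simpa [h1.symm] using h.v1, h.coords, h.sk0, h.sk3⟩

/-- The invariant of the main loop. -/
structure MainInv (σ : Sketching F S) (P : Fin n → EuclideanSpace ℝ (Fin d)) (ε ρ : ℝ)
    (s : State S) (l : List (Fin n)) : Prop where
  input : Input σ P ε s
  v8 : s.var 8 = 0
  cl : ∃ own E, Clustering P F ρ l own E ∧ Base σ P s l own

/-- The main loop has succeeded. -/
structure MainDone (σ : Sketching F S) (P : Fin n → EuclideanSpace ℝ (Fin d)) (ε ρ : ℝ)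
    (s : State S) : Prop where
  input : Input σ P ε s
  v8 : s.var 8 = 1
  fresh : ∃ β : ℤ, s.var 5 = β ∧ Fresh σ d s β
  pos : 0 < s.var 6
  le : s.var 6 ≤ ρ
  ge : ρ ≤ s.var 7
  eq : s.var 7 = 307 * s.var 6

/-- The list `l'` is much shorter than `l`, on average over the choice of `x`. -/
def Shrinks (P : Fin n → EuclideanSpace ℝ (Fin d)) (l : List (Fin n)) (x : Fin n)
    (l' : List (Fin n)) : Prop :=
  l'.Sublist l ∧ ∃ ℓ, NearestAt P x l ℓ ∧
    ((∀ y ∈ l, (∀ z ∈ l, z ≠ y → ℓ ≤ dist (P y) (P z)) → y ∉ l') ∨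
      ∀ w ∈ l', ∀ w' ∈ l', w ≠ w' → 2 * ℓ < dist (P w) (P w'))

/-- Both `w` and `w'` are within `D + δ ≤ R` of the corner of the cell of `w`, so two points are
counted there. -/
theorem mem_pruned (hu : 0 < u) {δ D : ℝ} (hδ : u * d ≤ δ) (hDR : D + δ ≤ R) (hD : 0 ≤ D)
    {w w' : Fin n} (hw : w ∈ l) (hw' : w' ∈ l) (hne : w ≠ w') (hd : dist (P w) (P w') ≤ D) :
    w ∈ pruned P l u R := by
  have h1 := dist_latt_cell hu (P w)
  have h2 := dist_triangle_left (P w') (latt u (cell u (P w))) (P w)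
  rw [pruned, List.mem_filter, decide_eq_true_eq]
  refine ⟨hw, ?_⟩
  unfold nearCount
  rw [Finset.one_lt_card]
  refine ⟨w, ?_, w', ?_, hne⟩ <;> simp only [Finset.mem_filter, Finset.mem_univ, true_and]
  · exact ⟨hw, by linarith⟩
  · exact ⟨hw', by linarith⟩

/-- Whatever is counted at the corner of the cell of `w` lies within `R + δ < ℓ` of `w`; for an
isolated `w` this leaves only `w` itself. -/
theorem notMem_pruned (hu : 0 < u) {δ ℓ : ℝ} (hδ : u * d ≤ δ) (hℓ : R + δ < ℓ)
    {w : Fin n} (hfar : ∀ z ∈ l, z ≠ w → ℓ ≤ dist (P w) (P z)) :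
    w ∉ pruned P l u R := by
  have h1 := dist_latt_cell hu (P w)
  rw [pruned, List.mem_filter, decide_eq_true_eq]
  rintro ⟨-, h⟩
  unfold nearCount at h
  rw [Finset.one_lt_card] at h
  obtain ⟨a, ha, b, hb, hab⟩ := h
  simp only [Finset.mem_filter, Finset.mem_univ, true_and] at ha hb
  have key : ∀ z, z ∈ l ∧ dist (P z) (latt u (cell u (P w))) ≤ R → z = w := by
    rintro z ⟨hz, hz'⟩
    by_contra hne
    linarith [hfar z hz hne, dist_triangle_right (P w) (P z) (latt u (cell u (P w)))]
  exact hab ((key a ha).trans (key b hb).symm)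

theorem passTime_mono {m k k' : ℕ} (h : k ≤ k') : passTime d τ m k ≤ passTime d τ m k' := by
  unfold passTime
  gcongr

theorem mainStep_spec (hd : 1 ≤ d) (hn : 1 ≤ n) (hP : Function.Injective P) (hemp : ∅ ∉ F)
    (hF : IsUpperSet F) (hτ : 1 ≤ τ) (hρ : IsLeast (ballRadii P F) ρ) (h0 : 0 < ρ)
    (hI : MainInv σ P ε ρ s l) {r : ℕ} (hr : r < l.length) (h24 : s.var 24 = r) :
    Tri σ.join σ.oracle τ (mainStep d) s (300 * passTime d τ l.length (273 * d)) fun s' =>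
      MainDone σ P ε ρ s' ∨ ∃ l', MainInv σ P ε ρ s' l' ∧ Shrinks P l l[r] l' := by
  obtain ⟨hin, h8, own, E, hC, hB⟩ := hI
  have hlen := hC.two_le_length hF hρ h0 hn
  have hne : ∃ y ∈ l, y ≠ l[r] := by
    by_contra! h
    have : l.length ≤ 1 := by
      have hsub : l ⊆ [l[r]] := fun y hy => by simp [h y hy]
      simpa using (List.subperm_of_subset hC.nodup hsub).length_le
    omega
  have hd' : (0 : ℝ) < d := by exact_mod_cast hd
  have hfloor : ∀ (c : ℕ) (u : ℝ), 0 < u → ⌊(c * u) / (u / d)⌋₊ = c * d := by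
    intro c u hu
    rw [show (c * u) / (u / d) = ((c * d : ℕ) : ℝ) by push_cast; field_simp, Nat.floor_natCast]
  have hpt : (l.length : ℝ) ≤ passTime d τ l.length (273 * d) := by
    have : 1 * 1 * l.length ≤ passTime d τ l.length (273 * d) := by
      unfold passTime
      gcongr
      exact Nat.one_le_pow _ _ (by omega)
    exact_mod_cast (by linarith : l.length ≤ passTime d τ l.length (273 * d))
  have hlen' : (2 : ℝ) ≤ l.length := by exact_mod_cast hlen
  have hpc : ∀ c : ℕ, c ≤ 273 → (passTime d τ l.length (c * d) : ℝ) ≤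
      passTime d τ l.length (273 * d) := fun c hc => by
    exact_mod_cast passTime_mono (Nat.mul_le_mul_right d hc)
  -- the chosen point and its nearest neighbour
  have h23 : (Expr.read d (.var 24)).eval s = (l[r] : ℕ) := by
    rw [Expr.eval_read, Expr.eval_var, h24, Int.floor_natCast]
    exact hB.clustered.holds r hr
  refine Tri.mono (T := 1 + 1 + (1 + (8 * l.length + 5) + (1 + 1 + (1 + 1 + (1 + 1 + (
      22 * passTime d τ l.length (3 * d) + 18 + (1 + max
        ((1 : ℝ) + 1 + (22 * passTime d τ l.length (14 * d) + 9 * l.length + 26))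
        (1 + 1 + (22 * passTime d τ l.length (273 * d) + 18 + (1 + max ((1 : ℝ) + 1 + 1)
          (1 + 1 + (22 * passTime d τ l.length (33 * d) + 19))))))))))))
      ?_ ?_ fun _ h => h
  swap
  · have h3 := hpc 3 (by norm_num)
    have h14 := hpc 14 (by norm_num)
    have h33 := hpc 33 (by norm_num)
    have hm1 : max ((1 : ℝ) + 1 + 1) (1 + 1 + (22 * passTime d τ l.length (33 * d) + 19)) ≤
        22 * passTime d τ l.length (273 * d) + 21 := max_le (by linarith) (by linarith)
    have hm2 : max ((1 : ℝ) + 1 + (22 * passTime d τ l.length (14 * d) + 9 * l.length + 26))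
        (1 + 1 + (22 * passTime d τ l.length (273 * d) + 18 + (1 + max ((1 : ℝ) + 1 + 1)
          (1 + 1 + (22 * passTime d τ l.length (33 * d) + 19))))) ≤
        44 * passTime d τ l.length (273 * d) + 9 * l.length + 42 :=
      max_le (by linarith) (by linarith)
    linarith
  refine Tri.seq (Tri.assign (Tri.seq ((nearest_spec (l := l) (x := l[r])
    (s₀ := s.setVar 23 ((Expr.read d (.var 24)).eval s)) hP hB.coords ?_ ?_ ?_
    hne).mono le_rfl ?_)))
  · simpa using hB.clustered.v4
  · exact hB.clustered.holds
  · rw [setVar_var, if_pos rfl, h23]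
  rintro s₁ ⟨hf₁, ℓ, h25, hnear⟩
  have hS₁ : ∀ x, x ≠ 23 → x ≠ 16 → x ≠ 20 → x ≠ 25 → s₁.var x = s.var x := by
    intro x a b c e
    rw [hf₁.var x ((wv_nearest x).not.2 (by omega)), setVar_var, if_neg a]
  have ha₁ : s₁.arr = s.arr := by funext a; rw [hf₁.arr a (wa_nearest a)]; rfl
  have hk₁ : s₁.sk = s.sk := by funext a; rw [hf₁.sk a (wk_nearest a)]; rfl
  have hB₁ : Base σ P s₁ l own := by
    obtain ⟨h1, hc, ⟨β, hβ, hf⟩, hn, hb⟩ := hB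
    have e2 := hS₁ 2 (by omega) (by omega) (by omega) (by omega)
    exact ⟨h1.congr (hS₁ 4 (by omega) (by omega) (by omega) (by omega)) (by rw [ha₁]) (by rw [hk₁]),
      hc.congr fun a _ => by rw [ha₁], ⟨β, (hS₁ 5 (by omega) (by omega) (by omega)
        (by omega)).trans hβ, hf.congr (by rw [ha₁]) (by rw [hk₁])⟩, e2 ▸ hn, e2 ▸ hb⟩
  have hin₁ : Input σ P ε s₁ :=
    ⟨(hS₁ 0 (by omega) (by omega) (by omega) (by omega)).trans hin.v0,
      (hS₁ 1 (by omega) (by omega) (by omega) (by omega)).trans hin.v1, hB₁.coords,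
      fun i => hk₁ ▸ hin.sk0 i, hk₁ ▸ hin.sk3⟩
  have h8₁ : s₁.var 8 = 0 := (hS₁ 8 (by omega) (by omega) (by omega) (by omega)).trans h8
  clear hS₁ ha₁ hk₁ hf₁
  -- the lattice
  obtain ⟨u, hu⟩ : ∃ u, u = ℓ / 16 := ⟨_, rfl⟩
  have hu0 : 0 < u := by have := hnear.pos; rw [hu]; positivity
  have hℓu : ℓ = 16 * u := by rw [hu]; ring
  have hud : 0 < u / d := by positivity
  have hudd : u / d * d = u := by field_simp
  -- From `8 / 17 * E ≤ ℓ = 16 * u`. The factor reproduces itself: a net raises the error to at most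
  -- `68 * u` and has separation above `32 * u = 8 / 17 * (68 * u)`.
  have hE : E ≤ 34 * u := by
    obtain ⟨y, hy, hyx, hdy⟩ := hnear.mem
    have := hC.sep _ (List.getElem_mem hr) y hy hyx.symm
    linarith
  have hE3 := hC.le
  have hev : (Expr.sqrt (.var 25) / 16 : Expr).eval s₁ = u := by
    rw [Expr.eval_hdiv, Expr.eval_sqrt, Expr.eval_var, h25, Real.sqrt_sq hnear.pos.le,
      Expr.eval_ofNat, hu]
  refine Tri.seq (Tri.assign (Tri.seq (Tri.assign (Tri.seq (Tri.assign ?_)))))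
  rw [hev]
  obtain ⟨s₂, hs₂⟩ : ∃ s₂, s₂ = ((s₁.setVar 6 u).setVar 9 (u / d)).setVar 10 (3 * u) := ⟨_, rfl⟩
  have hs₂' : (((s₁.setVar 6 u).setVar 9 ((.var 6 / .const d : Expr).eval (s₁.setVar 6 u))).setVar 10
      ((3 * .var 6 : Expr).eval ((s₁.setVar 6 u).setVar 9
        ((.var 6 / .const d : Expr).eval (s₁.setVar 6 u))))) = s₂ := by
    simp [hs₂]
  rw [hs₂']
  have hB₂ : Base σ P s₂ l own := by
    rw [hs₂]
    exact ((hB₁.setVar (by omega) (by omega) (by omega)).setVar (by omega) (by omega)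
      (by omega)).setVar (by omega) (by omega) (by omega)
  have hin₂ : Input σ P ε s₂ := by
    rw [hs₂]
    exact ((hin₁.setVar (by omega) (by omega)).setVar (by omega) (by omega)).setVar (by omega)
      (by omega)
  have h6₂ : s₂.var 6 = u := by simp [hs₂]
  have h9₂ : s₂.var 9 = u / d := by simp [hs₂]
  have h10₂ : s₂.var 10 = 3 * u := by simp [hs₂]
  have h8₂ : s₂.var 8 = 0 := by simp [hs₂, h8₁]
  clear hs₂' hs₂ hev hB₁ hin₁ h8₁ h25
  have hfl3 := hfloor 3 u hu0
  have hfl14 := hfloor 14 u hu0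
  have hfl33 := hfloor 33 u hu0
  have hfl273 := hfloor 273 u hu0
  push_cast at hfl3 hfl14 hfl33 hfl273
  rw [← hfl3, ← hfl14, ← hfl33, ← hfl273]
  refine pass_bump_spec hemp hF hτ hC.nodup hB₂ hud (by positivity) h9₂ h10₂ ?_
  intro s₃ hB₃ hS₃ hflag
  have h6₃ : s₃.var 6 = u :=
    (hS₃.var 6 (by omega) (by omega) (by omega) (by omega)).trans h6₂
  have h9₃ : s₃.var 9 = u / d :=
    (hS₃.var 9 (by omega) (by omega) (by omega) (by omega)).trans h9₂
  have h8₃ : s₃.var 8 = 0 := (hS₃.var 8 (by omega) (by omega) (by omega) (by omega)).trans h8₂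
  have hin₃ := hin₂.congr hS₃ hB₃.coords
  refine Tri.ite (fun hb => ?_) (fun hb => ?_)
  all_goals rw [Test.holds, Expr.eval_zero, Expr.eval_var, hflag] at hb
  · obtain ⟨g, hg⟩ := hb
    -- `ρ ≤ 3 * u + E` and `3 * E ≤ ρ` give `2 * ρ + 2 * E ≤ 12 * u`, so pruning at `D = 13 * u` is
    -- safe. The radius `14 * u` is `D` plus the rounding error `u`, and `14 * u + u` is still below
    -- `ℓ = 16 * u`.
    have hρu := hC.le_of_hitSet_mem hF hρ (by positivity) hg
    refine Tri.seq (Tri.assign (prune_bump_spec hemp hF hτ hC.nodup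
      (hB₃.setVar (by omega) (by omega) (by omega)) hud (by positivity) (by simpa using h9₃)
      (by simp [h6₃]) fun s₄ hB₄ hS₄ => Or.inr ⟨_, ⟨?_, ?_, own, E, ?_, hB₄⟩, ?_⟩))
    · exact (hin₃.setVar (by omega) (by omega)).congr hS₄ hB₄.coords
    · rw [hS₄.var 8 (by omega) (by omega) (by omega) (by omega)]
      simpa using h8₃
    · refine hC.prune hF hρ h0 List.filter_sublist (D := 13 * u) (by linarith) ?_
      intro w hw w' hw' hne hdist
      exact mem_pruned hud hudd.le (by linarith) (by positivity) hw hw' hne hdist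
    · refine ⟨List.filter_sublist, ℓ, hnear, Or.inl fun y hy hfar => ?_⟩
      exact notMem_pruned hud hudd.le (by linarith) hfar
  -- `3 * u < ρ + E + u` and `3 * E ≤ ρ` give the lower bound `u ≤ ρ`.
  · have hρu := hC.lt_of_hitSet_notMem hF hud (not_exists.1 hb)
    rw [hudd] at hρu
    refine Tri.seq (Tri.assign (pass_bump_spec hemp hF hτ hC.nodup
      (hB₃.setVar (by omega) (by omega) (by omega)) hud (by positivity) (by simpa using h9₃)
      (by simp [h6₃]) fun s₄ hB₄ hS₄ hflag₄ => ?_))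
    have h6₄ : s₄.var 6 = u := by
      rw [hS₄.var 6 (by omega) (by omega) (by omega) (by omega)]; simpa using h6₃
    have h9₄ : s₄.var 9 = u / d := by
      rw [hS₄.var 9 (by omega) (by omega) (by omega) (by omega)]; simpa using h9₃
    have h8₄ : s₄.var 8 = 0 := by
      rw [hS₄.var 8 (by omega) (by omega) (by omega) (by omega)]; simpa using h8₃
    have hin₄ := (hin₃.setVar (x := 10) (by omega) (by omega)).congr hS₄ hB₄.coords
    refine Tri.ite (fun hb' => ?_) (fun hb' => ?_)
    all_goals rw [Test.holds, Expr.eval_zero, Expr.eval_var, hflag₄] at hb'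
    · obtain ⟨g, hg⟩ := hb'
      -- The upper bound is `273 * u + E ≤ 307 * u`.
      have hρu' := hC.le_of_hitSet_mem hF hρ (by positivity) hg
      refine Tri.seq (Tri.assign (Tri.assign (Or.inl ⟨?_, ?_, ?_, ?_, ?_, ?_, ?_⟩)))
      · exact (hin₄.setVar (by omega) (by omega)).setVar (by omega) (by omega)
      · simp
      · obtain ⟨β, hβ, hf⟩ := hB₄.fresh
        exact ⟨β, by simpa using hβ, hf⟩
      all_goals simp only [Expr.eval_hmul, Expr.eval_ofNat, Expr.eval_var, setVar_var, h6₄]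
      all_goals norm_num
      all_goals linarith
    -- `272 * u < ρ + E` and `E ≤ 34 * u` give `238 * u < ρ`, whereas three times the new error is
    -- at most `204 * u`.
    · have hρu' := hC.lt_of_hitSet_notMem hF hud (not_exists.1 hb')
      rw [hudd] at hρu'
      refine Tri.seq (Tri.assign (net_bump_spec hτ hC.nodup
        (hB₄.setVar (by omega) (by omega) (by omega)) hud (by positivity) (by simpa using h9₄)
        (by simp [h6₄]) fun s₅ l' own' hB₅ hS₅ hnet =>
          Or.inr ⟨l', ⟨?_, ?_, own', E + (33 * u + u / d * d), ?_, hB₅⟩, ?_⟩))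
      · exact (hin₄.setVar (by omega) (by omega)).congr hS₅ hB₅.coords
      · rw [hS₅.var 8 (by omega) (by omega) (by omega) (by omega)]
        simpa using h8₄
      · have hsub := hnet.sub
        refine hC.net hsub (fun p => ⟨fun h => ?_, fun h => (hnet.mem p h).1⟩)
          (fun p hp => (hnet.mem p hp).2) (by positivity) (by rw [hudd]; linarith) ?_
        · by_contra hp
          rw [hnet.eq p hp] at h
          exact hp (hsub.subset h)
        · intro w hw w' hw' hne
          have := hnet.sep w hw w' hw' hne
          rw [hudd] at this ⊢
          linarith
      -- Net points are more than `33 * u - u = 2 * ℓ` apart.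
      · refine ⟨hnet.sub, ℓ, hnear, Or.inr fun w hw w' hw' hne => ?_⟩
        have := hnet.sep w hw w' hw' hne
        rw [hudd] at this
        linarith

end MainStep

end RealRAM

namespace RealRAM

/-! ### Expected time of the main loop. -/

section MainLoop

variable {S : Type} {jn : S → S → S} {orc : S → Bool} {τ : ℕ} {d n : ℕ}
  {P : Fin n → EuclideanSpace ℝ (Fin d)} {s s' s'' : State S}
  {ρ ε : ℝ} {F : Set (Finset (Fin n))} {σ : Sketching F S} {l l' : List (Fin n)}
  {Q : State S → Prop}

theorem Bounded.of_step {N : ℕ} {p : Prog} {k : List Prog} {s : State S} {c' : Conf S}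
    {X : ENNReal} (hs : step jn orc (p :: k, s) = PMF.pure c')
    (h : Bounded jn orc τ Q N c' X) :
    Bounded jn orc τ Q N (p :: k, s) (stepCost τ (p :: k, s) + X) := by
  cases N with
  | zero => exact bounded_zero _ _ _ _
  | succ N => exact bounded_step hs h.of_succ

theorem Bounded.of_rand {N : ℕ} {x : ℕ} {e : Expr} {k : List Prog} {s : State S} {m : ℕ}
    {X : ENNReal} {Y : Fin (m + 1) → ENNReal} (he : ⌊e.eval s⌋₊ = m)
    (h : ∀ j : Fin (m + 1), Bounded jn orc τ Q N (k, s.setVar x (j.val : ℝ)) (Y j))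
    (hX : ∑ j, Y j ≤ (m + 1 : ℕ) * X) :
    Bounded jn orc τ Q N (.rand x e :: k, s) (1 + X) := by
  cases N with
  | zero => exact bounded_zero _ _ _ _
  | succ N => exact bounded_rand he (fun j => (h j).of_succ) hX

theorem Tri.bounded {p : Prog} {T : ℝ} {R : State S → Prop} (h : Tri jn orc τ p s T R)
    {N : ℕ} {k : List Prog} {X : ENNReal} (hR : ∀ s', R s' → Bounded jn orc τ Q N (k, s') X) :
    Bounded jn orc τ Q N (p :: k, s) (ENNReal.ofReal T + X) := by
  obtain ⟨t, s', h1, h2, h3⟩ := h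
  refine (h2.bounded N k X (hR s' h3)).mono ?_
  gcongr
  rw [← ENNReal.ofReal_natCast]
  exact ENNReal.ofReal_le_ofReal h1

theorem NearestAt.unique {x : Fin n} {a b : ℝ} (ha : NearestAt P x l a) (hb : NearestAt P x l b) :
    a = b := by
  obtain ⟨y, hy, hyx, rfl⟩ := ha.mem
  obtain ⟨z, hz, hzx, rfl⟩ := hb.mem
  exact le_antisymm (ha.le z hz hzx) (hb.le y hy hyx)

theorem exists_nearestAt (hP : Function.Injective P) (hl : l.Nodup) (h2 : 2 ≤ l.length)
    (x : Fin n) : ∃ ℓ, NearestAt P x l ℓ := by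
  have hne : (l.toFinset.erase x).Nonempty := by
    rw [← Finset.card_pos]
    have := Finset.pred_card_le_card_erase (s := l.toFinset) (a := x)
    rw [List.toFinset_card_of_nodup hl] at this
    omega
  obtain ⟨y, hy, hmin⟩ := Finset.exists_min_image _ (fun y => dist (P x) (P y)) hne
  simp only [Finset.mem_erase, List.mem_toFinset] at hy hmin
  exact ⟨_, dist_pos.2 (hP.ne hy.1.symm), ⟨y, hy.2, hy.1, rfl⟩, fun z hz hzx => hmin z ⟨hzx, hz⟩⟩

/-- Here `v` is the nearest-neighbour distance. Pruning at `x` removes all `y` with `v x ≤ v y`. For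
a net, all `y` with `v y ≤ v x` have a neighbour within `ℓ`, so `card_filter_close_le` applies. -/
theorem Shrinks.card_le {x : Fin n} (h : Shrinks P l x l') (hl : l.Nodup)
    {v : Fin n → ℝ} (hv : ∀ y, NearestAt P y l (v y)) :
    (l.toFinset.filter fun y => v y ≤ v x).card ≤ 2 * (l.length - l'.length) ∨
      (l.toFinset.filter fun y => v x ≤ v y).card ≤ 2 * (l.length - l'.length) := by
  obtain ⟨hsub, ℓ, hℓ, h⟩ := h
  obtain rfl := hℓ.unique (hv x)
  have hsub' : l'.toFinset ⊆ l.toFinset := fun y hy => by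
    rw [List.mem_toFinset] at hy ⊢
    exact hsub.subset hy
  have hc := List.toFinset_card_of_nodup hl
  have hc' := List.toFinset_card_of_nodup (hsub.nodup hl)
  rcases h with h | h
  · right
    calc _ ≤ (l.toFinset \ l'.toFinset).card := Finset.card_le_card fun y hy => by
          rw [Finset.mem_filter, List.mem_toFinset] at hy
          rw [Finset.mem_sdiff, List.mem_toFinset, List.mem_toFinset]
          exact ⟨hy.1, h y hy.1 fun z hz hzy => hy.2.trans ((hv y).le z hz hzy)⟩
      _ = l.length - l'.length := by rw [Finset.card_sdiff_of_subset hsub', hc, hc']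
      _ ≤ _ := by omega
  · left
    rw [← hc, ← hc']
    refine card_filter_close_le l.toFinset P hsub' hℓ.pos.le ?_ _ (Finset.filter_subset _ _) ?_
    · intro w hw w' hw'
      rw [List.mem_toFinset] at hw hw'
      exact h w hw w' hw'
    · intro y hy
      rw [Finset.mem_filter] at hy
      obtain ⟨z, hz, hzy, hyz⟩ := (hv y).mem
      exact ⟨z, List.mem_toFinset.2 hz, hzy, hyz.trans_le hy.2⟩

/-- A list with at least two elements loses a twelfth of its elements on average. -/
theorem sq_length_le_sum_lost (hP : Function.Injective P) (hl : l.Nodup) (h2 : 2 ≤ l.length)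
    {m : Fin l.length → ℕ}
    (hm : ∀ r, m r = 0 ∨ ∃ l', m r = l'.length ∧ Shrinks P l l[r] l') :
    l.length ^ 2 ≤ 12 * ∑ r, (l.length - m r) := by
  choose v hv using exists_nearestAt hP hl h2
  -- The draw is over positions, the counting lemma over elements; `e` translates between them.
  let e : Fin l.length ≃ {x // x ∈ l.toFinset} :=
    (List.Nodup.getEquiv l hl).trans (Equiv.subtypeEquivRight fun x => by simp)
  have h := sq_le_twelve_mul_sum (W := l.toFinset) v
    (fun x => if hx : x ∈ l.toFinset then l.length - m (e.symm ⟨x, hx⟩) else 0) ?_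
  · rw [List.toFinset_card_of_nodup hl] at h
    refine h.trans (le_of_eq ?_)
    rw [← Finset.sum_coe_sort, ← e.sum_comp]
    congr 1
    refine Finset.sum_congr rfl fun r _ => ?_
    rw [dif_pos (e r).2]
    simp
  · intro x hx
    rw [dif_pos hx]
    obtain ⟨r, hr⟩ := e.surjective ⟨x, hx⟩
    have hx' : x = l[r] := (congrArg Subtype.val hr).symm
    rw [← hr, Equiv.symm_apply_apply]
    rcases hm r with h | ⟨l', h, hs⟩
    · left
      rw [h]
      refine (Finset.card_filter_le _ _).trans ?_
      rw [List.toFinset_card_of_nodup hl]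
      omega
    · rw [h, hx']
      exact hs.card_le hl hv

/-- The expected time of the main loop, per point. -/
def mainTime (d τ : ℕ) : ℕ := 12 * (300 * (τ * (2 * (273 * d + 2) + 1) ^ d) + 2)

/-- The potential is `mainTime d τ * l.length`. A loss of a twelfth of the list on average releases
twice the list's length beyond the cost of `mainStep`; as the list has at least two elements, this
pays for the three control steps of a round. `G` bounds the rest of the program, and the 1 before it
is the failing last test. -/
theorem mainLoop_bounded (hd : 1 ≤ d) (hn : 1 ≤ n) (hP : Function.Injective P) (hemp : ∅ ∉ F)
    (hF : IsUpperSet F) (hτ : 1 ≤ τ) (hρ : IsLeast (ballRadii P F) ρ) (h0 : 0 < ρ)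
    {k : List Prog} {G : ENNReal}
    (hk : ∀ s, MainDone σ P ε ρ s → ∀ N, Bounded σ.join σ.oracle τ Q N (k, s) G) (N : ℕ) :
    ∀ s l, MainInv σ P ε ρ s l → Bounded σ.join σ.oracle τ Q N (mainLoop d :: k, s)
      (ENNReal.ofReal (mainTime d τ * l.length) + (1 + G)) := by
  induction N with
  | zero => exact fun s l _ => bounded_zero _ _ _ _
  | succ N ih =>
    intro s l hI
    obtain ⟨own, E, hC, hB⟩ := hI.cl
    have h2 := hC.two_le_length hF hρ h0 hn
    obtain ⟨m₀, hm₀⟩ : ∃ m₀, l.length = m₀ + 1 := ⟨l.length - 1, by omega⟩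
    have key : ∀ j : Fin (m₀ + 1), ∃ m' : ℕ,
        (m' = 0 ∨ ∃ l', m' = l'.length ∧ Shrinks P l (l[j.val]'(by omega)) l') ∧
        Bounded σ.join σ.oracle τ Q N (mainStep d :: mainLoop d :: k, s.setVar 24 (j.val : ℝ))
          (ENNReal.ofReal (300 * passTime d τ l.length (273 * d) + mainTime d τ * m') +
            (1 + G)) := by
      intro j
      have hI' : MainInv σ P ε ρ (s.setVar 24 (j.val : ℝ)) l :=
        ⟨hI.input.setVar (by omega) (by omega), by simpa using hI.v8, own, E, hC,
          hB.setVar (by omega) (by omega) (by omega)⟩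
      obtain ⟨t, s', ht, hrun, h⟩ := mainStep_spec hd hn hP hemp hF hτ hρ h0 hI'
        (by omega) (r := j.val) (by simp)
      have htri : Tri σ.join σ.oracle τ (mainStep d) (s.setVar 24 (j.val : ℝ))
        (300 * passTime d τ l.length (273 * d)) (· = s') := ⟨t, s', ht, hrun, rfl⟩
      rcases h with h | ⟨l', hI'', hs⟩
      -- A finished loop counts as a list of length zero.
      · refine ⟨0, Or.inl rfl, (htri.bounded (X := 1 + G) ?_).mono (by simp)⟩
        intro s'' hs''
        have hv8 : s''.var 8 = 1 := hs'' ▸ h.v8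
        have := Bounded.of_step (p := mainLoop d) (k := k) (s := s'') (c' := (k, s''))
          (by simp [step, mainLoop, hv8]) (hk s'' (hs'' ▸ h) N)
        simpa [stepCost, mainLoop] using this
      · refine ⟨l'.length, Or.inr ⟨l', rfl, hs⟩, (htri.bounded
          (X := ENNReal.ofReal (mainTime d τ * l'.length) + (1 + G)) ?_).mono (le_of_eq ?_)⟩
        · intro s'' hs''
          exact ih s'' l' (hs'' ▸ hI'')
        · rw [← add_assoc, ← ENNReal.ofReal_add (by positivity) (by positivity)]
    choose m hm hb using key
    have hsum : ((m₀ : ℝ) + 1) ^ 2 ≤ 12 * ∑ j, ((m₀ : ℝ) + 1 - m j) := by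
      have h := sq_length_le_sum_lost hP hC.nodup h2 (m := fun r => m (Fin.cast hm₀ r))
        fun r => hm (Fin.cast hm₀ r)
      have hle : ∀ j, m j ≤ m₀ + 1 := fun j => by
        rcases hm j with h | ⟨l', h, hs⟩
        · omega
        · have := hs.1.length_le
          omega
      have hc : ∑ r, (l.length - m (Fin.cast hm₀ r)) = ∑ j, (m₀ + 1 - m j) :=
        ((finCongr hm₀).sum_comp fun j => l.length - m j).trans (by rw [hm₀])
      rw [hc, hm₀] at h
      have h' : (((m₀ + 1) ^ 2 : ℕ) : ℝ) ≤ (12 * ∑ j, (m₀ + 1 - m j) : ℕ) := Nat.cast_le.2 h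
      push_cast [Nat.cast_sub (hle _)] at h'
      exact h'
    have he : ⌊(Expr.var 4 - 1).eval s⌋₊ = m₀ := by
      rw [Expr.eval_hsub, Expr.eval_var, hB.clustered.v4, Expr.eval_one, hm₀]
      simp
    -- The three units set aside pay for the loop test, the sequencing and the draw.
    have hX : ∑ j, (ENNReal.ofReal (300 * passTime d τ l.length (273 * d) + mainTime d τ * m j) +
        (1 + G)) ≤ (m₀ + 1 : ℕ) * (ENNReal.ofReal (mainTime d τ * l.length - 3) + (1 + G)) := by
      rw [Finset.sum_add_distrib, mul_add, ← ENNReal.ofReal_sum_of_nonneg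
        (fun j _ => by positivity)]
      refine add_le_add ?_ (by simp [mul_add])
      rw [← ENNReal.ofReal_natCast, ← ENNReal.ofReal_mul (by positivity)]
      refine ENNReal.ofReal_le_ofReal ?_
      rw [Finset.sum_add_distrib]
      rw [Finset.sum_sub_distrib] at hsum
      simp only [Finset.sum_const, Finset.card_univ, Fintype.card_fin, nsmul_eq_mul] at hsum ⊢
      rw [hm₀]
      simp only [passTime, mainTime]
      push_cast at hsum ⊢
      have hm1 : (1 : ℝ) ≤ m₀ := by exact_mod_cast (by omega : 1 ≤ m₀)
      obtain ⟨A, hA, hA0⟩ : ∃ A : ℝ, A = τ * (2 * (273 * d + 2) + 1) ^ d ∧ 0 ≤ A :=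
        ⟨_, rfl, by positivity⟩
      rw [← hA, ← Finset.mul_sum]
      nlinarith [mul_le_mul_of_nonneg_left hsum (by linarith : 0 ≤ 300 * A + 2)]
    have hstep : Bounded σ.join σ.oracle τ Q N
        (.seq (.rand 24 (.var 4 - 1)) (mainStep d) :: mainLoop d :: k, s) _ :=
      Bounded.of_step rfl (Bounded.of_rand he hb hX)
    refine (bounded_step (c' := (_, s)) ?_ hstep).mono ?_
    · simp [step, mainLoop, hI.v8]
    · have h3 : (3 : ℝ) ≤ mainTime d τ * l.length := by
        have : 3 ≤ mainTime d τ * l.length := by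
          calc 3 ≤ 24 * 2 := by norm_num
            _ ≤ _ := Nat.mul_le_mul (by unfold mainTime; omega) h2
        exact_mod_cast this
      have h4 : ENNReal.ofReal (mainTime d τ * l.length) =
          3 + ENNReal.ofReal (mainTime d τ * l.length - 3) := by
        rw [← ENNReal.ofReal_ofNat, ← ENNReal.ofReal_add (by norm_num) (by linarith)]
        congr 1
        ring
      rw [h4]
      simp only [stepCost, mainLoop]
      refine le_of_eq ?_
      push_cast
      ring

end MainLoop

end RealRAM

namespace RealRAM

/-! ### From a constant-factor approximation to accuracy `ε`. -/

section Refine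

variable {S : Type} {jn : S → S → S} {orc : S → Bool} {τ : ℕ} {d n : ℕ}
  {P : Fin n → EuclideanSpace ℝ (Fin d)} {s s' : State S}
  {ρ ε lo : ℝ} {F : Set (Finset (Fin n))} {σ : Sketching F S} {Q : State S → Prop}

theorem clustering_id (hρ : IsLeast (ballRadii P F) ρ) :
    Clustering P F ρ (List.finRange n) id 0 := by
  obtain ⟨h0, c, hc⟩ := hρ.1
  exact ⟨List.nodup_finRange n, le_rfl, by simpa using h0, by simp, by simp, c, hc, by simp⟩

/-- The invariant of the search for the radius; `lo` is the initial lower bound. -/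
structure RefineInv (σ : Sketching F S) (P : Fin n → EuclideanSpace ℝ (Fin d)) (ε ρ lo : ℝ)
    (s : State S) : Prop where
  v1 : s.var 1 = ε
  base : Base σ P s (List.finRange n) id
  lo_le : lo ≤ s.var 6
  le : s.var 6 ≤ ρ
  ge : ρ ≤ s.var 7
  le_hi : s.var 7 ≤ 307 * lo
  gap : ε * lo / 2 ≤ s.var 7 - s.var 6

/-- The number of lattice steps is at most `1228 * d * lo / h`, and 5 is at most `1535 * d * lo / h`
because `h ≤ 307 * lo`. Twice the first plus the second is `3991 * d * lo / h`, rounded up to 4000.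
-/
theorem passTime_le (hd : 1 ≤ d) {a h : ℝ} (ha : 0 ≤ a) (hlo : 0 < lo) (hah : a + h ≤ 307 * lo)
    (hh : 0 < h) :
    (passTime d τ n ⌊((a + (a + h)) / 2) / (h / (4 * d))⌋₊ : ℝ) ≤
      τ * n * (4000 * d * lo / h) ^ d := by
  have hd' : (1 : ℝ) ≤ d := by exact_mod_cast hd
  have h1 : (⌊((a + (a + h)) / 2) / (h / (4 * d))⌋₊ : ℝ) ≤
      ((a + (a + h)) / 2) / (h / (4 * d)) := Nat.floor_le (by positivity)
  have h2 : ((a + (a + h)) / 2) / (h / (4 * d)) = 2 * d * (a + (a + h)) / h := by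
    field_simp
    ring
  have h3 : 2 * d * (a + (a + h)) / h ≤ 1228 * d * lo / h :=
    div_le_div_of_nonneg_right (by nlinarith) hh.le
  have h4 : (5 : ℝ) ≤ 1535 * d * lo / h := by
    rw [le_div_iff₀ hh]
    nlinarith
  have h5 : 2 * (1228 * d * lo / h) + 1535 * d * lo / h ≤ 4000 * d * lo / h := by
    rw [← mul_div_assoc, ← add_div]
    exact div_le_div_of_nonneg_right (by nlinarith) hh.le
  unfold passTime
  push_cast
  rw [mul_right_comm]
  gcongr
  linarith

/-- A step keeps at least half of a gap exceeding `ε * lo`. This maintains the lower bound `ε * lo /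
2` on the gap, which limits how fine the lattice can become. -/
theorem refineStep_spec (hd : 1 ≤ d) (hn : 1 ≤ n) (hemp : ∅ ∉ F) (hF : IsUpperSet F)
    (hτ : 1 ≤ τ) (hρ : IsLeast (ballRadii P F) ρ) (hε : 0 < ε) (hlo : 0 < lo)
    (hI : RefineInv σ P ε ρ lo s) (hgap : ε * lo < s.var 7 - s.var 6) :
    Tri σ.join σ.oracle τ (refineStep d) s
      (49 * (τ * n * (4000 * d * lo / (s.var 7 - s.var 6)) ^ d)) fun s' =>
      RefineInv σ P ε ρ lo s' ∧ s'.var 7 - s'.var 6 ≤ 3 / 4 * (s.var 7 - s.var 6) := by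
  have hC := clustering_id hρ
  obtain ⟨a, ha⟩ : ∃ a, s.var 6 = a := ⟨_, rfl⟩
  obtain ⟨h, hh⟩ : ∃ h, s.var 7 - s.var 6 = h := ⟨_, rfl⟩
  have h7 : s.var 7 = a + h := by linarith
  have hle := hI.le
  have hge := hI.ge
  have hlo_le := hI.lo_le
  have hle_hi := hI.le_hi
  rw [ha] at hle hlo_le
  rw [h7] at hge hle_hi
  rw [hh] at hgap ⊢
  have hh0 : 0 < h := lt_trans (by positivity) hgap
  have hd' : (0 : ℝ) < d := by exact_mod_cast hd
  have hpt := passTime_le (τ := τ) (n := n) hd (hlo.le.trans hlo_le) hlo hle_hi hh0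
  have hone : (1 : ℝ) ≤ τ * n * (4000 * d * lo / h) ^ d := by
    have h1 : (1 : ℝ) ≤ τ * n := by exact_mod_cast Nat.mul_pos hτ hn
    have h2 : 1 ≤ 4000 * d * lo / h := by
      rw [le_div_iff₀ hh0]
      have : (1 : ℝ) ≤ d := by exact_mod_cast hd
      nlinarith
    exact one_le_mul_of_one_le_of_one_le h1 (one_le_pow₀ h2)
  refine Tri.mono (T := 1 + 1 + (1 + 1 + (22 * passTime d τ (List.finRange n).length
    ⌊((a + (a + h)) / 2) / (h / (4 * d))⌋₊ + 18 + (1 + max (1 : ℝ) 1)))) ?_ ?_ fun _ h => h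
  swap
  · rw [List.length_finRange, max_self]
    linarith
  refine Tri.seq (Tri.assign (Tri.seq (Tri.assign ?_)))
  obtain ⟨s₁, hs₁⟩ : ∃ s₁, s₁ = (s.setVar 9 (h / (4 * d))).setVar 10 ((a + (a + h)) / 2) := ⟨_, rfl⟩
  have hs₁' : ((s.setVar 9 (((Expr.var 7 - .var 6) / (4 * .const d)).eval s)).setVar 10
      (((Expr.var 6 + .var 7) / 2 : Expr).eval
        (s.setVar 9 (((Expr.var 7 - .var 6) / (4 * .const d)).eval s)))) = s₁ := by
    simp [hs₁, ha, h7]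
  rw [hs₁']
  have hB₁ : Base σ P s₁ (List.finRange n) id := by
    rw [hs₁]
    exact (hI.base.setVar (by omega) (by omega) (by omega)).setVar (by omega) (by omega) (by omega)
  have hud : h / (4 * d) * d = h / 4 := by field_simp
  have hV₁ : ∀ x, x ≠ 9 → x ≠ 10 → s₁.var x = s.var x := fun x h1 h2 => by simp [hs₁, h1, h2]
  refine pass_bump_spec hemp hF hτ hC.nodup hB₁ (by positivity) (by linarith) (by simp [hs₁])
    (by simp [hs₁]) ?_
  intro s₂ hB₂ hS₂ hflag
  have hV₂ : ∀ x, x ≠ 4 → x ≠ 5 → ¬ (11 ≤ x ∧ x ≤ 22) → x ≠ 25 → x ≠ 9 → x ≠ 10 →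
      s₂.var x = s.var x := fun x h1 h2 h3 h4 h5 h6 => (hS₂.var x h1 h2 h3 h4).trans (hV₁ x h5 h6)
  have h6₂ : s₂.var 6 = a :=
    (hV₂ 6 (by omega) (by omega) (by omega) (by omega) (by omega) (by omega)).trans ha
  have h7₂ : s₂.var 7 = a + h :=
    (hV₂ 7 (by omega) (by omega) (by omega) (by omega) (by omega) (by omega)).trans h7
  have h1₂ : s₂.var 1 = ε :=
    (hV₂ 1 (by omega) (by omega) (by omega) (by omega) (by omega) (by omega)).trans hI.v1
  have h10₂ : s₂.var 10 = (a + (a + h)) / 2 := by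
    rw [hS₂.var 10 (by omega) (by omega) (by omega) (by omega)]
    simp [hs₁]
  refine Tri.ite (fun hb => Tri.assign ?_) (fun hb => Tri.assign ?_)
  all_goals rw [Test.holds, Expr.eval_zero, Expr.eval_var, hflag] at hb
  · obtain ⟨g, hg⟩ := hb
    have := hC.le_of_hitSet_mem hF hρ (by linarith) hg
    refine ⟨⟨?_, hB₂.setVar (by omega) (by omega) (by omega), ?_, ?_, ?_, ?_, ?_⟩, ?_⟩
    all_goals
      simp only [setVar_var, Expr.eval_var, h6₂, h7₂, h1₂, h10₂]
      norm_num
    all_goals linarith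
  · have := hC.lt_of_hitSet_notMem hF (by positivity) (not_exists.1 hb)
    rw [hud] at this
    refine ⟨⟨?_, hB₂.setVar (by omega) (by omega) (by omega), ?_, ?_, ?_, ?_, ?_⟩, ?_⟩
    all_goals
      simp only [setVar_var, Expr.eval_hsub, Expr.eval_hdiv, Expr.eval_ofNat, Expr.eval_var, h6₂,
        h7₂, h1₂, h10₂]
      norm_num
    all_goals linarith

theorem refine_spec (hd : 1 ≤ d) (hn : 1 ≤ n) (hemp : ∅ ∉ F) (hF : IsUpperSet F)
    (hτ : 1 ≤ τ) (hρ : IsLeast (ballRadii P F) ρ) (hε : 0 < ε) (hlo : 0 < lo)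
    (hI : RefineInv σ P ε ρ lo s) :
    Tri σ.join σ.oracle τ (refine d) s (1 + 200 * (τ * n * (8000 * d / ε) ^ d)) fun s' =>
      ρ ≤ s'.var 7 ∧ s'.var 7 ≤ (1 + ε) * ρ := by
  have hd' : (1 : ℝ) ≤ d := by exact_mod_cast hd
  have hexit : ∀ {s : State S}, RefineInv σ P ε ρ lo s →
      ¬ (Test.lt ((1 + .var 1) * .var 6) (.var 7)).holds s → ∀ T : ℝ, 1 ≤ T →
      Tri σ.join σ.oracle τ (refine d) s T fun s' =>
        ρ ≤ s'.var 7 ∧ s'.var 7 ≤ (1 + ε) * ρ := by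
    intro s hI hb T hT
    refine (Tri.while_neg hb ?_).mono hT fun _ h => h
    simp only [Test.holds, Expr.eval_hmul, Expr.eval_hadd, Expr.eval_one, Expr.eval_var,
      hI.v1, not_lt] at hb
    exact ⟨hI.ge, hb.trans (mul_le_mul_of_nonneg_left hI.le (by positivity))⟩
  have hM : ∀ {s : State S}, RefineInv σ P ε ρ lo s → 0 < s.var 7 - s.var 6 ∧
      (4000 * d * lo / (s.var 7 - s.var 6)) ^ d ≤ (8000 * d / ε) ^ d := by
    intro s hI
    have hpos : 0 < s.var 7 - s.var 6 := lt_of_lt_of_le (by positivity) hI.gap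
    refine ⟨hpos, pow_le_pow_left₀ (by positivity) ?_ d⟩
    calc 4000 * d * lo / (s.var 7 - s.var 6) ≤ 4000 * d * lo / (ε * lo / 2) := by
          gcongr
          exact hI.gap
      _ = 8000 * d / ε := by field_simp; norm_num
  -- The time bound is a potential. Shrinking the gap to at most 3/4 multiplies the subtracted power
  -- by at least `(4 / 3) ^ d ≥ 4 / 3`. This releases 200/3 times `τ * n` times that power, more
  -- than the factor 49 of the step plus the overhead. `N` bounds the number of remaining rounds.
  have key : ∀ N : ℕ, ∀ s : State S, RefineInv σ P ε ρ lo s →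
      (3 / 4) ^ N * (s.var 7 - s.var 6) ≤ ε * lo →
      Tri σ.join σ.oracle τ (refine d) s (1 + 200 * (τ * n * ((8000 * d / ε) ^ d -
        (4000 * d * lo / (s.var 7 - s.var 6)) ^ d))) fun s' =>
        ρ ≤ s'.var 7 ∧ s'.var 7 ≤ (1 + ε) * ρ := by
    intro N
    induction N with
    | zero =>
      intro s hI hN
      refine hexit hI ?_ _ ?_
      · simp only [Test.holds, Expr.eval_hmul, Expr.eval_hadd, Expr.eval_one, Expr.eval_var,
          hI.v1, not_lt]
        rw [pow_zero, one_mul] at hN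
        linarith [mul_le_mul_of_nonneg_left hI.lo_le hε.le]
      · have := sub_nonneg.2 (hM hI).2
        have : 0 ≤ 200 * (τ * n * ((8000 * d / ε) ^ d -
          (4000 * d * lo / (s.var 7 - s.var 6)) ^ d)) := by positivity
        linarith
    | succ N ih =>
      intro s hI hN
      by_cases hb : (Test.lt ((1 + .var 1) * .var 6) (.var 7)).holds s
      · have hgap : ε * lo < s.var 7 - s.var 6 := by
          have hb' := hb
          simp only [Test.holds, Expr.eval_hmul, Expr.eval_hadd, Expr.eval_one, Expr.eval_var,
            hI.v1] at hb'
          linarith [mul_le_mul_of_nonneg_left hI.lo_le hε.le]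
        obtain ⟨h, hh⟩ : ∃ h, h = s.var 7 - s.var 6 := ⟨_, rfl⟩
        have h0 : 0 < h := hh ▸ (hM hI).1
        have hτn : (0 : ℝ) ≤ τ * n := by positivity
        have hone : (1 : ℝ) ≤ τ * n * (4000 * d * lo / h) ^ d := by
          have h1 : (1 : ℝ) ≤ τ * n := by exact_mod_cast Nat.mul_pos hτ hn
          have h2 : 1 ≤ 4000 * d * lo / h := by
            rw [le_div_iff₀ h0]
            nlinarith [hI.le_hi, hI.lo_le]
          exact one_le_mul_of_one_le_of_one_le h1 (one_le_pow₀ h2)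
        refine (Tri.while_pos hb ((refineStep_spec hd hn hemp hF hτ hρ hε hlo hI hgap).mono
          (T := 49 * (τ * n * (4000 * d * lo / (s.var 7 - s.var 6)) ^ d)) le_rfl
          (Q' := fun s' => Tri σ.join σ.oracle τ (refine d) s' (1 + 200 * (τ * n *
            ((8000 * d / ε) ^ d - 4 / 3 * (4000 * d * lo / (s.var 7 - s.var 6)) ^ d)))
            fun s' => ρ ≤ s'.var 7 ∧ s'.var 7 ≤ (1 + ε) * ρ) ?_)).mono ?_ fun _ h => h
        · rintro s' ⟨hI', hs'⟩
          have hpos := (hM hI').1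
          refine (ih s' hI' ?_).mono ?_ fun _ h => h
          · refine le_trans ?_ hN
            rw [pow_succ, mul_assoc]
            gcongr
          · gcongr
            rw [← hh] at hs' ⊢
            calc 4 / 3 * (4000 * d * lo / h) ^ d ≤ (4 / 3) ^ d * (4000 * d * lo / h) ^ d := by
                  gcongr
                  exact le_self_pow₀ (by norm_num) (by omega)
              _ = (4000 * d * lo / (3 / 4 * h)) ^ d := by
                  rw [← mul_pow]
                  congr 1
                  field_simp
              _ ≤ _ := by gcongr
        · rw [← hh]
          linarith
      · refine hexit hI hb _ ?_
        have := sub_nonneg.2 (hM hI).2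
        have : 0 ≤ 200 * (τ * n * ((8000 * d / ε) ^ d -
          (4000 * d * lo / (s.var 7 - s.var 6)) ^ d)) := by positivity
        linarith
  have hpos := (hM hI).1
  obtain ⟨N, hN⟩ := exists_pow_lt_of_lt_one (x := ε * lo / (s.var 7 - s.var 6)) (y := (3 / 4 : ℝ))
    (by positivity) (by norm_num)
  rw [lt_div_iff₀ hpos] at hN
  refine (key N s hI hN.le).mono ?_ fun _ h => h
  gcongr
  have hlo_div : 0 ≤ 4000 * d * lo / (s.var 7 - s.var 6) := by positivity
  linarith [pow_nonneg hlo_div d]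

end Refine

end RealRAM

namespace RealRAM

/-! ### The whole program. -/

section SmallestBall

variable {S : Type} {jn : S → S → S} {orc : S → Bool} {τ : ℕ} {d n : ℕ}
  {P : Fin n → EuclideanSpace ℝ (Fin d)} {s s' : State S}
  {ρ ε : ℝ} {F : Set (Finset (Fin n))} {σ : Sketching F S} {Q : State S → Prop}

theorem bounded_nil (h : Q s) (N : ℕ) : Bounded jn orc τ Q N ([], s) 0 := by
  induction N with
  | zero => exact ⟨le_rfl, fun _ => h⟩
  | succ N ih =>
    refine ⟨?_, fun _ => h, fun c hc => ?_⟩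
    · rw [expectedTimeOfSteps, step, tsum_pure_mul, stepCost, Nat.cast_zero, zero_add]
      exact ih.1
    · rw [step, PMF.support_pure, Set.mem_singleton_iff] at hc
      exact hc ▸ ih.2

theorem Bounded.of_seq {N : ℕ} {p q : Prog} {k : List Prog} {X : ENNReal}
    (h : Bounded jn orc τ Q N (p :: q :: k, s) X) :
    Bounded jn orc τ Q N (.seq p q :: k, s) (1 + X) := by
  simpa [stepCost] using Bounded.of_step (p := .seq p q) (k := k) (s := s) rfl h

theorem Bounded.of_ite {N : ℕ} {b : Test} {p q : Prog} {k : List Prog} {X : ENNReal}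
    (hp : b.holds s → Bounded jn orc τ Q N (p :: k, s) X)
    (hq : ¬ b.holds s → Bounded jn orc τ Q N (q :: k, s) X) :
    Bounded jn orc τ Q N (.ite b p q :: k, s) (1 + X) := by
  by_cases hb : b.holds s
  · simpa only [stepCost, Nat.cast_one] using Bounded.of_step (p := .ite b p q) (k := k) (s := s)
      (by simp only [step, hb, if_true]) (hp hb)
  · simpa only [stepCost, Nat.cast_one] using Bounded.of_step (p := .ite b p q) (k := k) (s := s)
      (by simp only [step, hb, if_false]) (hq hb)

/-- Serves both at the start and after the main loop: only the input and a block of unused addresses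
are required, and these survive. -/
theorem init_base (hτ : 1 ≤ τ) (hn : 1 ≤ n) (hI : Input σ P ε s)
    (hf : ∃ β : ℤ, s.var 5 = β ∧ Fresh σ d s β) :
    Tri σ.join σ.oracle τ (init d) s (30 * τ * n) fun s' =>
      Input σ P ε s' ∧ Base σ P s' (List.finRange n) id ∧
      (0 < s'.var 3 ↔ ∅ ∈ F ∨ ∃ i, {i} ∈ F) ∧ ∀ x, 6 ≤ x → x ≤ 8 → s'.var x = s.var x := by
  refine (init_spec hτ hn hI.v0 hI.coords hI.sk0 hI.sk3).mono le_rfl ?_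
  rintro s' ⟨hfr, hcl, hb, h3⟩
  have hc : Coords P s' :=
    hI.coords.congr fun a ha => hfr.arr a ((wa_init a).not.2 (by omega))
  obtain ⟨β, hβ, hf⟩ := hf
  refine ⟨⟨?_, ?_, hc, ?_, ?_⟩, ⟨hcl, hc, ⟨β, ?_, hf.congr ?_ ?_⟩, hb.1, hb.2⟩, h3, ?_⟩
  · exact (hfr.var 0 ((wv_init 0).not.2 (by omega))).trans hI.v0
  · exact (hfr.var 1 ((wv_init 1).not.2 (by omega))).trans hI.v1
  · rw [hfr.sk 0 ((wk_init 0).not.2 (by omega))]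
    exact hI.sk0
  · rw [hfr.sk 3 ((wk_init 3).not.2 (by omega))]
    exact hI.sk3
  · exact (hfr.var 5 ((wv_init 5).not.2 (by omega))).trans hβ
  · exact hfr.arr _ ((wa_init _).not.2 (by omega))
  · exact hfr.sk 2 ((wk_init 2).not.2 (by omega))
  · intro x h1 h2
    exact hfr.var x ((wv_init x).not.2 (by omega))

theorem input_inputState : Input σ P ε (inputState P ε σ.sketch) := by
  refine ⟨by simp [inputState], by simp [inputState], fun i k => ?_, fun i => ?_, ?_⟩
  · simp [inputState]
  · simp [inputState]
  · simp [inputState]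

theorem fresh_inputState : Fresh σ d (inputState P ε σ.sketch) 0 := by
  intro x _
  simp [inputState]

/-- The whole program is correct, and its expected time is bounded. -/
theorem smallestBall_bounded (hd : 1 ≤ d) (hn : 1 ≤ n) (hP : Function.Injective P)
    (hF : IsUpperSet F) (hτ : 1 ≤ τ) (hρ : IsLeast (ballRadii P F) ρ) (hε : 0 < ε)
    (hε1 : ε < 1) (N : ℕ) :
    Bounded σ.join σ.oracle τ (fun s => ρ ≤ s.var 0 ∧ s.var 0 ≤ (1 + ε) * ρ) N
      ([smallestBall d], inputState P ε σ.sketch)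
      (ENNReal.ofReal
        (60 * τ * n + mainTime d τ * n + 200 * (τ * n * (8000 * d / ε) ^ d) + 9)) := by
  have hlast : ∀ s : State S, ρ ≤ s.var 7 → s.var 7 ≤ (1 + ε) * ρ → ∀ N,
      Bounded σ.join σ.oracle τ (fun s => ρ ≤ s.var 0 ∧ s.var 0 ≤ (1 + ε) * ρ) N
        ([.assign 0 (.var 7)], s) (ENNReal.ofReal 1 + 0) := fun s h1 h2 N => by
    refine (Tri.assign (Q := fun s => ρ ≤ s.var 0 ∧ s.var 0 ≤ (1 + ε) * ρ) ?_).bounded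
      fun s' hs' => bounded_nil hs' N
    simpa using And.intro h1 h2
  have hrefine : ∅ ∉ F → ∀ s : State S, MainDone σ P ε ρ s → ∀ N,
      Bounded σ.join σ.oracle τ (fun s => ρ ≤ s.var 0 ∧ s.var 0 ≤ (1 + ε) * ρ) N
        ([.seq (init d) (.seq (refine d) (.assign 0 (.var 7)))], s)
        (1 + (ENNReal.ofReal (30 * τ * n) + (1 + (ENNReal.ofReal
          (1 + 200 * (τ * n * (8000 * d / ε) ^ d)) + (ENNReal.ofReal 1 + 0))))) := by
    intro hemp s hs N
    refine Bounded.of_seq ((init_base hτ hn hs.input hs.fresh).bounded ?_)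
    rintro s' ⟨hin, hB, -, hv⟩
    refine Bounded.of_seq
      ((refine_spec (lo := s.var 6) hd hn hemp hF hτ hρ hε hs.pos ?_).bounded ?_)
    · have h6 := hv 6 (by omega) (by omega)
      have h7 := (hv 7 (by omega) (by omega)).trans hs.eq
      have hpos := hs.pos
      have := hs.le
      have := hs.ge
      exact ⟨hin.v1, hB, h6.ge, h6.trans_le hs.le, by linarith [hs.eq], h7.le,
        by rw [h6, h7]; nlinarith⟩
    · rintro s'' ⟨h1, h2⟩
      exact hlast s'' h1 h2 N
  have hc := fresh_inputState (P := P) (ε := ε) (σ := σ)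
  have hin := input_inputState (P := P) (ε := ε) (σ := σ)
  refine (Bounded.of_seq ((init_base hτ hn hin
    ⟨0, by simp [inputState], hc⟩).bounded (X := 1 + (1 + ((ENNReal.ofReal (mainTime d τ * n)) +
      (1 + (1 + (ENNReal.ofReal (30 * τ * n) + (1 + (ENNReal.ofReal
          (1 + 200 * (τ * n * (8000 * d / ε) ^ d)) + (ENNReal.ofReal 1 + 0))))))))) ?_)).mono ?_
  · rintro s ⟨hin, hB, h3, hv⟩
    rw [← isLeast_eq_zero_iff P hP hF hρ] at h3
    refine Bounded.of_ite (fun hb => ?_) (fun hb => ?_)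
    all_goals rw [Test.holds, Expr.eval_zero, Expr.eval_var, h3] at hb
    · subst hb
      refine ((Tri.assign (Q := fun s => 0 ≤ s.var 0 ∧ s.var 0 ≤ (1 + ε) * 0) ?_).bounded
        fun s' hs' => bounded_nil hs' N).mono ?_
      · simp
      · rw [ENNReal.ofReal_one, add_zero]
        exact le_self_add
    · have h0 : 0 < ρ := lt_of_le_of_ne hρ.1.1 (Ne.symm hb)
      have hemp : ∅ ∉ F := fun h => hb ((isLeast_eq_zero_iff P hP hF hρ).2 (Or.inl h))
      refine Bounded.of_seq ((mainLoop_bounded hd hn hP hemp hF hτ hρ h0 (hrefine hemp) N s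
        (List.finRange n) ⟨hin, ?_, id, 0, clustering_id hρ, hB⟩).mono ?_)
      · rw [hv 8 (by omega) (by omega)]
        simp [inputState]
      · rw [List.length_finRange]
  · have hM : 0 ≤ 200 * (τ * n * (8000 * d / ε) ^ d) := by positivity
    rw [show 60 * τ * n + mainTime d τ * n + 200 * (τ * n * (8000 * d / ε) ^ d) + 9 =
      1 + (30 * τ * n + (1 + (1 + (mainTime d τ * n + (1 + (1 + (30 * τ * n + (1 +
        ((1 + 200 * (τ * n * (8000 * d / ε) ^ d)) + 2))))))))) by ring]
    repeat rw [ENNReal.ofReal_add (by positivity) (by positivity)]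
    simp only [ENNReal.ofReal_one, ENNReal.ofReal_ofNat, add_zero]
    gcongr
    norm_num

/-- The constant factor in the running time. -/
def timeConst (d : ℕ) : ℝ := 93 + 3624 * (546 * d + 5) ^ d + 200 * (8000 * d) ^ d

theorem approximatesSmallestBall (hd : 1 ≤ d) (hn : 1 ≤ n) (hP : Function.Injective P)
    (hF : IsUpperSet F) (hne : F.Nonempty) (hτ : 1 ≤ τ) (hε : 0 < ε) (hε1 : ε < 1) :
    ApproximatesSmallestBall (smallestBall d) P σ τ ε (timeConst d * τ * (n / ε ^ d)) := by
  have : NeZero d := ⟨by omega⟩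
  obtain ⟨ρ, hρ⟩ := exists_isLeast_ballRadii P hF hne
  have hb := smallestBall_bounded (σ := σ) hd hn hP hF hτ hρ hε hε1
  refine ⟨ρ, hρ, fun s hs => Safe.reaches (fun N => (hb N).2) hs,
    iSup_le fun N => (hb N).1.trans (ENNReal.ofReal_le_ofReal ?_)⟩
  have h1 : (1 : ℝ) ≤ τ * n := by exact_mod_cast Nat.mul_pos hτ hn
  -- Since `ε < 1`, the terms linear in `n` are absorbed into `n / ε ^ d`.
  have h2 : 1 ≤ 1 / ε ^ d := by
    rw [le_div_iff₀ (by positivity), one_mul]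
    exact pow_le_one₀ hε.le hε1.le
  obtain ⟨A, hA, hA1⟩ : ∃ A : ℝ, A = (546 * d + 5) ^ d ∧ 1 ≤ A :=
    ⟨_, rfl, one_le_pow₀ (by linarith [(Nat.cast_nonneg d : (0 : ℝ) ≤ d)])⟩
  have h3 : (mainTime d τ * n : ℝ) ≤ 3600 * A * (τ * n) + 24 * (τ * n) := by
    have h4 : (1 : ℝ) ≤ τ := by exact_mod_cast hτ
    have h5 : (mainTime d τ : ℝ) = 3600 * τ * A + 24 := by
      rw [hA]
      unfold mainTime
      push_cast
      ring
    rw [h5]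
    nlinarith [(Nat.cast_nonneg n : (0 : ℝ) ≤ n)]
  have h4 : τ * n * (8000 * d / ε) ^ d = (8000 * d) ^ d * (τ * n * (1 / ε ^ d)) := by
    rw [div_pow]
    ring
  obtain ⟨X, hX⟩ : ∃ X, X = τ * n * (1 / ε ^ d) := ⟨_, rfl⟩
  have h5 : (τ : ℝ) * n ≤ X := by
    rw [hX]
    exact le_mul_of_one_le_right (by linarith) h2
  have h6 : timeConst d * τ * (n / ε ^ d) = timeConst d * X := by
    rw [hX]
    ring
  rw [h6, h4, ← hX, timeConst, ← hA]
  have h7 : A * (τ * n) ≤ A * X := by gcongr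
  have h8 : 1 * X ≤ A * X := mul_le_mul_of_nonneg_right hA1 (by linarith)
  linarith

end SmallestBall

end RealRAM
-- The two special families and the main theorem.
theorem isUpperSet_countFamily (α : Type) (k : ℕ) : IsUpperSet (countFamily α k) :=
  fun _ _ hAB hA => le_trans hA (Finset.card_le_card hAB)

theorem isUpperSet_colourFamily {α : Type} {K : ℕ} (χ : α → Fin K) (t : ℕ) :
    IsUpperSet (colourFamily χ t) :=
  fun _ _ hAB hA => le_trans hA (Finset.card_le_card (Finset.image_subset_image hAB))

theorem mainTheorem7 (d : ℕ) (hd : 1 ≤ d) :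
    ∃ (p : RealRAM.Prog) (C : ℝ), 0 < C ∧
      ∀ (n : ℕ) (P : Fin n → EuclideanSpace ℝ (Fin d)) (ε : ℝ),
        1 ≤ n → Function.Injective P → 0 < ε → ε < 1 →
        -- every sketchable family whose sketch operations take time `τ`
        (∀ (F : Set (Finset (Fin n))) (S : Type) (σ : Sketching F S) (τ : ℕ),
          IsUpperSet F → F.Nonempty → 1 ≤ τ →
          RealRAM.ApproximatesSmallestBall p P σ τ ε (C * τ * (n / ε ^ d))) ∧
        -- the smallest ball containing `k` points
        (∀ k : ℕ, k ≤ n →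
          RealRAM.ApproximatesSmallestBall p P (countSketching (Fin n) k) 1 ε
            (C * (n / ε ^ d))) ∧
        -- the smallest ball containing `t` of `K` colours
        (∀ (K : ℕ) (χ : Fin n → Fin K) (t : ℕ), t ≤ (Finset.univ.image χ).card →
          RealRAM.ApproximatesSmallestBall p P (colourSketching χ t) K ε
            (C * (n * K / ε ^ d))) := by
  refine ⟨RealRAM.smallestBall d, RealRAM.timeConst d, by unfold RealRAM.timeConst; positivity,
    fun n P ε hn hP hε hε1 => ⟨fun F S σ τ hF hne hτ =>
      RealRAM.approximatesSmallestBall hd hn hP hF hne hτ hε hε1, fun k hk => ?_,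
      fun K χ t ht => ?_⟩⟩
  · have h := RealRAM.approximatesSmallestBall (σ := countSketching (Fin n) k) hd hn hP
      (isUpperSet_countFamily _ k) ⟨Finset.univ, by simpa [countFamily] using hk⟩ le_rfl hε hε1
    simpa using h
  -- There is a point, hence a colour, so `K` is admissible as the cost `τ`.
  · have hK : 1 ≤ K := Fin.pos (χ ⟨0, hn⟩)
    have h := RealRAM.approximatesSmallestBall (σ := colourSketching χ t) hd hn hP
      (isUpperSet_colourFamily χ t) ⟨Finset.univ, ht⟩ hK hε hε1
    rwa [show RealRAM.timeConst d * (n * K / ε ^ d) = RealRAM.timeConst d * K * (n / ε ^ d) by ring]
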